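/- All graphs are finite and simple, and $|G|$ denotes the number of vertices of $G$. The congestion of a graph $H$ is $0$ if $H$ has no edges, and otherwise it is the maximum of $1-\frac{|J|-1}{|E(J)|}$ over all (not necessarily induced) subgraphs $J$ of $H$ with at least one edge. A graph $G$ is $\varepsilon$-sparse if every vertex of $G$ has degree less than $\varepsilon|G|$. An anticomplete pair in $G$ is a pair $A,B$ of disjoint subsets of $V(G)$ such that no vertex of $A$ has a neighbour in $B$; and for $\gamma,\delta\ge 0$, $G$ is $(\gamma,\delta)$-coherent if there is no anticomplete pair $A,B$ in $G$ with $|A|\ge\gamma$ and $|B|\ge\delta$. Theorem. Let $c>0$, and let $H$ be a graph with congestion at most $\frac{c}{9+15c}$. Then there exists $\varepsilon>0$ such that every $\varepsilon$-sparse, $(\varepsilon|G|^{1-c},\varepsilon|G|^{1-c})$-coherent graph $G$ with $|G|>1$ has an induced subgraph isomorphic to $H$. -/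

import Mathlib

namespace PurePairs

/-- The set of the numbers `1 - (|J| - 1) / |E(J)|`, where `J` ranges over the subgraphs
(not necessarily induced) of `H` with at least one edge. -/
def congestionValues {W : Type*} (H : SimpleGraph W) : Set ℝ :=
  {x | ∃ J : H.Subgraph, J.edgeSet.Nonempty ∧
    x = 1 - ((J.verts.ncard : ℝ) - 1) / (J.edgeSet.ncard : ℝ)}

open Classical in
/-- The congestion of a finite graph `H`: the maximum of `1 - (|J| - 1) / |E(J)|` over all
subgraphs `J` of `H` with at least one edge, or zero if `H` has no edge. (The supremum is a
maximum: see `isGreatest_congestion`.) -/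
noncomputable def congestion {W : Type*} (H : SimpleGraph W) : ℝ :=
  if H.edgeSet.Nonempty then sSup (congestionValues H) else 0

theorem isGreatest_congestion {W : Type*} [Finite W] (H : SimpleGraph W)
    (hH : H.edgeSet.Nonempty) : IsGreatest (congestionValues H) (congestion H) := by
  have hfin : (congestionValues H).Finite := by
    have : Finite H.Subgraph :=
      Finite.of_injective (fun J : H.Subgraph => (J.verts, J.Adj)) (by
        intro J K h
        simp only [Prod.mk.injEq] at h
        exact SimpleGraph.Subgraph.ext h.1 h.2)
    refine (Set.finite_range (fun J : H.Subgraph =>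
      1 - ((J.verts.ncard : ℝ) - 1) / (J.edgeSet.ncard : ℝ))).subset ?_
    rintro x ⟨J, -, rfl⟩
    exact ⟨J, rfl⟩
  have hne : (congestionValues H).Nonempty :=
    ⟨_, ⊤, by simpa using hH, rfl⟩
  rw [congestion, if_pos hH]
  exact ⟨hne.csSup_mem hfin, fun x hx => le_csSup hfin.bddAbove hx⟩

/-- `G` is `ε`-sparse: every vertex has degree less than `ε |G|`. -/
def IsSparse {V : Type*} [Fintype V] (G : SimpleGraph V) (ε : ℝ) : Prop :=
  ∀ v : V, ((G.neighborSet v).ncard : ℝ) < ε * (Fintype.card V : ℝ)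

/-- `A, B` is an anticomplete pair: `A` and `B` are disjoint and no vertex of `A` has a
neighbour in `B`. -/
def IsAnticompletePair {V : Type*} (G : SimpleGraph V) (A B : Finset V) : Prop :=
  Disjoint A B ∧ ∀ a ∈ A, ∀ b ∈ B, ¬ G.Adj a b

/-- `G` is `(γ, δ)`-coherent: there is no anticomplete pair `A, B` with `|A| ≥ γ` and
`|B| ≥ δ`. -/
def IsCoherent {V : Type*} (G : SimpleGraph V) (γ δ : ℝ) : Prop :=
  ¬ ∃ A B : Finset V, IsAnticompletePair G A B ∧ γ ≤ (A.card : ℝ) ∧ δ ≤ (B.card : ℝ)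

end PurePairs

/-! Call a family of disjoint vertex sets, each of size at least n^(1-σ) and with low degrees
between them, a blockade. Cutting the vertex set of a sparse graph into equal blocks gives a
blockade of any fixed length. So it suffices to find, in every good enough blockade, an induced copy
of H with at most one vertex in each set. This goes by induction on vertex subsets S of H
(`embeds_of_sparse`); the required parameters are fixed backwards from the target, so each step may
lose a small power of n.

Let k = ⌊1/c⌋ and L = 3k + 5. Small congestion makes every induced subgraph of H have few edges.
Hence H[S] has a vertex of degree at most one, or else it contains a path of length L whose interior
vertices have degree two in H[S]; this is a counting argument on oriented edges (`exists_ear`).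
Delete the leaf or the interior of the path, embed the rest in a sub-blockade, and put the deleted
part back.

A leaf is put back by `exists_private_nbrs`: after shrinking, each vertex of the remaining sets has
a neighbour in a reserved set that sees none of the other remaining sets. Coherence makes the
degrees into the reserved set regular up to a factor n^(-δ), and a greedy choice of neighbours then
covers much of one set and little of the others.

A path is put back by `forces_linked`: in a suitable sub-blockade any two vertices of distinct sets
are joined by a path of length exactly L, induced up to adjacency of its ends, with interior
anticomplete to all other sets. Since (k + 1)c > 1, some vertex of a large set reaches n^(1-c)
vertices through a chain of k sets (`exists_card_lay_ge`). Stopping the exploration just when it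
sees a quarter of some set turns this vertex into a hub: it is joined to a constant fraction of that
set by induced paths of one length, at most k + 1, which miss at least half of every other set
(`exists_hub`). A hub with two chains, followed by private neighbours, joins many vertices x to a
whole sub-blockade by paths of length at most 2k + 3. Making such an x a hub again, with one further
private neighbour, gives links of length at most (2k + 3) + (k + 1) + 1 = L, and private neighbours
lengthen shorter links one edge at a time. -/

namespace PurePairs

/-! ### Neighbourhoods, coherence and induced paths -/

section Basics

open Finset Classical

universe u

variable {V : Type u}

/-- The neighbours of the vertex `v` in `S`. -/
noncomputable def nbr (G : SimpleGraph V) (v : V) (S : Finset V) : Finset V :=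
  S.filter (G.Adj v)

/-- The vertices of `S` with a neighbour in `X`. -/
noncomputable def nbrs (G : SimpleGraph V) (X S : Finset V) : Finset V :=
  S.filter fun s => ∃ x ∈ X, G.Adj x s

theorem mem_nbr {G : SimpleGraph V} {v w : V} {S : Finset V} :
    w ∈ nbr G v S ↔ w ∈ S ∧ G.Adj v w := by simp [nbr]

theorem mem_nbrs {G : SimpleGraph V} {X S : Finset V} {w : V} :
    w ∈ nbrs G X S ↔ w ∈ S ∧ ∃ x ∈ X, G.Adj x w := by simp [nbrs]

theorem nbr_subset (G : SimpleGraph V) (v : V) (S : Finset V) : nbr G v S ⊆ S :=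
  filter_subset _ _

theorem nbrs_subset (G : SimpleGraph V) (X S : Finset V) : nbrs G X S ⊆ S :=
  filter_subset _ _

theorem nbr_mono (G : SimpleGraph V) (v : V) {S T : Finset V} (h : S ⊆ T) :
    nbr G v S ⊆ nbr G v T := filter_subset_filter _ h

theorem nbrs_mono (G : SimpleGraph V) {X Y : Finset V} (h : X ⊆ Y) (S : Finset V) :
    nbrs G X S ⊆ nbrs G Y S := by
  intro w
  simp only [mem_nbrs]
  rintro ⟨hw, x, hx, hxw⟩
  exact ⟨hw, x, h hx, hxw⟩

theorem nbrs_union (G : SimpleGraph V) (X Y S : Finset V) :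
    nbrs G (X ∪ Y) S = nbrs G X S ∪ nbrs G Y S := by
  ext w
  simp only [mem_nbrs, mem_union]
  grind

theorem nbrs_singleton (G : SimpleGraph V) (v : V) (S : Finset V) :
    nbrs G {v} S = nbr G v S := by
  ext w
  simp [mem_nbrs, mem_nbr]

theorem nbrs_empty (G : SimpleGraph V) (S : Finset V) : nbrs G ∅ S = ∅ := by
  ext w
  simp [mem_nbrs]

theorem sum_card_nbr_comm (G : SimpleGraph V) (X Y : Finset V) :
    ∑ v ∈ X, #(nbr G v Y) = ∑ w ∈ Y, #(nbr G w X) := by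
  have := Finset.sum_card_bipartiteAbove_eq_sum_card_bipartiteBelow (s := X) (t := Y) G.Adj
  simp only [bipartiteAbove, bipartiteBelow] at this
  simpa [nbr, G.adj_comm] using this

/-- Any two disjoint sets of at least `γ` vertices are joined by an edge. -/
def Coh (G : SimpleGraph V) (γ : ℝ) : Prop :=
  ∀ A B : Finset V, Disjoint A B → γ ≤ #A → γ ≤ #B → ∃ a ∈ A, ∃ b ∈ B, G.Adj a b

/-- The vertices of `A` without a neighbour in `X` form with `X` a pair without edges, so there are
fewer than `γ` of them. -/
theorem Coh.card_lt {G : SimpleGraph V} {γ : ℝ} (h : Coh G γ) {X A : Finset V}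
    (hd : Disjoint X A) (hX : γ ≤ #X) : (#A : ℝ) < #(nbrs G X A) + γ := by
  by_contra! hc
  have h1 : #(A \ nbrs G X A) + #(nbrs G X A) = #A :=
    card_sdiff_add_card_eq_card (nbrs_subset _ _ _)
  have h2 : γ ≤ #(A \ nbrs G X A) := by
    have : (#(A \ nbrs G X A) : ℝ) + #(nbrs G X A) = #A := by exact_mod_cast h1
    linarith
  obtain ⟨a, ha, b, hb, hab⟩ := h X (A \ nbrs G X A) (hd.mono_right sdiff_subset) hX h2
  simp only [mem_sdiff, mem_nbrs] at hb
  exact hb.2 ⟨hb.1, a, ha, hab⟩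

/-- `p 0, …, p ℓ` are the vertices of an induced path, in order. -/
def IndPath (G : SimpleGraph V) (p : ℕ → V) (ℓ : ℕ) : Prop :=
  ∀ a b, a < b → b ≤ ℓ → p a ≠ p b ∧ (G.Adj (p a) (p b) ↔ b = a + 1)

/-- A shortest subsequence that keeps both ends and has consecutive terms adjacent is induced, since
a chord would shorten it. Keeping the increasing index map `c` preserves the information on which
set each vertex comes from. -/
theorem exists_indPath_of_seq (G : SimpleGraph V) (q : ℕ → V) (L : ℕ)
    (hinj : ∀ a b, a < b → b ≤ L → q a ≠ q b) (hadj : ∀ a < L, G.Adj (q a) (q (a + 1))) :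
    ∃ (L' : ℕ) (c : ℕ → ℕ), L' ≤ L ∧ c 0 = 0 ∧ c L' = L ∧
      (∀ a b, a < b → b ≤ L' → c a < c b) ∧ IndPath G (fun a => q (c a)) L' := by
  let Q : ℕ → Prop := fun L' => ∃ c : ℕ → ℕ, c 0 = 0 ∧ c L' = L ∧
      (∀ a b, a < b → b ≤ L' → c a < c b) ∧ ∀ a < L', G.Adj (q (c a)) (q (c (a + 1)))
  have hQ : ∃ L', Q L' := ⟨L, id, rfl, rfl, fun a b h _ => h, hadj⟩
  obtain ⟨c, c0, cL, cm, ca⟩ := Nat.find_spec hQ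
  set L' := Nat.find hQ with hL'
  have hle : L' ≤ L := Nat.find_min' hQ ⟨id, rfl, rfl, fun a b h _ => h, hadj⟩
  refine ⟨L', c, hle, c0, cL, cm, ?_⟩
  intro a b hab hb
  have hcb : c b ≤ L := by
    rcases hb.lt_or_eq with h | h
    · exact (cm b L' h le_rfl).le.trans_eq cL
    · rw [h, cL]
  refine ⟨hinj _ _ (cm a b hab hb) hcb, ?_⟩
  constructor
  · intro hadj'
    by_contra hne
    have hlt : L' - (b - a - 1) < L' := by omega
    refine Nat.find_min hQ hlt ⟨fun i => if i ≤ a then c i else c (i + (b - a - 1)), ?_, ?_, ?_, ?_⟩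
    · simp [c0]
    · have h1 : ¬ (L' - (b - a - 1) ≤ a) := by omega
      have h2 : L' - (b - a - 1) + (b - a - 1) = L' := by omega
      simp only [h1, if_false, h2, cL]
    · intro i j hij hj
      by_cases hi : i ≤ a <;> by_cases hj' : j ≤ a
      · simp only [hi, hj', if_true]; exact cm _ _ hij (by omega)
      · simp only [hi, hj', if_true, if_false]; exact cm _ _ (by omega) (by omega)
      · omega
      · simp only [hi, hj', if_false]; exact cm _ _ (by omega) (by omega)
    · intro i hi
      by_cases h1 : i ≤ a <;> by_cases h2 : i + 1 ≤ a
      · simp only [h1, h2, if_true]; exact ca _ (by omega)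
      · have : i = a := by omega
        subst this
        have h3 : i + 1 + (b - i - 1) = b := by omega
        simp only [le_refl, h2, if_true, if_false, h3]
        exact hadj'
      · omega
      · have h3 : i + 1 + (b - a - 1) = i + (b - a - 1) + 1 := by omega
        simp only [h1, h2, if_false, h3]; exact ca _ (by omega)
  · rintro rfl
    exact ca a (by omega)

end Basics

/-! ### Reaching many vertices through a chain of sets -/

section Hub

open Finset Classical

universe u

variable {V : Type u}

/-- The vertices that can be reached from `X` through `C 0, …, C (i - 1)`, in this order
(some may be skipped). -/
noncomputable def reach (G : SimpleGraph V) (C : ℕ → Finset V) (X : Finset V) : ℕ → Finset V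
  | 0 => X
  | i + 1 => reach G C X i ∪ nbrs G (reach G C X i) (C i)

/-- The vertices that are reached from `X` in the `i`-th step. -/
noncomputable def lay (G : SimpleGraph V) (C : ℕ → Finset V) (X : Finset V) : ℕ → Finset V
  | 0 => X
  | i + 1 => nbrs G (reach G C X i) (C i)

theorem lay_subset_reach (G : SimpleGraph V) (C : ℕ → Finset V) (X : Finset V) (i : ℕ) :
    lay G C X i ⊆ reach G C X i := by
  cases i with
  | zero => exact Subset.rfl
  | succ i => exact subset_union_right

theorem reach_union (G : SimpleGraph V) (C : ℕ → Finset V) (X Y : Finset V) (i : ℕ) :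
    reach G C (X ∪ Y) i = reach G C X i ∪ reach G C Y i := by
  induction i with
  | zero => rfl
  | succ i ih =>
    simp only [reach, ih, nbrs_union]
    ext; simp only [mem_union]; tauto

theorem lay_union (G : SimpleGraph V) (C : ℕ → Finset V) (X Y : Finset V) (i : ℕ) :
    lay G C (X ∪ Y) i = lay G C X i ∪ lay G C Y i := by
  cases i with
  | zero => rfl
  | succ i => simp only [lay, reach_union, nbrs_union]

theorem reach_empty (G : SimpleGraph V) (C : ℕ → Finset V) (i : ℕ) : reach G C ∅ i = ∅ := by
  induction i with
  | zero => rfl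
  | succ i ih => simp [reach, ih, nbrs_empty]

theorem lay_empty (G : SimpleGraph V) (C : ℕ → Finset V) (i : ℕ) : lay G C ∅ i = ∅ := by
  cases i with
  | zero => rfl
  | succ i => simp [lay, reach_empty, nbrs_empty]

/-- Cut `X` into `t + 1` parts of size at most `s`; by subadditivity they cannot all have value
below `g`. -/
theorem exists_small_part (f : Finset V → ℕ) (hf : ∀ X Y, f (X ∪ Y) ≤ f X + f Y) (s g : ℕ) :
    ∀ (t : ℕ) (X : Finset V), #X ≤ (t + 1) * s → (t + 1) * g ≤ f X →
      ∃ X' ⊆ X, #X' ≤ s ∧ g ≤ f X' := by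
  intro t
  induction t with
  | zero => intro X h1 h2; exact ⟨X, Subset.rfl, by simpa using h1, by simpa using h2⟩
  | succ t ih =>
    intro X h1 h2
    obtain ⟨X1, hX1, hc⟩ := exists_subset_card_eq (min_le_right s #X)
    by_cases hg : g ≤ f X1
    · exact ⟨X1, hX1, by omega, hg⟩
    have h3 : f X ≤ f X1 + f (X \ X1) := by
      conv_lhs => rw [← union_sdiff_of_subset hX1]
      exact hf _ _
    have h4 : #(X \ X1) + #X1 = #X := card_sdiff_add_card_eq_card hX1
    obtain ⟨X', hX', h5, h6⟩ := ih (X \ X1) (by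
      rw [add_mul, one_mul] at h1 ⊢
      rw [add_mul] at h1
      rcases le_total s #X with h | h
      · rw [min_eq_left h] at hc; omega
      · rw [min_eq_right h] at hc
        have : #(X \ X1) = 0 := by omega
        rw [this]; exact Nat.zero_le _) (by
      rw [add_mul, one_mul] at h2
      omega)
    exact ⟨X', hX'.trans sdiff_subset, h5, h6⟩

/-- Some vertex of a large set `D` reaches a large part of the last set of a chain of large sets. -/
theorem exists_card_lay_ge {G : SimpleGraph V} {γ : ℝ} (hγ : 0 < γ) (hG : Coh G γ)
    (C : ℕ → Finset V) (k t : ℕ) (D : Finset V)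
    (hC : ∀ i < k, (t + 2) * ⌈γ⌉₊ ≤ #(C i)) (hD : γ ≤ #D) (ht : ⌈γ⌉₊ ≤ (t + 1) ^ k)
    (hDC : ∀ i < k, Disjoint D (C i)) (hCC : ∀ i < k, ∀ j < k, i ≠ j → Disjoint (C i) (C j)) :
    ∃ z ∈ D, γ ≤ #(lay G C {z} k) := by
  -- Each new layer is more than `t + 1` times as large as needed, so it suffices to keep one of `t
  -- + 1` parts of the sources. After `k` layers at most one source is left.
  have key : ∀ j ≤ k, ∃ X ⊆ D, #X ≤ (t + 1) ^ (k - j) ∧ γ ≤ #(lay G C X j) := by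
    intro j
    induction j with
    | zero =>
      intro _
      obtain ⟨X, hX, hc⟩ := exists_subset_card_eq (Nat.ceil_le.2 hD)
      refine ⟨X, hX, by rw [hc]; simpa using ht, ?_⟩
      simp only [lay, hc]
      exact Nat.le_ceil γ
    | succ j ih =>
      intro hj
      obtain ⟨X, hXD, hXc, hXl⟩ := ih (by omega)
      have hdis : Disjoint (lay G C X j) (C j) := by
        cases j with
        | zero => exact (hDC 0 (by omega)).mono_left hXD
        | succ j => exact (hCC j (by omega) (j + 1) (by omega) (by omega)).mono_left
                      (nbrs_subset _ _ _)
      have h1 := hG.card_lt hdis hXl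
      have h2 : #(nbrs G (lay G C X j) (C j)) ≤ #(lay G C X (j + 1)) :=
        card_le_card (nbrs_mono G (lay_subset_reach _ _ _ _) _)
      have h3 : (t + 1) * ⌈γ⌉₊ ≤ #(lay G C X (j + 1)) := by
        have h4 : ((t + 2) * ⌈γ⌉₊ : ℝ) ≤ #(C j) := by exact_mod_cast hC j (by omega)
        have h5 : γ ≤ ⌈γ⌉₊ := Nat.le_ceil γ
        have h6 : (#(nbrs G (lay G C X j) (C j)) : ℝ) ≤ #(lay G C X (j + 1)) := by
          exact_mod_cast h2
        have : ((t + 1) * ⌈γ⌉₊ : ℝ) ≤ #(lay G C X (j + 1)) := by linarith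
        exact_mod_cast this
      obtain ⟨X', hX', h4, h5⟩ := exists_small_part (fun X => #(lay G C X (j + 1)))
        (fun X Y => by simp only [lay_union]; exact card_union_le _ _)
        ((t + 1) ^ (k - (j + 1))) ⌈γ⌉₊ t X (by
          rw [← pow_succ']
          have : k - (j + 1) + 1 = k - j := by omega
          rwa [this]) h3
      exact ⟨X', hX'.trans hXD, h4, (Nat.le_ceil γ).trans (by exact_mod_cast h5)⟩
  obtain ⟨X, hX, h1, h2⟩ := key k le_rfl
  simp only [Nat.sub_self, pow_zero] at h1
  rcases Nat.le_one_iff_eq_zero_or_eq_one.1 h1 with h | h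
  · rw [card_eq_zero.1 h, lay_empty] at h2
    simp at h2; linarith
  · obtain ⟨z, rfl⟩ := card_eq_one.1 h
    exact ⟨z, hX (mem_singleton_self z), h2⟩

/-- Trace `u` back through the steps at which vertices were added. Each `C i` is used at most once
and in order, so the indices `c` increase; the value `c 0` carries no meaning. -/
theorem exists_seq_of_mem_reach (G : SimpleGraph V) (C : ℕ → Finset V) (z : V) (i : ℕ) :
    ∀ u ∈ reach G C {z} i, ∃ (L : ℕ) (q : ℕ → V) (c : ℕ → ℕ), L ≤ i ∧ q 0 = z ∧ q L = u ∧
      (∀ a ≤ L, q a ∈ reach G C {z} i) ∧ (∀ a < L, G.Adj (q a) (q (a + 1))) ∧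
      (∀ a, 0 < a → a ≤ L → q a ∈ C (c a) ∧ c a < i) ∧
      (∀ a b, 0 < a → a < b → b ≤ L → c a < c b) := by
  induction i with
  | zero =>
    intro u hu
    refine ⟨0, fun _ => z, id, le_rfl, rfl, ?_, ?_, ?_, ?_, ?_⟩
    · simpa [reach, eq_comm] using hu
    · intro a _; simp [reach]
    · intro a ha; omega
    · intro a h1 h2; omega
    · intro a b h1 h2 h3; omega
  | succ i ih =>
    intro u hu
    rw [reach, mem_union] at hu
    rcases hu with hu | hu
    · obtain ⟨L, q, c, h1, h2, h3, h4, h5, h6, h7⟩ := ih u hu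
      exact ⟨L, q, c, by omega, h2, h3, fun a ha => mem_union_left _ (h4 a ha), h5,
        fun a ha hb => ⟨(h6 a ha hb).1, by have := (h6 a ha hb).2; omega⟩, h7⟩
    · obtain ⟨huC, w, hw, hwu⟩ := mem_nbrs.1 hu
      obtain ⟨L, q, c, h1, h2, h3, h4, h5, h6, h7⟩ := ih w hw
      refine ⟨L + 1, fun a => if a ≤ L then q a else u, fun a => if a ≤ L then c a else i,
        by omega, by simp [h2], by simp, ?_, ?_, ?_, ?_⟩
      · intro a ha
        by_cases h : a ≤ L
        · simp only [h, if_true]; exact mem_union_left _ (h4 a h)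
        · simp only [h, if_false]; exact mem_union_right _ hu
      · intro a ha
        by_cases h : a + 1 ≤ L
        · have h' : a ≤ L := by omega
          simp only [h, h', if_true]; exact h5 a (by omega)
        · have h' : a = L := by omega
          subst h'
          simpa [h3] using hwu
      · intro a ha hb
        by_cases h : a ≤ L
        · simp only [h, if_true]
          exact ⟨(h6 a ha h).1, by have := (h6 a ha h).2; omega⟩
        · simp only [h, if_false]; exact ⟨huC, by omega⟩
      · intro a b ha hab hb
        have h' : a ≤ L := by omega
        by_cases h : b ≤ L
        · simp only [h, h', if_true]; exact h7 a b ha hab h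
        · simp only [h, h', if_true, if_false]; exact (h6 a ha h').2

end Hub

end PurePairs

namespace PurePairs

/-! ### From a reaching vertex to a hub -/

section Hub

open Finset Classical

universe u

variable {V : Type u}

/-- A traced sequence ending at a neighbour of `v` has distinct vertices because the sets are
disjoint, and can be shortened to an induced path. Only a part `T` of the last layer is allowed,
because only the neighbourhood of `reach G C {z} j ∪ T` will be controlled. -/
theorem indPath_to_nbr {G : SimpleGraph V} {C : ℕ → Finset V} {z : V} {k j : ℕ} (hj : j < k)
    (hz : ∀ i < k, z ∉ C i) (hCC : ∀ i < k, ∀ j < k, i ≠ j → Disjoint (C i) (C j))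
    {T : Finset V} (hT : T ⊆ lay G C {z} (j + 1)) {v : V} (hvz : v ≠ z) (hv : ∀ i < k, v ∉ C i)
    (hX : ∃ x ∈ reach G C {z} j ∪ T, G.Adj x v) :
    ∃ (r : ℕ) (p : ℕ → V) (c : ℕ → ℕ), 1 ≤ r ∧ r ≤ k + 1 ∧ IndPath G p r ∧ p 0 = z ∧ p r = v ∧
      (∀ a, 0 < a → a < r → p a ∈ C (c a) ∧ c a < k) ∧
      (∀ a b, 0 < a → a < b → b < r → c a < c b) ∧
      (∀ a < r, p a ∈ reach G C {z} j ∪ T) := by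
  obtain ⟨u, hu, huv⟩ := hX
  have hseq : ∃ (L : ℕ) (q : ℕ → V) (c : ℕ → ℕ), L ≤ j + 1 ∧ q 0 = z ∧ q L = u ∧
      (∀ a ≤ L, q a ∈ reach G C {z} j ∪ T) ∧ (∀ a < L, G.Adj (q a) (q (a + 1))) ∧
      (∀ a, 0 < a → a ≤ L → q a ∈ C (c a) ∧ c a < j + 1) ∧
      (∀ a b, 0 < a → a < b → b ≤ L → c a < c b) := by
    rw [mem_union] at hu
    rcases hu with hu | huT
    · obtain ⟨L, q, c, h1, h2, h3, h4, h5, h6, h7⟩ := exists_seq_of_mem_reach G C z j u hu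
      exact ⟨L, q, c, by omega, h2, h3, fun a ha => mem_union_left _ (h4 a ha), h5,
        fun a ha hb => ⟨(h6 a ha hb).1, by have := (h6 a ha hb).2; omega⟩, h7⟩
    · obtain ⟨huC, w, hw, hwu⟩ := mem_nbrs.1 (hT huT)
      obtain ⟨L, q, c, h1, h2, h3, h4, h5, h6, h7⟩ := exists_seq_of_mem_reach G C z j w hw
      refine ⟨L + 1, fun a => if a ≤ L then q a else u, fun a => if a ≤ L then c a else j,
        by omega, by simp [h2], by simp, ?_, ?_, ?_, ?_⟩
      · intro a ha
        by_cases h : a ≤ L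
        · simp only [h, if_true]; exact mem_union_left _ (h4 a h)
        · simp only [h, if_false]; exact mem_union_right _ huT
      · intro a ha
        by_cases h : a + 1 ≤ L
        · have h' : a ≤ L := by omega
          simp only [h, h', if_true]; exact h5 a (by omega)
        · have h' : a = L := by omega
          subst h'
          simpa [h3] using hwu
      · intro a ha hb
        by_cases h : a ≤ L
        · simp only [h, if_true]
          exact ⟨(h6 a ha h).1, by have := (h6 a ha h).2; omega⟩
        · simp only [h, if_false]; exact ⟨huC, by omega⟩
      · intro a b ha hab hb
        have h' : a ≤ L := by omega
        by_cases h : b ≤ L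
        · simp only [h, h', if_true]; exact h7 a b ha hab h
        · simp only [h, h', if_true, if_false]; exact (h6 a ha h').2
  obtain ⟨L, q, c, h1, h2, h3, h4, h5, h6, h7⟩ := hseq
  let q' : ℕ → V := fun a => if a ≤ L then q a else v
  have hq' : ∀ a ≤ L, q' a = q a := fun a ha => by simp [q', ha]
  have hqL : q' (L + 1) = v := by simp [q']
  obtain ⟨r, d, hr, d0, dr, dm, hp⟩ := exists_indPath_of_seq G q' (L + 1) (by
      intro a b hab hb
      rcases hb.lt_or_eq with hb' | rfl
      · rw [hq' a (by omega), hq' b (by omega)]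
        have hbC := h6 b (by omega) (by omega)
        rcases Nat.eq_zero_or_pos a with rfl | ha
        · rw [h2]
          rintro rfl
          exact hz _ (by omega) hbC.1
        · have haC := h6 a ha (by omega)
          have hlt := h7 a b ha hab (by omega)
          intro he
          rw [he] at haC
          exact disjoint_left.1 (hCC _ (by omega) _ (by omega) hlt.ne) haC.1 hbC.1
      · rw [hq' a (by omega), hqL]
        rcases Nat.eq_zero_or_pos a with rfl | ha
        · rw [h2]; exact hvz.symm
        · have haC := h6 a ha (by omega)
          rintro rfl
          exact hv _ (by omega) haC.1) (by
      intro a ha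
      rcases Nat.lt_or_ge a L with h | h
      · rw [hq' a (by omega), hq' (a + 1) (by omega)]; exact h5 a h
      · have : a = L := by omega
        subst this
        rw [hq' a le_rfl, hqL, h3]; exact huv)
  have hdL : ∀ a < r, d a ≤ L := by
    intro a ha
    have := dm a r ha le_rfl
    omega
  have hd0 : ∀ a, 0 < a → a ≤ r → 0 < d a := by
    intro a ha hb
    have := dm 0 a ha hb
    omega
  refine ⟨r, fun a => q' (d a), fun a => c (d a), ?_, by omega, hp, ?_, ?_, ?_, ?_, ?_⟩
  · rcases Nat.eq_zero_or_pos r with rfl | h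
    · omega
    · exact h
  · simp only [d0, hq' 0 (Nat.zero_le _), h2]
  · simp only [dr, hqL]
  · intro a ha hb
    have := hdL a hb
    simp only [hq' _ this]
    have := h6 (d a) (hd0 a ha hb.le) this
    exact ⟨this.1, by omega⟩
  · intro a b ha hab hb
    exact h7 _ _ (hd0 a ha (by omega)) (dm a b hab hb.le) (hdL b hb)
  · intro a ha
    simp only [hq' _ (hdL a ha)]
    exact h4 _ (hdL a ha)

theorem exists_large_fiber {α β : Type*} (s : Finset α) (t : Finset β) (f : α → β)
    (hf : ∀ a ∈ s, f a ∈ t) (ht : t.Nonempty) :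
    ∃ y ∈ t, #s ≤ #t * #(s.filter fun x => f x = y) := by
  by_contra! h
  have h1 : #s = ∑ y ∈ t, #(s.filter fun x => f x = y) := card_eq_sum_card_fiberwise hf
  have h2 : ∑ y ∈ t, #t * #(s.filter fun x => f x = y) < ∑ _y ∈ t, #s :=
    sum_lt_sum_of_nonempty ht h
  rw [← mul_sum, ← h1, sum_const, smul_eq_mul] at h2
  exact lt_irrefl _ h2

/-- A vertex that reaches a large set through a chain is joined to a constant fraction of some set
of a family by induced paths of the same length, whose vertices have no neighbours in most of
the rest of the family. -/
theorem exists_hub {G : SimpleGraph V} {γ : ℝ} (hγ : 0 < γ) (hG : Coh G γ) {C : ℕ → Finset V}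
    {z : V} {k : ℕ} (hz : ∀ i < k, z ∉ C i)
    (hCC : ∀ i < k, ∀ j < k, i ≠ j → Disjoint (C i) (C j)) (hlay : γ ≤ #(lay G C {z} k))
    {ι : Type*} [Nonempty ι] (A : ι → Finset V) (hA : ∀ i, 2 * γ ≤ #(A i))
    (hzA : ∀ i, z ∉ A i) (hCA : ∀ i, ∀ j < k, Disjoint (C j) (A i))
    (hlz : ∀ i, 8 * #(nbr G z (A i)) ≤ #(A i))
    (hlC : ∀ j < k, ∀ u ∈ C j, ∀ i, 8 * #(nbr G u (A i)) ≤ #(A i)) :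
    ∃ (m : ι) (r : ℕ) (A' : ι → Finset V), 1 ≤ r ∧ r ≤ k + 1 ∧ (∀ i, A' i ⊆ A i) ∧
      (∀ i, i ≠ m → #(A i) ≤ 2 * #(A' i)) ∧ #(A m) ≤ 4 * (k + 1) * #(A' m) ∧
      ∀ v ∈ A' m, ∃ (p : ℕ → V) (c : ℕ → ℕ), IndPath G p r ∧ p 0 = z ∧ p r = v ∧
        (∀ a, 0 < a → a < r → p a ∈ C (c a) ∧ c a < k) ∧
        (∀ a b, 0 < a → a < b → b < r → c a < c b) ∧
        (∀ a < r, ∀ i, i ≠ m → ∀ u ∈ A' i, ¬ G.Adj (p a) u) := by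
  have hApos : ∀ i, 0 < #(A i) := by
    intro i
    have := hA i
    have : (0 : ℝ) < #(A i) := by linarith
    exact_mod_cast this
  -- A set hits when its neighbours fill at least a quarter of some `A m`. By coherence the final
  -- reached set hits, as it misses fewer than `γ` vertices of any `A m`.
  let Hit : Finset V → Prop := fun X => ∃ m, #(A m) ≤ 4 * #(nbrs G X (A m))
  have hreach_sub : ∀ i ≤ k, ∀ u ∈ reach G C {z} i, u = z ∨ ∃ j < k, u ∈ C j := by
    intro i
    induction i with
    | zero => intro _ u hu; left; simpa [reach] using hu
    | succ i ih =>
      intro hi u hu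
      rw [reach, mem_union] at hu
      rcases hu with hu | hu
      · exact ih (by omega) u hu
      · exact Or.inr ⟨i, by omega, nbrs_subset _ _ _ hu⟩
  have hitk : Hit (reach G C {z} k) := by
    obtain ⟨m⟩ := ‹Nonempty ι›
    refine ⟨m, ?_⟩
    have hd : Disjoint (reach G C {z} k) (A m) := by
      rw [disjoint_left]
      intro u hu huA
      rcases hreach_sub k le_rfl u hu with rfl | ⟨j, hj, huC⟩
      · exact hzA m huA
      · exact disjoint_left.1 (hCA m j hj) huC huA
    have h1 := hG.card_lt hd (hlay.trans (by exact_mod_cast card_le_card (lay_subset_reach _ _ _ _)))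
    have h2 := hA m
    have : (#(A m) : ℝ) ≤ 4 * #(nbrs G (reach G C {z} k) (A m)) := by linarith
    exact_mod_cast this
  have hex : ∃ j, Hit (reach G C {z} j) := ⟨k, hitk⟩
  -- Stop at the first step that hits. It is not step zero, because `z` alone sees at most an eighth
  -- of each set.
  obtain ⟨j0, hj0, hj0min⟩ : ∃ j0, Hit (reach G C {z} j0) ∧ ∀ i < j0, ¬ Hit (reach G C {z} i) :=
    ⟨Nat.find hex, Nat.find_spec hex, fun i hi => Nat.find_min hex hi⟩
  have hj0k : j0 ≤ k := by
    by_contra! h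
    exact hj0min k h hitk
  cases j0 with
  | zero =>
    obtain ⟨m, hm⟩ := hj0
    simp only [reach, nbrs_singleton] at hm
    have := hlz m
    have := hApos m
    omega
  | succ j =>
    set S := reach G C {z} j with hS
    have hSn : ¬ Hit S := hj0min j (by omega)
    -- Choose as few vertices of the last layer as still produce a hit. Without one of them no set
    -- is covered up to a quarter, and that one adds at most an eighth, so every set keeps at least
    -- half of its vertices unseen.
    obtain ⟨T, hT, hTmin⟩ := Finset.exists_min_image
      ((lay G C {z} (j + 1)).powerset.filter fun T => Hit (S ∪ T)) card
      ⟨lay G C {z} (j + 1), by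
        simp only [mem_filter, mem_powerset]; exact ⟨Subset.rfl, hj0⟩⟩
    simp only [mem_filter, mem_powerset] at hT hTmin
    obtain ⟨hTs, m, hm⟩ := hT
    have hTne : T.Nonempty := by
      rw [nonempty_iff_ne_empty]
      rintro rfl
      exact hSn ⟨m, by simpa using hm⟩
    obtain ⟨t, ht⟩ := hTne
    have hnot : ¬ Hit (S ∪ T.erase t) := by
      intro h
      have := hTmin (T.erase t) ⟨(erase_subset _ _).trans hTs, h⟩
      have := card_erase_lt_of_mem ht
      omega
    have hXt : S ∪ T = (S ∪ T.erase t) ∪ {t} := by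
      conv_lhs => rw [← insert_erase ht]
      ext; simp only [mem_union, mem_insert, mem_singleton]; tauto
    have htC : t ∈ C j := nbrs_subset _ _ _ (hTs ht)
    have hprot : ∀ i, 2 * #(nbrs G (S ∪ T) (A i)) ≤ #(A i) := by
      intro i
      have h1 : ¬ #(A i) ≤ 4 * #(nbrs G (S ∪ T.erase t) (A i)) := fun h => hnot ⟨i, h⟩
      have h2 := hlC j (by omega) t htC i
      have h3 : #(nbrs G (S ∪ T) (A i)) ≤
          #(nbrs G (S ∪ T.erase t) (A i)) + #(nbr G t (A i)) := by
        rw [hXt, nbrs_union, nbrs_singleton]; exact card_union_le _ _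
      omega
    have hpath : ∀ v ∈ nbrs G (S ∪ T) (A m), ∃ (r : ℕ) (p : ℕ → V) (c : ℕ → ℕ), 1 ≤ r ∧
        r ≤ k + 1 ∧ IndPath G p r ∧ p 0 = z ∧ p r = v ∧
        (∀ a, 0 < a → a < r → p a ∈ C (c a) ∧ c a < k) ∧
        (∀ a b, 0 < a → a < b → b < r → c a < c b) ∧ (∀ a < r, p a ∈ S ∪ T) := by
      intro v hv
      obtain ⟨hvA, hv⟩ := mem_nbrs.1 hv
      refine indPath_to_nbr (by omega) hz hCC hTs ?_ ?_ hv
      · rintro rfl; exact hzA m hvA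
      · intro i hi hvC; exact disjoint_left.1 (hCA m i hi) hvC hvA
    choose! rr pp cc hpp using hpath
    -- The path lengths lie in `1, …, k + 1`; keeping the most frequent one costs a factor `k + 1`.
    obtain ⟨r, hr, hrc⟩ := exists_large_fiber (nbrs G (S ∪ T) (A m)) (Finset.Icc 1 (k + 1)) rr
      (fun v hv => mem_Icc.2 ⟨(hpp v hv).1, (hpp v hv).2.1⟩) ⟨1, by simp⟩
    rw [mem_Icc] at hr
    rw [Nat.card_Icc, Nat.add_sub_cancel] at hrc
    refine ⟨m, r, fun i => if i = m then (nbrs G (S ∪ T) (A m)).filter (fun v => rr v = r) else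
      A i \ nbrs G (S ∪ T) (A i), hr.1, hr.2, ?_, ?_, ?_, ?_⟩
    · intro i
      by_cases h : i = m
      · subst h
        simp only [if_true]
        exact (filter_subset _ _).trans (nbrs_subset _ _ _)
      · simp only [h, if_false]; exact sdiff_subset
    · intro i hi
      simp only [hi, if_false]
      have := hprot i
      have h4 : #(A i \ nbrs G (S ∪ T) (A i)) + #(nbrs G (S ∪ T) (A i)) = #(A i) :=
        card_sdiff_add_card_eq_card (nbrs_subset _ _ _)
      omega
    · simp only [if_true]
      calc #(A m) ≤ 4 * #(nbrs G (S ∪ T) (A m)) := hm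
        _ ≤ 4 * ((k + 1) * #((nbrs G (S ∪ T) (A m)).filter fun v => rr v = r)) :=
          Nat.mul_le_mul_left _ (by convert hrc)
        _ = _ := by ring
    · intro v hv
      simp only [if_true, mem_filter] at hv
      obtain ⟨hvN, hvr⟩ := hv
      obtain ⟨-, -, h3, h4, h5, h6, h7, h8⟩ := hpp v hvN
      rw [hvr] at h3 h5 h6 h7 h8
      refine ⟨pp v, cc v, h3, h4, h5, h6, h7, ?_⟩
      intro a ha i hi u hu hau
      simp only [hi, if_false, mem_sdiff, mem_nbrs] at hu
      exact hu.2 ⟨hu.1, _, h8 a ha, hau⟩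

end Hub

end PurePairs

namespace PurePairs

/-! ### Covering one set while sparing others, and regularising degrees -/

section Hits

open Finset Classical

universe u

variable {V : Type u}

/-- Greedy choice of `W`: it covers a good part of `A`, and little of the protected sets. -/
theorem exists_cover {G : SimpleGraph V} {ι : Type*} (P : Finset ι) (Y : ι → Finset V)
    (A M : Finset V) {E ψ : ℝ} (hE : 0 < E) (hψ : 0 < ψ) (hψ1 : ψ ≤ 1) (hA : A.Nonempty)
    (hY : ∀ k ∈ P, (Y k).Nonempty)
    (hcost : ∀ w ∈ M, ∑ k ∈ P, (#(nbr G w (Y k)) : ℝ) / #(Y k) ≤ 1 / 8)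
    (hup : ∀ k ∈ P, ∀ v ∈ Y k, (#(nbr G v M) : ℝ) ≤ E)
    (hlow : ∀ U ⊆ A, (#A : ℝ) ≤ 2 * #U → 1 / 2 * ψ * E * #U ≤ ∑ v ∈ U, (#(nbr G v M) : ℝ)) :
    ∃ W ⊆ M, (∀ k ∈ P, 4 * #(nbrs G W (Y k)) ≤ #(Y k)) ∧
      ψ * #A ≤ 64 * (#P + 1) * #(nbrs G W A) := by
  set cost : Finset V → ℝ := fun W => ∑ k ∈ P, (#(nbrs G W (Y k)) : ℝ) / #(Y k) with hcostdef
  -- A price per unit of cost, below the ratio of total gain to total cost over `M` found by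
  -- averaging. The `+ 1` keeps it defined when `P` is empty.
  set β : ℝ := ψ * #A / (8 * (#P + 1)) with hβ
  have hApos : (0 : ℝ) < #A := by exact_mod_cast hA.card_pos
  have hPpos : (0 : ℝ) < #P + 1 := by positivity
  have hβpos : 0 < β := by positivity
  have hYpos : ∀ k ∈ P, (0 : ℝ) < #(Y k) := fun k hk => by exact_mod_cast (hY k hk).card_pos
  have hcost0 : ∀ W, 0 ≤ cost W := fun W => sum_nonneg fun k _ => by positivity
  obtain ⟨W, hW, hWmax⟩ := Finset.exists_max_image
    (M.powerset.filter fun W => cost W ≤ 1 / 4 ∧ β * cost W ≤ #(nbrs G W A)) card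
    ⟨∅, by simp [hcostdef, nbrs_empty]⟩
  simp only [mem_filter, mem_powerset] at hW hWmax
  obtain ⟨hWM, hW4, hWβ⟩ := hW
  refine ⟨W, hWM, ?_, ?_⟩
  · intro k hk
    have h1 : (#(nbrs G W (Y k)) : ℝ) / #(Y k) ≤ cost W :=
      single_le_sum (f := fun k => (#(nbrs G W (Y k)) : ℝ) / #(Y k))
        (fun i _ => by positivity) hk
    have h2 : (#(nbrs G W (Y k)) : ℝ) / #(Y k) ≤ 1 / 4 := h1.trans hW4
    rw [div_le_iff₀ (hYpos k hk)] at h2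
    have : (4 * #(nbrs G W (Y k)) : ℝ) ≤ #(Y k) := by linarith
    exact_mod_cast this
  · by_cases hhalf : (#A : ℝ) ≤ 2 * #(nbrs G W A)
    · have h1 : (1 : ℝ) ≤ #P + 1 := by linarith [Nat.cast_nonneg (α := ℝ) #P]
      have h2 : (0 : ℝ) ≤ #(nbrs G W A) := by positivity
      nlinarith
    push Not at hhalf
    set U := A \ nbrs G W A with hU
    have hUc : (#U : ℝ) + #(nbrs G W A) = #A := by
      exact_mod_cast card_sdiff_add_card_eq_card (nbrs_subset G W A)
    have hgain := hlow U sdiff_subset (by linarith)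
    have hswap : ∑ v ∈ U, (#(nbr G v M) : ℝ) = ∑ w ∈ M, (#(nbr G w U) : ℝ) := by
      exact_mod_cast sum_card_nbr_comm G U M
    -- Double counting: over `M` the total gain is at least `ψ E |A| / 4`, and the total cost is at
    -- most `|P| E`. So some `w` gains more than its price.
    have hex : ∃ w ∈ M, β * ∑ k ∈ P, (#(nbr G w (Y k)) : ℝ) / #(Y k) < #(nbr G w U) := by
      by_contra! hno
      have h1 : ∑ w ∈ M, (#(nbr G w U) : ℝ) ≤
          β * ∑ w ∈ M, ∑ k ∈ P, (#(nbr G w (Y k)) : ℝ) / #(Y k) := by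
        rw [mul_sum]; exact sum_le_sum hno
      have h2 : ∑ w ∈ M, ∑ k ∈ P, (#(nbr G w (Y k)) : ℝ) / #(Y k) ≤ #P * E := by
        rw [sum_comm, ← nsmul_eq_mul]
        refine sum_le_card_nsmul _ _ _ fun k hk => ?_
        rw [← sum_div, div_le_iff₀ (hYpos k hk)]
        have h3 : ∑ w ∈ M, (#(nbr G w (Y k)) : ℝ) = ∑ v ∈ Y k, (#(nbr G v M) : ℝ) := by
          exact_mod_cast sum_card_nbr_comm G M (Y k)
        rw [h3, mul_comm, ← nsmul_eq_mul]
        exact sum_le_card_nsmul _ _ _ (hup k hk)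
      have h4 : β * (#P + 1) = ψ * #A / 8 := by rw [hβ]; field_simp
      have h5 : β * (#P * E) < ψ * #A / 8 * E := by
        rw [← h4]; nlinarith [mul_pos hβpos hE]
      have h6 : β * ∑ w ∈ M, ∑ k ∈ P, (#(nbr G w (Y k)) : ℝ) / #(Y k) ≤ β * (#P * E) := by gcongr
      have h7 : 1 / 2 * ψ * E * (#A / 2) ≤ 1 / 2 * ψ * E * #U := by
        gcongr; linarith
      have : 0 < ψ * E * #A := by positivity
      nlinarith
    obtain ⟨w, hwM, hw⟩ := hex
    have hc0 : 0 ≤ ∑ k ∈ P, (#(nbr G w (Y k)) : ℝ) / #(Y k) :=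
      sum_nonneg fun k _ => by positivity
    have hwW : w ∉ W := by
      intro hwW
      have : nbr G w U = ∅ := by
        rw [eq_empty_iff_forall_notMem]
        intro a ha
        simp only [mem_nbr, hU, mem_sdiff, mem_nbrs] at ha
        exact ha.1.2 ⟨ha.1.1, w, hwW, ha.2⟩
      rw [this] at hw
      simp only [card_empty, Nat.cast_zero] at hw
      nlinarith
    have hins : insert w W = W ∪ {w} := by rw [union_comm]; rfl
    have hcost' : cost (insert w W) ≤ cost W + ∑ k ∈ P, (#(nbr G w (Y k)) : ℝ) / #(Y k) := by
      change ∑ k ∈ P, (#(nbrs G (insert w W) (Y k)) : ℝ) / #(Y k) ≤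
        ∑ k ∈ P, (#(nbrs G W (Y k)) : ℝ) / #(Y k) + _
      rw [← sum_add_distrib]
      refine sum_le_sum fun k hk => ?_
      rw [← add_div]
      have : (#(nbrs G (insert w W) (Y k)) : ℝ) ≤ #(nbrs G W (Y k)) + #(nbr G w (Y k)) := by
        rw [hins, nbrs_union, nbrs_singleton]; exact_mod_cast card_union_le _ _
      gcongr
    have hgain' : (#(nbrs G W A) : ℝ) + #(nbr G w U) ≤ #(nbrs G (insert w W) A) := by
      have hd : Disjoint (nbrs G W A) (nbr G w U) := by
        refine disjoint_of_subset_right (nbr_subset _ _ _) disjoint_sdiff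
      have : nbrs G W A ∪ nbr G w U ⊆ nbrs G (insert w W) A := by
        rw [hins, nbrs_union, nbrs_singleton]
        exact union_subset_union_right (nbr_mono _ _ sdiff_subset)
      have := card_le_card this
      rw [card_union_of_disjoint hd] at this
      exact_mod_cast this
    -- By maximality, adding `w` must break the budget `1 / 4`. One vertex costs at most `1 / 8`, so
    -- `W` has already spent `1 / 8` and has gained accordingly.
    have hbig : 1 / 4 < cost (insert w W) := by
      by_contra! hle
      have := hWmax (insert w W) ⟨insert_subset hwM hWM, hle, by nlinarith⟩
      rw [card_insert_of_notMem hwW] at this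
      omega
    have h8 : 1 / 8 ≤ cost W := by
      have := hcost w hwM
      linarith
    have h9 : β * (1 / 8) ≤ #(nbrs G W A) := (mul_le_mul_of_nonneg_left h8 hβpos.le).trans hWβ
    have h10 : ψ * #A = 64 * (#P + 1) * (β * (1 / 8)) := by rw [hβ]; field_simp; norm_num
    have h11 : (0 : ℝ) ≤ 64 * (#P + 1) := by linarith
    exact h10.le.trans (mul_le_mul_of_nonneg_left h9 h11)

/-- Each vertex has at most `lam |Y l|` neighbours in each set `Y l` of the family but its own. -/
def Linkage (G : SimpleGraph V) {ι : Type*} (lam : ℝ) (Y : ι → Finset V) : Prop :=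
  ∀ k l, k ≠ l → ∀ v ∈ Y k, (#(nbr G v (Y l)) : ℝ) ≤ lam * #(Y l)

/-- The vertices of `S` with many neighbours in `Z` are few. -/
theorem card_heavy_le {G : SimpleGraph V} {S Z : Finset V} {lam μ N : ℝ} (hZ : Z.Nonempty)
    (hμ : 0 < μ) (h : ∀ z ∈ Z, (#(nbr G z S) : ℝ) ≤ lam * N) :
    (#(S.filter fun v => μ * #Z < #(nbr G v Z)) : ℝ) ≤ lam / μ * N := by
  have hZpos : (0 : ℝ) < #Z := by exact_mod_cast hZ.card_pos
  have h1 : (#(S.filter fun v => μ * #Z < #(nbr G v Z)) : ℝ) * (μ * #Z) ≤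
      ∑ v ∈ S, (#(nbr G v Z) : ℝ) := by
    rw [← nsmul_eq_mul]
    refine (card_nsmul_le_sum _ (fun v => (#(nbr G v Z) : ℝ)) _ fun v hv =>
      (mem_filter.1 hv).2.le).trans ?_
    exact sum_le_sum_of_subset_of_nonneg (filter_subset _ _) fun _ _ _ => by positivity
  have h2 : ∑ v ∈ S, (#(nbr G v Z) : ℝ) = ∑ z ∈ Z, (#(nbr G z S) : ℝ) := by
    exact_mod_cast sum_card_nbr_comm G S Z
  have h3 : ∑ z ∈ Z, (#(nbr G z S) : ℝ) ≤ #Z * (lam * N) := by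
    rw [← nsmul_eq_mul]; exact sum_le_card_nsmul _ _ _ h
  rw [div_mul_eq_mul_div, le_div_iff₀ hμ]
  have h4 : (#(S.filter fun v => μ * #Z < #(nbr G v Z)) : ℝ) * μ * #Z ≤ lam * N * #Z := by
    linarith
  exact le_of_mul_le_mul_right h4 hZpos

/-- The set `Y i` is replaced by its part covered by a set `W ⊆ Y m` that has no neighbours in the
rest of the other sets. -/
theorem exists_hit {G : SimpleGraph V} {ι : Type*} [Fintype ι] (Y : ι → Finset V) {m i : ι}
    (him : i ≠ m) {E ψ lam : ℝ} (hE : 0 < E) (hψ : 0 < ψ) (hψ1 : ψ ≤ 1) (hlam : 0 < lam)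
    (hY : ∀ k, (Y k).Nonempty) (hlink : Linkage G lam Y)
    (hsmall : Fintype.card ι * lam ≤ 1 / 8)
    (hup : ∀ k, k ≠ m → ∀ v ∈ Y k, (#(nbr G v (Y m)) : ℝ) ≤ E)
    (hlow : ∀ U ⊆ Y i, (#(Y i) : ℝ) ≤ 2 * #U →
      1 / 2 * ψ * E * #U ≤ ∑ v ∈ U, (#(nbr G v (Y m)) : ℝ)) :
    ∃ Y' : ι → Finset V, (∀ k, Y' k ⊆ Y k) ∧ (∀ k, k ≠ i → (#(Y k) : ℝ) ≤ 2 * #(Y' k)) ∧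
      ψ * #(Y i) ≤ 64 * (Fintype.card ι + 1) * #(Y' i) ∧ Linkage G (8 * lam) Y' ∧
      ∀ v ∈ Y' i, ∃ w ∈ Y m, G.Adj w v ∧ ∀ j, j ≠ i → j ≠ m → ∀ u ∈ Y' j, ¬ G.Adj w u := by
  have hYpos : ∀ k, (0 : ℝ) < #(Y k) := fun k => by exact_mod_cast (hY k).card_pos
  set P : Finset ι := (univ.erase m).erase i with hP
  have hPcard : (#P : ℝ) ≤ Fintype.card ι := by exact_mod_cast card_le_univ P
  obtain ⟨W, hWM, hWP, hWi⟩ := exists_cover (G := G) P Y (Y i) (Y m) hE hψ hψ1 (hY i)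
    (fun k _ => hY k) (by
      intro w hw
      have : ∑ k ∈ P, (#(nbr G w (Y k)) : ℝ) / #(Y k) ≤ #P • lam := by
        refine sum_le_card_nsmul _ _ _ fun k hk => ?_
        rw [div_le_iff₀ (hYpos k)]
        simp only [hP, mem_erase, mem_univ, and_true] at hk
        exact hlink m k (Ne.symm hk.2) w hw
      rw [nsmul_eq_mul] at this
      nlinarith) (by
      intro k hk v hv
      simp only [hP, mem_erase, mem_univ, and_true] at hk
      exact hup k hk.2 v hv) hlow
  set Z := nbrs G W (Y i) with hZ
  have hZne : Z.Nonempty := by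
    rw [← card_pos]
    by_contra! h
    have : #Z = 0 := by omega
    rw [this] at hWi
    have := mul_pos hψ (hYpos i)
    simp at hWi
    linarith
  -- Replacing `Y i` by the much smaller `Z` may destroy the degree bound towards it. The vertices
  -- for which it fails by more than a factor 8 are at most an eighth of each other set, and are
  -- deleted.
  set H : ι → Finset V := fun k => (Y k).filter fun v => 8 * lam * #Z < #(nbr G v Z) with hH
  have hHcard : ∀ k, k ≠ i → (#(H k) : ℝ) ≤ 1 / 8 * #(Y k) := by
    intro k hk
    have := card_heavy_le (G := G) (S := Y k) (Z := Z) (lam := lam) (μ := 8 * lam) (N := #(Y k))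
      hZne (by positivity) (fun z hz => hlink i k hk.symm z (nbrs_subset _ _ _ hz))
    have h2 : lam / (8 * lam) = 1 / 8 := by field_simp
    rwa [h2] at this
  let Y' : ι → Finset V := fun k => if k = i then Z else
    if k = m then Y m \ H m else (Y k \ nbrs G W (Y k)) \ H k
  have hYi : Y' i = Z := by simp [Y']
  have hYm : Y' m = Y m \ H m := by simp [Y', him.symm]
  have hYk : ∀ k, k ≠ i → k ≠ m → Y' k = (Y k \ nbrs G W (Y k)) \ H k := by
    intro k h1 h2; simp [Y', h1, h2]
  have hsub : ∀ k, Y' k ⊆ Y k := by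
    intro k
    by_cases h1 : k = i
    · subst h1; rw [hYi]; exact nbrs_subset _ _ _
    by_cases h2 : k = m
    · subst h2; rw [hYm]; exact sdiff_subset
    · rw [hYk k h1 h2]; exact sdiff_subset.trans sdiff_subset
  have hnotH : ∀ k, k ≠ i → ∀ v ∈ Y' k, (#(nbr G v Z) : ℝ) ≤ 8 * lam * #Z := by
    intro k hk v hv
    have hvH : v ∉ H k := by
      by_cases h2 : k = m
      · subst h2; rw [hYm] at hv; exact (mem_sdiff.1 hv).2
      · rw [hYk k hk h2] at hv; exact (mem_sdiff.1 hv).2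
    simp only [hH, mem_filter, not_and, not_lt] at hvH
    exact hvH (hsub k hv)
  have hhalf : ∀ k, k ≠ i → (#(Y k) : ℝ) ≤ 2 * #(Y' k) := by
    intro k hk
    have hHk := hHcard k hk
    have hpos := hYpos k
    by_cases h2 : k = m
    · subst h2
      rw [hYm]
      have : (#(Y k) : ℝ) ≤ #(Y k \ H k) + #(H k) := by
        exact_mod_cast card_le_card_sdiff_add_card
      linarith
    · rw [hYk k hk h2]
      have h3 : (#(Y k) : ℝ) ≤ #(Y k \ nbrs G W (Y k)) + #(nbrs G W (Y k)) := by
        exact_mod_cast card_le_card_sdiff_add_card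
      have h4 : (#(Y k \ nbrs G W (Y k)) : ℝ) ≤ #((Y k \ nbrs G W (Y k)) \ H k) + #(H k) := by
        exact_mod_cast card_le_card_sdiff_add_card
      have h5 : (4 * #(nbrs G W (Y k)) : ℝ) ≤ #(Y k) := by
        exact_mod_cast hWP k (by simp [hP, hk, h2])
      linarith
  refine ⟨Y', hsub, hhalf, ?_, ?_, ?_⟩
  · rw [hYi]
    refine hWi.trans ?_
    gcongr
  · intro k l hkl v hv
    by_cases hl : l = i
    · subst hl
      rw [hYi]
      exact hnotH k hkl v hv
    · have h1 : (#(nbr G v (Y' l)) : ℝ) ≤ #(nbr G v (Y l)) := by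
        exact_mod_cast card_le_card (nbr_mono _ _ (hsub l))
      have h2 := hlink k l hkl v (hsub k hv)
      have h3 := hhalf l hl
      nlinarith [hYpos l]
  · intro v hv
    rw [hYi] at hv
    obtain ⟨-, w, hwW, hwv⟩ := mem_nbrs.1 hv
    refine ⟨w, hWM hwW, hwv, ?_⟩
    intro j hji hjm u hu hwu
    rw [hYk j hji hjm] at hu
    have := (mem_sdiff.1 (mem_sdiff.1 hu).1)
    exact this.2 (mem_nbrs.2 ⟨this.1, w, hwW, hwu⟩)

/-- Apply `exists_hit` to the indices of `S` in turn. A round at most halves the sets not being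
covered and multiplies the linkage by 8, so regularity for subsets of proportion `2 ^ (-(|ι| + 1))`
lasts through all rounds. Privacy survives later shrinking. -/
theorem exists_hits {G : SimpleGraph V} {ι : Type*} [Fintype ι] (A : ι → Finset V) (m : ι)
    {E ψ lam : ℝ} (hE : 0 < E) (hψ : 0 < ψ) (hψ1 : ψ ≤ 1) (hlam : 0 < lam)
    (hA : ∀ k, (A k).Nonempty) (hlink : Linkage G lam A)
    (hsmall : Fintype.card ι * (8 ^ Fintype.card ι * lam) ≤ 1 / 8)
    (hup : ∀ k, k ≠ m → ∀ v ∈ A k, (#(nbr G v (A m)) : ℝ) ≤ E)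
    (hlow : ∀ i, i ≠ m → ∀ U ⊆ A i, ∀ M ⊆ A m, (#(A i) : ℝ) ≤ 2 ^ (Fintype.card ι + 1) * #U →
      (#(A m) : ℝ) ≤ 2 ^ (Fintype.card ι + 1) * #M →
      1 / 2 * ψ * E * #U ≤ ∑ v ∈ U, (#(nbr G v M) : ℝ)) (S : Finset ι) :
    m ∉ S → ∃ Y : ι → Finset V, (∀ k, Y k ⊆ A k) ∧
      (∀ k, k ∉ S → (#(A k) : ℝ) ≤ 2 ^ #S * #(Y k)) ∧
      (∀ k ∈ S, ψ * #(A k) ≤ 2 ^ #S * (64 * (Fintype.card ι + 1)) * #(Y k)) ∧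
      Linkage G (8 ^ #S * lam) Y ∧
      ∀ i ∈ S, ∀ v ∈ Y i, ∃ w ∈ A m, G.Adj w v ∧ ∀ j, j ≠ i → j ≠ m → ∀ u ∈ Y j, ¬ G.Adj w u := by
  have hApos : ∀ k, (0 : ℝ) < #(A k) := fun k => by exact_mod_cast (hA k).card_pos
  induction S using Finset.induction_on with
  | empty =>
    intro _
    exact ⟨A, fun k => Subset.rfl, by simp, by simp, by simpa using hlink, by simp⟩
  | insert i S hiS ih =>
    intro hm
    rw [mem_insert, not_or] at hm
    obtain ⟨Y, hYA, hY1, hY2, hYl, hYc⟩ := ih hm.2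
    have hNpos : (0 : ℝ) < 64 * (Fintype.card ι + 1) := by positivity
    have hYpos : ∀ k, (0 : ℝ) < #(Y k) := by
      intro k
      by_contra! h
      have h0 : (#(Y k) : ℝ) = 0 := le_antisymm h (by positivity)
      by_cases hk : k ∈ S
      · have := hY2 k hk
        rw [h0] at this
        have := mul_pos hψ (hApos k)
        linarith
      · have := hY1 k hk
        rw [h0] at this
        linarith [hApos k]
    have hScard : #S ≤ Fintype.card ι := card_le_univ S
    have h8 : (8 : ℝ) ^ #S * lam ≤ 8 ^ Fintype.card ι * lam := by
      gcongr; norm_num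
    have h2S : (2 : ℝ) ^ #S ≤ 2 ^ Fintype.card ι := by gcongr; norm_num
    obtain ⟨Y', hY'Y, hY'1, hY'2, hY'l, hY'c⟩ := exists_hit (G := G) Y (m := m) (i := i)
      (fun h => hm.1 h.symm) hE hψ hψ1 (lam := 8 ^ #S * lam) (by positivity)
      (fun k => by
        have := hYpos k
        rw [← card_pos]; exact_mod_cast this) hYl
      (le_trans (by gcongr) hsmall)
      (fun k hk v hv => (Nat.cast_le.2 (card_le_card (nbr_mono _ _ (hYA m)))).trans
        (hup k hk v (hYA k hv)))
      (fun U hU hUc => hlow i (fun h => hm.1 h.symm) U (hU.trans (hYA i)) (Y m) (hYA m) (by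
          have h1 := hY1 i hiS
          have : (2 : ℝ) ^ #S * #(Y i) ≤ 2 ^ Fintype.card ι * (2 * #U) := by gcongr
          rw [pow_succ]; linarith) (by
          have h1 := hY1 m hm.2
          have : (2 : ℝ) ^ #S * #(Y m) ≤ 2 ^ (Fintype.card ι + 1) * #(Y m) := by
            gcongr
            · norm_num
            · omega
          linarith))
    rw [card_insert_of_notMem hiS]
    refine ⟨Y', fun k => (hY'Y k).trans (hYA k), ?_, ?_, ?_, ?_⟩
    · intro k hk
      rw [mem_insert, not_or] at hk
      have h1 := hY1 k hk.2
      have h2 := hY'1 k hk.1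
      have : (2 : ℝ) ^ #S * #(Y k) ≤ 2 ^ #S * (2 * #(Y' k)) := by gcongr
      rw [pow_succ]; linarith
    · intro k hk
      by_cases hki : k = i
      · subst hki
        have h1 := hY1 k hiS
        have h3 : ψ * #(A k) ≤ 2 ^ #S * (ψ * #(Y k)) := by nlinarith
        have h4 : (2 : ℝ) ^ #S * (ψ * #(Y k)) ≤
            2 ^ #S * (64 * (Fintype.card ι + 1) * #(Y' k)) := by gcongr
        have h5 : (0 : ℝ) ≤ 2 ^ #S * (64 * (Fintype.card ι + 1) * #(Y' k)) := by positivity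
        rw [pow_succ]; linarith
      · have hkS : k ∈ S := (mem_insert.1 hk).resolve_left hki
        have h1 := hY2 k hkS
        have h2 := hY'1 k hki
        have : (2 : ℝ) ^ #S * (64 * (Fintype.card ι + 1)) * #(Y k) ≤
            2 ^ #S * (64 * (Fintype.card ι + 1)) * (2 * #(Y' k)) := by gcongr
        rw [pow_succ]; linarith
    · intro k l hkl v hv
      have := hY'l k l hkl v hv
      rw [pow_succ]; linarith
    · intro k hk v hv
      by_cases hki : k = i
      · subst hki
        obtain ⟨w, hw, hwv, hwn⟩ := hY'c v hv
        exact ⟨w, hYA m hw, hwv, hwn⟩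
      · have hkS : k ∈ S := (mem_insert.1 hk).resolve_left hki
        obtain ⟨w, hw, hwv, hwn⟩ := hYc k hkS v (hY'Y k hv)
        exact ⟨w, hw, hwv, fun j hj hjm u hu => hwn j hj hjm u (hY'Y j hu)⟩

/-- Passing to subsets, the degrees from `A` to `B` become regular, up to a factor `ψ`. -/
theorem exists_regular_pair {G : SimpleGraph V} {γ : ℝ} (hG : Coh G γ) {ψ C : ℝ} (hψ : 0 < ψ)
    (hC : 1 ≤ C) : ∀ (T : ℕ) (D : ℝ) (A B : Finset V), Disjoint A B → (2 * C) ^ T * γ ≤ #A →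
      C ^ T * γ ≤ #B → (∀ v ∈ A, (#(nbr G v B) : ℝ) ≤ D) → ψ ^ T * D < 1 →
      ∃ (A' B' : Finset V) (j : ℕ), A' ⊆ A ∧ B' ⊆ B ∧ j < T ∧ (#A : ℝ) ≤ (2 * C) ^ T * #A' ∧
        (#B : ℝ) ≤ C ^ T * #B' ∧ (∀ v ∈ A', (#(nbr G v B') : ℝ) ≤ ψ ^ j * D) ∧
        ∀ X ⊆ A', ∀ Y ⊆ B', (#A' : ℝ) ≤ C * #X → (#B' : ℝ) ≤ C * #Y →
          1 / 2 * ψ * (ψ ^ j * D) * #X ≤ ∑ v ∈ X, (#(nbr G v Y) : ℝ) := by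
  have hC0 : (0 : ℝ) < C := by linarith
  intro T
  induction T with
  | zero =>
    intro D A B hd hA hB hD hT
    obtain ⟨a, ha, b, hb, hab⟩ := hG A B hd (by simpa using hA) (by simpa using hB)
    have h1 := hD a ha
    have h2 : 0 < #(nbr G a B) := card_pos.2 ⟨b, mem_nbr.2 ⟨hb, hab⟩⟩
    have h3 : (1 : ℝ) ≤ #(nbr G a B) := by exact_mod_cast h2
    simp at hT
    linarith
  | succ T ih =>
    intro D A B hd hA hB hD hT
    -- If regularity fails for some `X` and `Y`, at least half of `X` has at most `ψ D` neighbours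
    -- in `Y`, and one recurses there with `D` replaced by `ψ D`. After `T` rounds the degree bound
    -- would be below 1, contradicting the edge that coherence provides.
    by_cases hrob : ∀ X ⊆ A, ∀ Y ⊆ B, (#A : ℝ) ≤ C * #X → (#B : ℝ) ≤ C * #Y →
          1 / 2 * ψ * (ψ ^ 0 * D) * #X ≤ ∑ v ∈ X, (#(nbr G v Y) : ℝ)
    · refine ⟨A, B, 0, Subset.rfl, Subset.rfl, by omega, ?_, ?_, by simpa using hD, hrob⟩
      · have : (1 : ℝ) ≤ (2 * C) ^ (T + 1) := one_le_pow₀ (by linarith)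
        nlinarith [Nat.cast_nonneg (α := ℝ) #A]
      · have : (1 : ℝ) ≤ C ^ (T + 1) := one_le_pow₀ hC
        nlinarith [Nat.cast_nonneg (α := ℝ) #B]
    push Not at hrob
    obtain ⟨X, hXA, Y, hYB, hXc, hYc, hlt⟩ := hrob
    simp only [pow_zero, one_mul] at hlt
    have hsum0 : 0 ≤ ∑ v ∈ X, (#(nbr G v Y) : ℝ) := sum_nonneg fun _ _ => by positivity
    have hDX : 0 < D * #X := by
      by_contra! h
      nlinarith
    have hXpos : (0 : ℝ) < #X := by
      rcases (Nat.cast_nonneg (α := ℝ) #X).lt_or_eq with h | h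
      · exact h
      · rw [← h] at hDX; simp at hDX
    have hDpos : 0 < D := by
      by_contra! h
      nlinarith
    set A1 := X.filter fun v => (#(nbr G v Y) : ℝ) ≤ ψ * D with hA1
    have hA1c : (#X : ℝ) ≤ 2 * #A1 := by
      have h1 : (#(X \ A1) : ℝ) * (ψ * D) ≤ ∑ v ∈ X, (#(nbr G v Y) : ℝ) := by
        rw [← nsmul_eq_mul]
        refine (card_nsmul_le_sum _ (fun v => (#(nbr G v Y) : ℝ)) _ fun v hv => ?_).trans
          (sum_le_sum_of_subset_of_nonneg sdiff_subset fun _ _ _ => by positivity)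
        simp only [hA1, mem_sdiff, mem_filter, not_and, not_le] at hv
        exact (hv.2 hv.1).le
      have h2 : (#(X \ A1) : ℝ) + #A1 = #X := by
        exact_mod_cast card_sdiff_add_card_eq_card (filter_subset _ _)
      have h3 : (#(X \ A1) : ℝ) * (ψ * D) < 1 / 2 * #X * (ψ * D) := by linarith
      have h4 := lt_of_mul_lt_mul_right h3 (by positivity)
      linarith
    have hAc : (#A : ℝ) ≤ 2 * C * #A1 := by nlinarith
    obtain ⟨A', B', j, h1, h2, h3, h4, h5, h6, h7⟩ := ih (ψ * D) A1 Y
      (hd.mono ((filter_subset _ _).trans hXA) hYB)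
      (by
        have : 2 * C * ((2 * C) ^ T * γ) ≤ 2 * C * #A1 := by
          rw [pow_succ] at hA; linarith
        exact le_of_mul_le_mul_left this (by positivity))
      (by
        have : C * (C ^ T * γ) ≤ C * #Y := by
          rw [pow_succ] at hB; linarith
        exact le_of_mul_le_mul_left this (by positivity))
      (fun v hv => (mem_filter.1 hv).2) (by rw [pow_succ] at hT; linarith)
    refine ⟨A', B', j + 1, h1.trans ((filter_subset _ _).trans hXA), h2.trans hYB, by omega,
      ?_, ?_, ?_, ?_⟩
    · have : 2 * C * #A1 ≤ 2 * C * ((2 * C) ^ T * #A') := by gcongr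
      rw [pow_succ]; linarith
    · have : C * #Y ≤ C * (C ^ T * #B') := by gcongr
      rw [pow_succ]; linarith
    · intro v hv
      have := h6 v hv
      rw [pow_succ]; linarith
    · intro X' hX' Y' hY' hXc' hYc'
      have := h7 X' hX' Y' hY' hXc' hYc'
      have e : ψ ^ (j + 1) * D = ψ ^ j * (ψ * D) := by ring
      rw [e]; exact this

/-- `exists_regular_pair` for several sets `A i` and one set `M`. -/
theorem exists_regular_star {ι : Type*} (T : ℕ) (S : Finset ι) :
    ∀ C : ℝ, 1 ≤ C → ∃ κ : ℝ, 0 < κ ∧ κ ≤ 1 ∧ ∀ {V : Type u} (G : SimpleGraph V) (γ ψ D : ℝ),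
      0 < γ → Coh G γ → 0 < ψ → ψ ^ T * D < 1 → ∀ (A : ι → Finset V) (M : Finset V),
      (∀ i ∈ S, Disjoint (A i) M) → (∀ i ∈ S, γ ≤ κ * #(A i)) → γ ≤ κ * #M →
      (∀ i ∈ S, ∀ v ∈ A i, (#(nbr G v M) : ℝ) ≤ D) →
      ∃ (A' : ι → Finset V) (M' : Finset V) (j : ι → ℕ), (∀ i, A' i ⊆ A i) ∧ M' ⊆ M ∧
        (∀ i ∈ S, κ * #(A i) ≤ #(A' i)) ∧ κ * #M ≤ #M' ∧ ∀ i ∈ S, j i < T ∧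
        (∀ v ∈ A' i, (#(nbr G v M') : ℝ) ≤ ψ ^ j i * D) ∧
        ∀ X ⊆ A' i, ∀ Y ⊆ M', (#(A' i) : ℝ) ≤ C * #X → (#M' : ℝ) ≤ C * #Y →
          1 / 2 * ψ * (ψ ^ j i * D) * #X ≤ ∑ v ∈ X, (#(nbr G v Y) : ℝ) := by
  induction S using Finset.induction_on with
  | empty =>
    intro C hC
    refine ⟨1, one_pos, le_rfl, ?_⟩
    intro V G γ ψ D _ _ _ _ A M _ _ _ _
    exact ⟨A, M, fun _ => 0, fun _ => Subset.rfl, Subset.rfl, by simp, by simp, by simp⟩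
  | insert s S hs ih =>
    intro C hC
    obtain ⟨κ, hκ, hκ1, H⟩ := ih C hC
    -- The pair `A s`, `M` is regularised first, for subsets of the smaller proportion `κ / C`: the
    -- other indices later shrink `M` by up to a factor `κ`, and regularity must survive this.
    have hC1 : 1 ≤ C / κ := by rw [le_div_iff₀ hκ]; linarith
    set c := (2 * (C / κ)) ^ T with hc
    have hc1 : 1 ≤ c := one_le_pow₀ (by linarith)
    have hc2 : (C / κ) ^ T ≤ c := by rw [hc]; gcongr; linarith
    have hcpos : 0 < c := by linarith
    have hκc : κ / c ≤ κ := div_le_self hκ.le hc1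
    refine ⟨κ / c, by positivity, hκc.trans hκ1, ?_⟩
    intro V G γ ψ D hγ hG hψ hT A M hd hA hM hD
    have hle : ∀ x : ℝ, 0 ≤ x → κ / c * x ≤ x / c := by
      intro x hx
      rw [div_mul_eq_mul_div]
      gcongr
      nlinarith
    obtain ⟨A1, M1, j1, h1, h2, h3, h4, h5, h6, h7⟩ := exists_regular_pair hG hψ hC1 T D (A s) M
      (hd s (mem_insert_self _ _))
      (by
        have := (hA s (mem_insert_self _ _)).trans (hle _ (by positivity))
        rw [le_div_iff₀ hcpos] at this
        linarith)
      (by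
        have := hM.trans (hle _ (by positivity))
        rw [le_div_iff₀ hcpos] at this
        have : (C / κ) ^ T * γ ≤ c * γ := by gcongr
        linarith)
      (hD s (mem_insert_self _ _)) hT
    have hM1 : κ / c * #M ≤ κ * #M1 := by
      rw [div_mul_eq_mul_div, div_le_iff₀ hcpos]
      have : κ * #M ≤ κ * ((C / κ) ^ T * #M1) := by gcongr
      have : κ * ((C / κ) ^ T * #M1) ≤ κ * (c * #M1) := by gcongr
      linarith
    obtain ⟨A', M', j, g1, g2, g3, g4, g5⟩ := H G γ ψ D hγ hG hψ hT A M1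
      (fun i hi => (hd i (mem_insert_of_mem hi)).mono_right h2)
      (fun i hi => (hA i (mem_insert_of_mem hi)).trans (by gcongr))
      (hM.trans hM1)
      (fun i hi v hv => (Nat.cast_le.2 (card_le_card (nbr_mono _ _ h2))).trans
        (hD i (mem_insert_of_mem hi) v hv))
    refine ⟨fun i => if i = s then A1 else A' i, M', fun i => if i = s then j1 else j i, ?_,
      g2.trans h2, ?_, hM1.trans g4, ?_⟩
    · intro i
      by_cases h : i = s
      · subst h; simpa using h1
      · simpa [h] using g1 i
    · intro i hi
      by_cases h : i = s
      · subst h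
        simp only [if_true]
        refine (hle _ (by positivity)).trans ?_
        rw [div_le_iff₀ hcpos]
        linarith
      · simp only [h, if_false]
        refine le_trans ?_ (g3 i ((mem_insert.1 hi).resolve_left h))
        gcongr
    · intro i hi
      by_cases h : i = s
      · subst h
        simp only [if_true]
        refine ⟨h3, fun v hv => (Nat.cast_le.2 (card_le_card (nbr_mono _ _ g2))).trans (h6 v hv),
          ?_⟩
        intro X hX Y hY hXc hYc
        have hC' : C ≤ C / κ := by rw [le_div_iff₀ hκ]; nlinarith
        refine h7 X hX Y (hY.trans g2) (hXc.trans (by gcongr)) ?_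
        have : κ * #M1 ≤ C * #Y := g4.trans hYc
        rw [div_mul_eq_mul_div, le_div_iff₀ hκ]
        linarith
      · simp only [h, if_false]
        exact g5 i ((mem_insert.1 hi).resolve_left h)

end Hits

end PurePairs

namespace PurePairs

/-! ### Blockades and private neighbours -/

section Blockades

open Finset Classical Filter

universe u

variable {V : Type u}

theorem eventually_mul_rpow_le {a b : ℝ} (hab : a < b) (K : ℝ) :
    ∀ᶠ n : ℕ in atTop, K * (n : ℝ) ^ a ≤ (n : ℝ) ^ b := by
  have h1 : ∀ᶠ x : ℝ in atTop, K ≤ x ^ (b - a) :=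
    (tendsto_rpow_atTop (by linarith : 0 < b - a)).eventually_ge_atTop K
  filter_upwards [tendsto_natCast_atTop_atTop.eventually h1, eventually_gt_atTop 0] with n hn hn0
  have hpos : (0 : ℝ) < n := by exact_mod_cast hn0
  calc K * (n : ℝ) ^ a ≤ (n : ℝ) ^ (b - a) * (n : ℝ) ^ a := by gcongr
    _ = (n : ℝ) ^ b := by rw [← Real.rpow_add hpos]; ring_nf

/-- A family of disjoint sets of at least `|G| ^ (1 - σ)` vertices, with small degrees between
them. -/
structure Blockade [Fintype V] (G : SimpleGraph V) (σ lam : ℝ) {ι : Type*} (B : ι → Finset V) :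
    Prop where
  disj : ∀ i j, i ≠ j → Disjoint (B i) (B j)
  width : ∀ i, (Fintype.card V : ℝ) ^ (1 - σ) ≤ #(B i)
  link : Linkage G lam B

theorem Linkage.shrink {G : SimpleGraph V} {ι ι' : Type*} {lam R : ℝ} {B : ι → Finset V}
    (h : Linkage G lam B) (φ : ι' ↪ ι) {B' : ι' → Finset V} (hsub : ∀ i, B' i ⊆ B (φ i))
    (hlam : 0 ≤ lam) (hR : ∀ i, (#(B (φ i)) : ℝ) ≤ R * #(B' i)) : Linkage G (R * lam) B' := by
  intro k l hkl v hv
  calc (#(nbr G v (B' l)) : ℝ) ≤ #(nbr G v (B (φ l))) := by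
        exact_mod_cast card_le_card (nbr_mono _ _ (hsub l))
    _ ≤ lam * #(B (φ l)) := h _ _ (fun e => hkl (φ.injective e)) v (hsub k hv)
    _ ≤ lam * (R * #(B' l)) := by gcongr; exact hR l
    _ = R * lam * #(B' l) := by ring

theorem Blockade.shrink [Fintype V] {G : SimpleGraph V} {ι ι' : Type*} {σ σ' lam R : ℝ}
    {B : ι → Finset V} (h : Blockade G σ lam B) (φ : ι' ↪ ι) {B' : ι' → Finset V}
    (hsub : ∀ i, B' i ⊆ B (φ i)) (hlam : 0 ≤ lam) (hR0 : 0 < R)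
    (hR : ∀ i, (#(B (φ i)) : ℝ) ≤ R * #(B' i))
    (hσ : R * (Fintype.card V : ℝ) ^ (1 - σ') ≤ (Fintype.card V : ℝ) ^ (1 - σ)) :
    Blockade G σ' (R * lam) B' where
  disj i j hij := (h.disj _ _ (fun e => hij (φ.injective e))).mono (hsub i) (hsub j)
  width i := by
    have := (hσ.trans (h.width (φ i))).trans (hR i)
    exact le_of_mul_le_mul_left this hR0
  link := h.link.shrink φ hsub hlam hR

theorem Linkage.mono {G : SimpleGraph V} {ι : Type*} {lam lam' : ℝ} {B : ι → Finset V}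
    (h : Linkage G lam B) (hl : lam ≤ lam') : Linkage G lam' B := fun k l hkl v hv =>
  (h k l hkl v hv).trans (by gcongr)

theorem Blockade.mono [Fintype V] {G : SimpleGraph V} {ι : Type*} {σ σ' lam lam' : ℝ}
    {B : ι → Finset V} (h : Blockade G σ lam B) (hl : lam ≤ lam') (hσ : σ ≤ σ')
    (hV : 1 ≤ Fintype.card V) : Blockade G σ' lam' B where
  disj := h.disj
  width i := le_trans (Real.rpow_le_rpow_of_exponent_le (by exact_mod_cast hV) (by linarith))
    (h.width i)
  link := h.link.mono hl

theorem exists_embedding_avoiding {ι : Type*} [Fintype ι] (n : ℕ) (E : Finset ι)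
    (h : n + #E ≤ Fintype.card ι) : ∃ e : Fin n ↪ ι, ∀ i, e i ∉ E := by
  have h1 : Fintype.card (Fin n) ≤ Fintype.card {i : ι // i ∉ E} := by
    have : Fintype.card {i : ι // i ∈ E} = #E := by simp
    rw [Fintype.card_subtype_compl, this, Fintype.card_fin]
    omega
  obtain ⟨e⟩ := Function.Embedding.nonempty_of_card_le h1
  exact ⟨e.trans (Function.Embedding.subtype _), fun i => (e i).2⟩

/-- From a given set `B m` of a blockade, the vertices of many other sets (other than `B b`) get
private neighbours, after shrinking these sets. -/
theorem exists_private_nbrs {c : ℝ} (hc : 0 < c) (ι' : Type) [Fintype ι'] {σ' lam' : ℝ}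
    (hσ' : 0 < σ') (hlam' : 0 < lam') :
    ∃ (K : ℕ) (σ lam : ℝ), 0 < σ ∧ 0 < lam ∧ ∀ᶠ n : ℕ in atTop, ∀ (V : Type u) [Fintype V]
      (G : SimpleGraph V), Fintype.card V = n → Coh G ((n : ℝ) ^ (1 - c)) →
      ∀ (ι : Type) [Fintype ι] (B : ι → Finset V), K ≤ Fintype.card ι → Blockade G σ lam B →
      ∀ m b : ι, ∃ (φ : ι' ↪ ι) (B' : ι' → Finset V), (∀ i, B' i ⊆ B (φ i)) ∧
        Blockade G σ' lam' B' ∧ (∀ i, φ i ≠ m ∧ φ i ≠ b) ∧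
        ∀ i, ∀ v ∈ B' i, ∃ w ∈ B m, G.Adj w v ∧ ∀ j, j ≠ i → ∀ u ∈ B' j, ¬ G.Adj w u := by
  set δ : ℝ := σ' / 4 with hδ
  have hδ0 : 0 < δ := by positivity
  -- With `ψ = n ^ (-δ)`, more than `1 / δ` levels bring the trivial degree bound `n` below 1. The
  -- number of levels does not depend on `n`.
  obtain ⟨T, hT⟩ := exists_nat_gt (1 / δ)
  have hTδ : 1 < T * δ := by rwa [div_lt_iff₀ hδ0] at hT
  have hT0 : 0 < T := by
    rcases Nat.eq_zero_or_pos T with rfl | h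
    · simp at hTδ; linarith
    · exact h
  set q := Fintype.card ι' with hq
  -- `T * q` sets allow a pigeonhole over levels that leaves `q`. The constant `2 ^ (q + 2)` is what
  -- `exists_hits` requires for `q + 1` sets, namely these and the reserved one.
  obtain ⟨κ, hκ, hκ1, hstar⟩ := exists_regular_star.{u} T (univ : Finset (Fin (T * q)))
    (2 ^ (q + 2)) (one_le_pow₀ (by norm_num))
  set R : ℝ := 2 ^ q * (64 * (q + 2)) / κ with hR
  have hR0 : 0 < R := by positivity
  set lam : ℝ := κ * min (1 / (8 * ((q : ℝ) + 1) * 8 ^ (q + 1))) (lam' / (8 : ℝ) ^ q) with hlam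
  have hlam0 : 0 < lam := by positivity
  refine ⟨T * q + 2, min (c / 2) δ, lam, by positivity, hlam0, ?_⟩
  have hσc : min (c / 2) δ < c := (min_le_left _ _).trans_lt (by linarith)
  filter_upwards [eventually_gt_atTop 1,
    eventually_mul_rpow_le (a := 1 - c) (b := 1 - min (c / 2) δ) (by linarith) (1 / κ),
    eventually_mul_rpow_le (a := 1 - σ') (b := 1 - min (c / 2) δ - δ)
      (by have := min_le_right (c / 2) δ; linarith) R]
    with n hn1 hnγ hnσ
  intro V _ G hV hG ι _ B hK hB m b
  subst hV
  set N : ℝ := (Fintype.card V : ℝ) with hN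
  have hN1 : 1 < N := by rw [hN]; exact_mod_cast hn1
  have hN0 : 0 < N := by linarith
  set ψ : ℝ := N ^ (-δ) with hψ
  have hψ0 : 0 < ψ := Real.rpow_pos_of_pos hN0 _
  have hψ1 : ψ ≤ 1 := Real.rpow_le_one_of_one_le_of_nonpos hN1.le (by linarith)
  have hψT : ψ ^ T * N < 1 := by
    have : ψ ^ T * N = N ^ (1 - T * δ) := by
      rw [hψ, ← Real.rpow_natCast, ← Real.rpow_mul hN0.le]
      conv_lhs => rw [← Real.rpow_one N, ← Real.rpow_mul hN0.le, ← Real.rpow_add hN0]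
      ring_nf
    rw [this]
    exact Real.rpow_lt_one_of_one_lt_of_neg hN1 (by linarith)
  have hγ0 : 0 < N ^ (1 - c) := Real.rpow_pos_of_pos hN0 _
  have hwide : ∀ i, N ^ (1 - c) ≤ κ * #(B i) := by
    intro i
    have h1 := hnγ.trans (hB.width i)
    rw [div_mul_eq_mul_div, one_mul, div_le_iff₀ hκ] at h1
    linarith
  obtain ⟨e, he⟩ := exists_embedding_avoiding (T * q) {m, b}
    (le_trans (by gcongr; exact card_le_two) hK)
  have hem : ∀ i, e i ≠ m := fun i h => he i (by simp [h])
  have heb : ∀ i, e i ≠ b := fun i h => he i (by simp [h])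
  obtain ⟨A', M', j, hA', hM', hA'c, hM'c, hreg⟩ := hstar G (N ^ (1 - c)) ψ N hγ0 hG hψ0 hψT
    (fun i => B (e i)) (B m) (fun i _ => hB.disj _ _ (hem i)) (fun i _ => hwide _) (hwide m)
    (fun i _ v _ => by rw [hN]; exact_mod_cast card_le_univ _)
  -- The greedy cover compares degrees from different sets with a single scale `E = ψ ^ y * N`, so
  -- `q` sets at the same level are selected.
  obtain ⟨y, -, hy⟩ := exists_large_fiber (univ : Finset (Fin (T * q))) (range T) j
    (fun i _ => mem_range.2 (hreg i (mem_univ i)).1) ⟨0, mem_range.2 hT0⟩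
  rw [card_univ, Fintype.card_fin, card_range] at hy
  have hy' := Nat.le_of_mul_le_mul_left hy hT0
  obtain ⟨g⟩ : Nonempty (ι' ↪ {i : Fin (T * q) // j i = y}) := by
    refine Function.Embedding.nonempty_of_card_le ?_
    rw [Fintype.card_subtype]
    refine hy'.trans (le_of_eq ?_)
    congr
  have hne : ∀ i, (0 : ℝ) < #(A' i) := fun i =>
    (hγ0.trans_le (hwide (e i))).trans_le (hA'c i (mem_univ i))
  let A : Option ι' → Finset V := fun o => o.elim M' fun i => A' (g i).1
  let e' : Option ι' ↪ ι := ⟨fun o => o.elim m fun i => e (g i).1, by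
    rintro (_ | i) (_ | k) h
    · rfl
    · exact absurd h.symm (hem _)
    · exact absurd h (hem _)
    · simp only [Option.elim_some, EmbeddingLike.apply_eq_iff_eq] at h
      rw [g.injective (Subtype.ext h)]⟩
  have hcardO : (Fintype.card (Option ι') : ℝ) = q + 1 := by
    rw [Fintype.card_option]; push_cast; rfl
  have hAB : ∀ o, A o ⊆ B (e' o) := by
    rintro (_ | i)
    · exact hM'
    · exact hA' _
  have hABc : ∀ o, (#(B (e' o)) : ℝ) ≤ 1 / κ * #(A o) := by
    have key : ∀ x y : ℝ, κ * x ≤ y → x ≤ 1 / κ * y := by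
      intro x y h
      rw [div_mul_eq_mul_div, one_mul, le_div_iff₀ hκ]
      linarith
    rintro (_ | i)
    · exact key _ _ hM'c
    · exact key _ _ (hA'c _ (mem_univ _))
  have hlinkA : Linkage G (1 / κ * lam) A := hB.link.shrink e' hAB hlam0.le hABc
  have hlamκ : 1 / κ * lam = min (1 / (8 * ((q : ℝ) + 1) * 8 ^ (q + 1))) (lam' / (8 : ℝ) ^ q) := by
    rw [hlam]; field_simp
  obtain ⟨Y, hYA, -, hYc, hYl, hYw⟩ := exists_hits (G := G) A none (E := ψ ^ y * N) (ψ := ψ)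
    (lam := 1 / κ * lam) (by positivity) hψ0 hψ1 (by positivity)
    (by
      rintro (_ | i)
      · have : (0 : ℝ) < #M' := (hγ0.trans_le (hwide m)).trans_le hM'c
        exact card_pos.1 (by exact_mod_cast this)
      · exact card_pos.1 (by exact_mod_cast hne _)) hlinkA
    (by
      rw [hcardO, Fintype.card_option, hlamκ]
      have h1 := min_le_left (1 / (8 * (q + 1) * 8 ^ (q + 1)) : ℝ) (lam' / 8 ^ q)
      calc ((q : ℝ) + 1) * (8 ^ (q + 1) * min (1 / (8 * (q + 1) * 8 ^ (q + 1)) : ℝ) (lam' / 8 ^ q))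
          ≤ ((q : ℝ) + 1) * (8 ^ (q + 1) * (1 / (8 * (q + 1) * 8 ^ (q + 1)))) := by gcongr
        _ = 1 / 8 := by field_simp)
    (by
      rintro (_ | i) hi
      · exact absurd rfl hi
      · intro v hv
        have := (hreg (g i).1 (mem_univ _)).2.1 v hv
        rwa [(g i).2] at this)
    (by
      rintro (_ | i) hi
      · exact absurd rfl hi
      · intro U hU M hM hUc hMc
        rw [Fintype.card_option] at hUc hMc
        have := (hreg (g i).1 (mem_univ _)).2.2 U hU M hM hUc hMc
        rwa [(g i).2] at this)
    (univ.map Function.Embedding.some) (by simp)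
  have hScard : #((univ : Finset ι').map Function.Embedding.some) = q := by
    rw [card_map, card_univ]
  rw [hScard] at hYc hYl
  let φ : ι' ↪ ι := Function.Embedding.some.trans e'
  have hsub : ∀ i, Y (some i) ⊆ B (φ i) := fun i => (hYA _).trans (hAB _)
  refine ⟨φ, fun i => Y (some i), hsub, ⟨?_, ?_, ?_⟩, ?_, ?_⟩
  · intro i k hik
    exact (hB.disj _ _ (fun h => hik (φ.injective h))).mono (hsub i) (hsub k)
  · intro i
    have h1 := hYc (some i) (by simp)
    rw [hcardO] at h1
    have h2 := hABc (some i)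
    have h3 := hB.width (e' (some i))
    have h4 : N ^ (1 - min (c / 2) δ - δ) = ψ * N ^ (1 - min (c / 2) δ) := by
      rw [hψ, ← Real.rpow_add hN0]; ring_nf
    rw [h4] at hnσ
    have h5 : ψ * N ^ (1 - min (c / 2) δ) ≤ 1 / κ * (ψ * #(A (some i))) := by
      calc ψ * N ^ (1 - min (c / 2) δ) ≤ ψ * (1 / κ * #(A (some i))) := by
            gcongr; exact h3.trans h2
        _ = _ := by ring
    have h6 : 1 / κ * (ψ * #(A (some i))) ≤ R * #(Y (some i)) := by
      calc 1 / κ * (ψ * #(A (some i)))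
          ≤ 1 / κ * (2 ^ q * (64 * ((q : ℝ) + 1 + 1)) * #(Y (some i))) := by gcongr
        _ = R * #(Y (some i)) := by rw [hR]; ring
    exact le_of_mul_le_mul_left ((hnσ.trans h5).trans h6) hR0
  · intro i k hik v hv
    have h1 := hYl (some i) (some k) (by simpa using hik) v hv
    refine h1.trans ?_
    have h2 : 8 ^ q * (1 / κ * lam) ≤ lam' := by
      rw [hlamκ]
      calc (8 : ℝ) ^ q * min (1 / (8 * (q + 1) * 8 ^ (q + 1)) : ℝ) (lam' / 8 ^ q)
          ≤ 8 ^ q * (lam' / 8 ^ q) := by gcongr; exact min_le_right _ _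
        _ = lam' := by field_simp
    gcongr
  · intro i
    exact ⟨hem _, heb _⟩
  · intro i v hv
    obtain ⟨w, hw, hwv, hwn⟩ := hYw (some i) (by simp) v hv
    exact ⟨w, hM' hw, hwv, fun k hk u hu => hwn (some k) (by simpa using hk) (by simp) u hu⟩

/-- Sets of size `n ^ (1 - σ)` are large enough for chains of length `k`. -/
theorem exists_chain_parameter {c : ℝ} (hc1 : c < 1) {k : ℕ}
    (hk : 1 < (k + 1) * c) : ∃ σ₀ : ℝ, 0 < σ₀ ∧ σ₀ < c ∧ ∀ᶠ n : ℕ in atTop, ∃ t : ℕ,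
      ((t + 2) * ⌈(n : ℝ) ^ (1 - c)⌉₊ : ℝ) ≤ (n : ℝ) ^ (1 - σ₀) ∧
      ⌈(n : ℝ) ^ (1 - c)⌉₊ ≤ (t + 1) ^ k := by
  have hk0 : 0 < k := by
    rcases Nat.eq_zero_or_pos k with rfl | h
    · simp at hk; linarith
    · exact h
  have hk0' : (0 : ℝ) < k := by exact_mod_cast hk0
  -- Choose `t + 1 = ⌈n ^ τ⌉`, a `k`-th root of `n ^ (1 - c)` up to rounding. The chain sets then
  -- need size about `n ^ (τ + 1 - c)`, which is below `n` by a power exactly when `τ < c`, that is,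
  -- when `(k + 1) * c > 1`.
  set τ : ℝ := (1 - c) / k with hτ
  have hτc : τ < c := by rw [hτ, div_lt_iff₀ hk0']; linarith
  have hτ0 : 0 < τ := div_pos (by linarith) hk0'
  refine ⟨(c - τ) / 2, by linarith, by linarith, ?_⟩
  filter_upwards [eventually_ge_atTop 1,
    eventually_mul_rpow_le (a := τ + (1 - c)) (b := 1 - (c - τ) / 2) (by linarith) 6] with n hn h
  have hn1 : (1 : ℝ) ≤ n := by exact_mod_cast hn
  have hn0 : (0 : ℝ) < n := by linarith
  have hxτ : (1 : ℝ) ≤ (n : ℝ) ^ τ := Real.one_le_rpow hn1 hτ0.le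
  have hxc : (1 : ℝ) ≤ (n : ℝ) ^ (1 - c) := Real.one_le_rpow hn1 (by linarith)
  have h1 : (⌈(n : ℝ) ^ τ⌉₊ : ℝ) < (n : ℝ) ^ τ + 1 := Nat.ceil_lt_add_one (by linarith)
  have h2 : (⌈(n : ℝ) ^ (1 - c)⌉₊ : ℝ) < (n : ℝ) ^ (1 - c) + 1 := Nat.ceil_lt_add_one (by linarith)
  have hceil : 1 ≤ ⌈(n : ℝ) ^ τ⌉₊ := Nat.one_le_ceil_iff.2 (by linarith)
  refine ⟨⌈(n : ℝ) ^ τ⌉₊ - 1, ?_, ?_⟩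
  · rw [Nat.cast_sub hceil]
    refine le_trans ?_ h
    rw [Real.rpow_add hn0]
    calc ((⌈(n : ℝ) ^ τ⌉₊ : ℝ) - (1 : ℕ) + 2) * ⌈(n : ℝ) ^ (1 - c)⌉₊
        ≤ (3 * (n : ℝ) ^ τ) * (2 * (n : ℝ) ^ (1 - c)) := by
          gcongr
          · push_cast; linarith
          · linarith
      _ = _ := by ring
  · rw [Nat.sub_add_cancel hceil]
    refine Nat.ceil_le.2 ?_
    push_cast
    calc (n : ℝ) ^ (1 - c) = ((n : ℝ) ^ τ) ^ k := by
          rw [← Real.rpow_natCast, ← Real.rpow_mul hn0.le, hτ, div_mul_cancel₀ _ hk0'.ne']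
      _ ≤ _ := by gcongr; exact Nat.le_ceil _

end Blockades

end PurePairs

namespace PurePairs

/-! ### Joining vertices to a whole sub-blockade -/

section Hubs

open Finset Classical Filter

universe u

variable {V : Type u}

/-- A vertex joined to large parts of two sets of a family, through two disjoint chains, gives
connections between these two parts that have no neighbours in the other sets. -/
theorem exists_double_hub {G : SimpleGraph V} {γ : ℝ} (hγ : 0 < γ) (hG : Coh G γ) {k t : ℕ}
    (ht : ⌈γ⌉₊ ≤ (t + 1) ^ k) {ι κ : Type*} [Nontrivial κ] (B : ι → Finset V)
    (hB : ∀ i j, i ≠ j → Disjoint (B i) (B j)) (e : ℕ → ι)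
    (he : ∀ a b, a ≤ 2 * k → b ≤ 2 * k → e a = e b → a = b) (g : κ ↪ ι)
    (hge : ∀ i a, a ≤ 2 * k → e a ≠ g i) (hsize : ∀ i, (t + 2) * ⌈γ⌉₊ ≤ #(B i))
    (h4 : ∀ i, 4 * γ ≤ #(B i))
    (hlink : ∀ i, ∀ a ≤ 2 * k, ∀ u ∈ B (e a), 16 * #(nbr G u (B (g i))) ≤ #(B (g i))) :
    ∃ (m b : κ) (Y : κ → Finset V), m ≠ b ∧ (∀ i, Y i ⊆ B (g i)) ∧
      (∀ i, #(B (g i)) ≤ 8 * (k + 1) * #(Y i)) ∧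
      ∀ x ∈ Y b, ∀ w ∈ Y m, ∃ (r : ℕ) (p : ℕ → V) (d : ℕ → ℕ), 0 < r ∧ r ≤ 2 * k + 2 ∧ p 0 = x ∧
        p r = w ∧ (∀ a < r, G.Adj (p a) (p (a + 1))) ∧
        (∀ a, 0 < a → a < r → p a ∈ B (e (d a)) ∧ d a ≤ 2 * k) ∧
        (∀ a b, 0 < a → a < r → 0 < b → b < r → d a = d b → a = b) ∧
        ∀ a, 0 < a → a < r → ∀ i, i ≠ m → i ≠ b → ∀ u ∈ Y i, ¬ G.Adj (p a) u := by
  -- Index `0` hosts the hub vertex, `1, …, k` form the first chain and `k + 1, …, 2 * k` the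
  -- second.
  set C₁ : ℕ → Finset V := fun i => B (e (1 + i)) with hC₁
  set C₂ : ℕ → Finset V := fun i => B (e (k + 1 + i)) with hC₂
  have hd : ∀ a b, a ≤ 2 * k → b ≤ 2 * k → a ≠ b → Disjoint (B (e a)) (B (e b)) :=
    fun a b ha hb hab => hB _ _ fun h => hab (he a b ha hb h)
  have hCC₁ : ∀ i < k, ∀ j < k, i ≠ j → Disjoint (C₁ i) (C₁ j) :=
    fun i hi j hj hij => hd _ _ (by omega) (by omega) (by omega)
  have hCC₂ : ∀ i < k, ∀ j < k, i ≠ j → Disjoint (C₂ i) (C₂ j) :=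
    fun i hi j hj hij => hd _ _ (by omega) (by omega) (by omega)
  -- Fewer than `γ` vertices of `B (e 0)` fail for the first chain, so enough remain to find one
  -- that also succeeds for the second.
  obtain ⟨z, hzD, hz₁, hz₂⟩ : ∃ z ∈ B (e 0), γ ≤ #(lay G C₁ {z} k) ∧ γ ≤ #(lay G C₂ {z} k) := by
    set D := (B (e 0)).filter fun z => γ ≤ #(lay G C₁ {z} k) with hD
    have h1 : (#((B (e 0)).filter fun z => ¬ γ ≤ #(lay G C₁ {z} k)) : ℝ) < γ := by
      by_contra! h
      obtain ⟨z, hz, hz'⟩ := exists_card_lay_ge hγ hG C₁ k t _ (fun i _ => hsize _) h ht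
        (fun i hi => (hd 0 _ (by omega) (by omega) (by omega)).mono_left (filter_subset _ _)) hCC₁
      exact absurd (mem_filter.1 hz).2 hz'.not_gt
    have h2 : #D + #((B (e 0)).filter fun z => ¬ γ ≤ #(lay G C₁ {z} k)) = #(B (e 0)) := by
      rw [hD]; exact card_filter_add_card_filter_not _
    have h3 : (#D : ℝ) + #((B (e 0)).filter fun z => ¬ γ ≤ #(lay G C₁ {z} k)) = #(B (e 0)) := by
      exact_mod_cast h2
    obtain ⟨z, hz, hz'⟩ := exists_card_lay_ge hγ hG C₂ k t D (fun i _ => hsize _)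
      (by linarith [h4 (e 0)]) ht
      (fun i hi => (hd 0 _ (by omega) (by omega) (by omega)).mono_left (filter_subset _ _)) hCC₂
    exact ⟨z, (mem_filter.1 hz).1, (mem_filter.1 hz).2, hz'⟩
  have hgd : ∀ a ≤ 2 * k, ∀ i, Disjoint (B (e a)) (B (g i)) := fun a ha i => hB _ _ (hge i a ha)
  have hzC : ∀ a, 0 < a → a ≤ 2 * k → z ∉ B (e a) := fun a h0 ha h =>
    disjoint_left.1 (hd 0 a (by omega) ha (by omega)) hzD h
  have hzg : ∀ i, z ∉ B (g i) := fun i h => disjoint_left.1 (hgd 0 (by omega) i) hzD h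
  obtain ⟨m, r₁, Y₁, -, hr₁, hY₁, hY₁c, hY₁m, hP₁⟩ := exists_hub hγ hG (C := C₁) (z := z) (k := k)
    (fun i hi => hzC _ (by omega) (by omega)) hCC₁ hz₁ (fun i => B (g i))
    (fun i => by linarith [h4 (g i)]) hzg (fun i j hj => hgd _ (by omega) i)
    (fun i => by have := hlink i 0 (by omega) z hzD; omega)
    (fun j hj u hu i => by have := hlink i (1 + j) (by omega) u hu; omega)
  have hY₁c' : ∀ i : {i // i ≠ m}, #(B (g i)) ≤ 2 * #(Y₁ i) := fun i => hY₁c i i.2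
  have hlink₁ : ∀ i : {i // i ≠ m}, ∀ a ≤ 2 * k, ∀ u ∈ B (e a),
      8 * #(nbr G u (Y₁ i)) ≤ #(Y₁ i) := by
    intro i a ha u hu
    have h1 := hlink i a ha u hu
    have h2 := hY₁c' i
    have h3 := card_le_card (nbr_mono G u (hY₁ i))
    omega
  obtain ⟨i₀, hi₀⟩ := exists_ne m
  have : Nonempty {i // i ≠ m} := ⟨⟨i₀, hi₀⟩⟩
  -- The second hub is taken among the sets left by the first, with `m` excluded. Hence `b ≠ m`, and
  -- the first paths still miss the shrunk sets.
  obtain ⟨b, r₂, Y₂, -, hr₂, hY₂, hY₂c, hY₂b, hP₂⟩ := exists_hub hγ hG (C := C₂) (z := z) (k := k)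
    (fun i hi => hzC _ (by omega) (by omega)) hCC₂ hz₂ (fun i : {i // i ≠ m} => Y₁ i)
    (fun i => by
      have h1 : (#(B (g i)) : ℝ) ≤ 2 * #(Y₁ i) := by exact_mod_cast hY₁c' i
      linarith [h4 (g i)])
    (fun i h => hzg i (hY₁ i h)) (fun i j hj => (hgd _ (by omega) i).mono_right (hY₁ i))
    (fun i => hlink₁ i 0 (by omega) z hzD)
    (fun j hj u hu i => hlink₁ i (k + 1 + j) (by omega) u hu)
  have hbm : (b : κ) ≠ m := b.2
  let Y : κ → Finset V := fun i => if h : i ≠ m then Y₂ ⟨i, h⟩ else Y₁ i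
  have hYm : Y m = Y₁ m := by simp [Y]
  have hYi : ∀ i : {i // i ≠ m}, Y i = Y₂ i := fun i => by simp [Y, i.2]
  refine ⟨m, b, Y, hbm.symm, ?_, ?_, ?_⟩
  · intro i
    by_cases h : i = m
    · subst h; rw [hYm]; exact hY₁ i
    · rw [hYi ⟨i, h⟩]; exact (hY₂ _).trans (hY₁ _)
  · intro i
    by_cases h : i = m
    · subst h; rw [hYm]
      refine hY₁m.trans ?_
      gcongr; omega
    · rw [hYi ⟨i, h⟩]
      have h1 := hY₁c i h
      by_cases h2 : (⟨i, h⟩ : {i // i ≠ m}) = b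
      · have h3 := hY₂b
        rw [← h2] at h3
        dsimp only at h1 h3
        calc #(B (g i)) ≤ 2 * #(Y₁ i) := h1
          _ ≤ 2 * (4 * (k + 1) * #(Y₂ ⟨i, h⟩)) := by gcongr
          _ = _ := by ring
      · have h3 := hY₂c _ h2
        dsimp only at h1 h3
        calc #(B (g i)) ≤ 4 * #(Y₂ ⟨i, h⟩) := by omega
          _ ≤ _ := by gcongr; omega
  · intro x hx w hw
    rw [hYm] at hw
    rw [hYi b] at hx
    obtain ⟨p₁, c₁, hp₁, hp₁z, hp₁w, hc₁, hc₁m, hp₁Y⟩ := hP₁ w hw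
    obtain ⟨p₂, c₂, hp₂, hp₂z, hp₂x, hc₂, hc₂m, hp₂Y⟩ := hP₂ x hx
    have hr₁0 : 0 < r₁ := by
      rcases Nat.eq_zero_or_pos r₁ with h | h
      · subst h
        exact absurd (hY₁ _ hw) (by rw [← hp₁w, hp₁z]; exact hzg m)
      · exact h
    -- Go back from `x` to `z` along `p₂`, then on to `w` along `p₁`. There may be chords between
    -- the two halves; they are removed later, by shortening.
    refine ⟨r₂ + r₁, fun a => if a ≤ r₂ then p₂ (r₂ - a) else p₁ (a - r₂),
      fun a => if a < r₂ then k + 1 + c₂ (r₂ - a) else if a = r₂ then 0 else 1 + c₁ (a - r₂),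
      by omega, by omega, by simp [hp₂x], ?_, ?_, ?_, ?_, ?_⟩
    · dsimp only
      rw [if_neg (by omega), Nat.add_sub_cancel_left, hp₁w]
    · intro a ha
      dsimp only
      rcases lt_trichotomy a r₂ with h | h | h
      · rw [if_pos h.le, if_pos (by omega), G.adj_comm]
        exact (hp₂ (r₂ - (a + 1)) (r₂ - a) (by omega) (by omega)).2.2 (by omega)
      · subst h
        rw [if_pos le_rfl, if_neg (by omega), Nat.sub_self, Nat.add_sub_cancel_left, hp₂z, ← hp₁z]
        exact (hp₁ 0 1 (by omega) (by omega)).2.2 (by omega)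
      · rw [if_neg (by omega), if_neg (by omega)]
        exact (hp₁ (a - r₂) (a + 1 - r₂) (by omega) (by omega)).2.2 (by omega)
    · intro a h0 ha
      rcases lt_trichotomy a r₂ with h | h | h
      · simp only [h.le, h, if_true]
        have := hc₂ (r₂ - a) (by omega) (by omega)
        exact ⟨this.1, by omega⟩
      · subst h
        simpa [hp₂z] using hzD
      · simp only [not_le.2 h, not_lt.2 h.le, h.ne', if_false]
        have := hc₁ (a - r₂) (by omega) (by omega)
        exact ⟨this.1, by omega⟩
    · intro a b ha0 ha hb0 hb hab
      have key : ∀ a b, 0 < a → a < b → b < r₂ + r₁ →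
          (if a < r₂ then k + 1 + c₂ (r₂ - a) else if a = r₂ then 0 else 1 + c₁ (a - r₂)) ≠
          (if b < r₂ then k + 1 + c₂ (r₂ - b) else if b = r₂ then 0 else 1 + c₁ (b - r₂)) := by
        intro a b ha hab hb
        rcases lt_trichotomy b r₂ with h | h | h
        · rw [if_pos (by omega), if_pos h]
          have := hc₂m (r₂ - b) (r₂ - a) (by omega) (by omega) (by omega)
          omega
        · rw [if_pos (by omega), if_neg (by omega), if_pos h]
          omega
        · rw [if_neg (show ¬ b < r₂ by omega), if_neg (show ¬ b = r₂ by omega)]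
          have hb' := hc₁ (b - r₂) (by omega) (by omega)
          rcases lt_trichotomy a r₂ with h' | h' | h'
          · rw [if_pos h']; omega
          · rw [if_neg (by omega), if_pos h']; omega
          · rw [if_neg (by omega), if_neg (by omega)]
            have := hc₁m (a - r₂) (b - r₂) (by omega) (by omega) (by omega)
            omega
      rcases lt_trichotomy a b with h | h | h
      · exact absurd hab (key a b ha0 h hb)
      · exact h
      · exact absurd hab.symm (key b a hb0 h ha)
    · intro a h0 ha i him hib u hu
      rw [hYi ⟨i, him⟩] at hu
      dsimp only
      split_ifs with h
      · exact hp₂Y _ (by omega) ⟨i, him⟩ (fun h => hib (congrArg Subtype.val h)) u hu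
      · exact hp₁Y _ (by omega) i him u (hY₂ _ hu)

theorem ne_of_mem_of_index_ne {ι : Type*} {B : ι → Finset V}
    (hB : ∀ i j, i ≠ j → Disjoint (B i) (B j)) {i j : ι} (hij : i ≠ j) {x y : V} (hx : x ∈ B i)
    (hy : y ∈ B j) : x ≠ y := fun h =>
  disjoint_left.1 (hB i j hij) hx (h ▸ hy)

theorem exists_embedding_pair {ι : Type*} [Fintype ι] (r s : ℕ) (h : r + 1 + s ≤ Fintype.card ι) :
    ∃ (e : ℕ → ι) (g : Fin s ↪ ι), (∀ a b, a ≤ r → b ≤ r → e a = e b → a = b) ∧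
      ∀ i a, a ≤ r → e a ≠ g i := by
  obtain ⟨E⟩ : Nonempty (Fin (r + 1) ⊕ Fin s ↪ ι) :=
    Function.Embedding.nonempty_of_card_le (by simpa using h)
  refine ⟨fun a => E (Sum.inl (Fin.ofNat (r + 1) a)), Function.Embedding.inr.trans E, ?_, ?_⟩
  · intro a b ha hb hab
    have := congrArg Fin.val (Sum.inl_injective (E.injective hab))
    simpa [Fin.ofNat, Nat.mod_eq_of_lt (Nat.lt_succ_of_le ha),
      Nat.mod_eq_of_lt (Nat.lt_succ_of_le hb)] using this
  · intro i a _ h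
    have := E.injective h
    simp at this

/-- Many vertices `x` of some set of a blockade are joined to all vertices of a sub-blockade by
short induced paths, whose interiors have no neighbours in the other sets of the sub-blockade. -/
theorem exists_joined {c : ℝ} (hc1 : c < 1) {k : ℕ} (hk : 1 < (k + 1) * c)
    (ι' : Type) [Fintype ι'] {σ' lam' : ℝ} (hσ' : 0 < σ') (hlam' : 0 < lam') :
    ∃ (K : ℕ) (σ lam : ℝ), 0 < σ ∧ 0 < lam ∧ ∀ᶠ n : ℕ in atTop, ∀ (V : Type u) [Fintype V]
      (G : SimpleGraph V), Fintype.card V = n → Coh G ((n : ℝ) ^ (1 - c)) →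
      ∀ (ι : Type) [Fintype ι] (B : ι → Finset V), K ≤ Fintype.card ι → Blockade G σ lam B →
      ∃ (φ : ι' ↪ ι) (B' : ι' → Finset V) (b : ι) (D : Finset V), (∀ i, B' i ⊆ B (φ i)) ∧
        Blockade G σ' lam' B' ∧ (∀ i, φ i ≠ b) ∧ D ⊆ B b ∧ (n : ℝ) ^ (1 - σ') ≤ #D ∧
        ∀ x ∈ D, ∀ i, 8 * #(nbr G x (B' i)) ≤ #(B' i) ∧ ∀ v ∈ B' i,
          ∃ (r : ℕ) (p : ℕ → V) (d : ℕ → ι), 0 < r ∧ r ≤ 2 * k + 3 ∧ IndPath G p r ∧ p 0 = x ∧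
            p r = v ∧ (∀ a, 0 < a → a < r → p a ∈ B (d a) ∧ d a ≠ b ∧ (∀ j, d a ≠ φ j) ∧
              ∀ j, j ≠ i → ∀ u ∈ B' j, ¬ G.Adj (p a) u) ∧
            ∀ a a', 0 < a → a < r → 0 < a' → a' < r → d a = d a' → a = a' := by
  have hc : 0 < c := by
    by_contra! h
    have : ((k : ℝ) + 1) * c ≤ 0 := mul_nonpos_of_nonneg_of_nonpos (by positivity) h
    linarith
  obtain ⟨σ₀, hσ₀, hσ₀c, hchain⟩ := exists_chain_parameter hc1 hk
  obtain ⟨K₂, σ₂, lam₂, hσ₂, hlam₂, hpriv⟩ := exists_private_nbrs.{u} hc ι' hσ' hlam'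
  set q := Fintype.card ι' with hq
  set σY := min σ₂ (σ' / 2) with hσY
  set lamY := min lam₂ (1 / (16 * ((q : ℝ) + 1))) with hlamY
  have hσY0 : 0 < σY := by positivity
  have hlamY0 : 0 < lamY := by positivity
  have hlamY1 : lamY * (16 * ((q : ℝ) + 1)) ≤ 1 := by
    rw [← le_div_iff₀ (by positivity)]; exact min_le_right _ _
  have hσY' : σY < σ' := (min_le_right _ _).trans_lt (by linarith)
  set R : ℝ := 8 * (k + 1) with hR
  have hR1 : 1 ≤ R := by rw [hR]; linarith [(Nat.cast_nonneg k : (0 : ℝ) ≤ k)]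
  -- `2 * k + 1` sets serve the double hub. The other `K₂ + 2` are enough for private neighbours and
  -- guarantee two distinct indices.
  refine ⟨2 * k + 1 + (K₂ + 2), min (σY / 2) σ₀, lamY / R, by positivity, by positivity, ?_⟩
  filter_upwards [eventually_gt_atTop 1, hchain, hpriv,
    eventually_mul_rpow_le (a := 1 - c) (b := 1 - σ₀) (by linarith) 4,
    eventually_mul_rpow_le (a := 1 - σY) (b := 1 - min (σY / 2) σ₀)
      (by linarith [min_le_left (σY / 2) σ₀]) R,
    eventually_mul_rpow_le (a := 1 - σ') (b := 1 - σY) (by linarith) 2]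
    with n hn1 hn_chain hn_priv hn4 hnR hnσ
  intro V _ G hV hG ι _ B hK hB
  obtain ⟨t, ht1, ht2⟩ := hn_chain
  have hn1' : (1 : ℝ) ≤ n := by exact_mod_cast hn1.le
  have hγ0 : 0 < (n : ℝ) ^ (1 - c) := Real.rpow_pos_of_pos (by linarith) _
  have hwide : ∀ i, (n : ℝ) ^ (1 - σ₀) ≤ #(B i) := fun i => by
    refine le_trans (Real.rpow_le_rpow_of_exponent_le hn1' ?_) (hV ▸ hB.width i)
    linarith [min_le_right (σY / 2) σ₀]
  obtain ⟨e, g, he, hge⟩ := exists_embedding_pair (2 * k) (K₂ + 2) hK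
  have : Nontrivial (Fin (K₂ + 2)) := inferInstance
  have hlamR : lamY / R ≤ 1 / 16 := by
    calc lamY / R ≤ lamY := div_le_self hlamY0.le hR1
      _ ≤ 1 / (16 * ((q : ℝ) + 1)) := min_le_right _ _
      _ ≤ 1 / 16 := by
        apply one_div_le_one_div_of_le (by norm_num)
        linarith [(Nat.cast_nonneg q : (0 : ℝ) ≤ q)]
  obtain ⟨m, b, Y, hmb, hYB, hYc, hYp⟩ := exists_double_hub hγ0 hG ht2 B hB.disj e he g hge
    (fun i => by exact_mod_cast ht1.trans (hwide i)) (fun i => hn4.trans (hwide i))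
    (fun i a ha u hu => by
      have h1 := hB.link (e a) (g i) (hge i a ha) u hu
      have h2 : (16 : ℝ) * #(nbr G u (B (g i))) ≤ #(B (g i)) := by
        have : lamY / R * #(B (g i)) ≤ 1 / 16 * #(B (g i)) := by gcongr
        linarith
      exact_mod_cast h2)
  have hY : Blockade G σY lamY Y := by
    have := hB.shrink (σ' := σY) (R := R) g hYB (by positivity) (by linarith)
      (fun i => by rw [hR]; exact_mod_cast hYc i) (by rw [hV]; exact hnR)
    rwa [mul_div_cancel₀ _ (by linarith : R ≠ 0)] at this
  obtain ⟨φ, B', hB'Y, hB', hφ, hw⟩ := hn_priv V G hV hG (Fin (K₂ + 2)) Y (by simp)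
    (hY.mono (min_le_left _ _) (min_le_left _ _) (by omega)) m b
  have hYdisj := hY.disj
  -- Vertices of `Y b` that see over an eighth of some `B' i` would spoil the later hub. By double
  -- counting these `q` exceptional sets together fill at most half of `Y b`.
  set heavy : ι' → Finset V :=
    fun i => (Y b).filter fun x => (1 / 8 : ℝ) * #(B' i) < #(nbr G x (B' i)) with hheavy
  have hB'ne : ∀ i, (B' i).Nonempty := fun i => by
    have := (Real.rpow_pos_of_pos (by linarith : (0 : ℝ) < n) (1 - σ')).trans_le (hV ▸ hB'.width i)
    exact card_pos.1 (by exact_mod_cast this)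
  have hheavyc : ∀ i, (#(heavy i) : ℝ) ≤ lamY / (1 / 8) * #(Y b) := fun i =>
    card_heavy_le (hB'ne i) (by norm_num) fun z hz =>
      hY.link (φ i) b (hφ i).2 z (hB'Y i hz)
  set D := Y b \ univ.biUnion heavy with hD
  have hDc : (#(Y b) : ℝ) ≤ 2 * #D := by
    have h1 : #(Y b) ≤ #D + #(univ.biUnion heavy) := by
      rw [hD]; exact card_le_card_sdiff_add_card
    have h2 : (#(univ.biUnion heavy) : ℝ) ≤ q * (lamY / (1 / 8) * #(Y b)) := by
      calc (#(univ.biUnion heavy) : ℝ) ≤ ∑ i, (#(heavy i) : ℝ) := by exact_mod_cast card_biUnion_le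
        _ ≤ ∑ _i : ι', lamY / (1 / 8) * #(Y b) := sum_le_sum fun i _ => hheavyc i
        _ = _ := by rw [sum_const, nsmul_eq_mul, card_univ]
    have h3 : (#(Y b) : ℝ) ≤ #D + #(univ.biUnion heavy) := by exact_mod_cast h1
    have h4 : (q : ℝ) * (lamY / (1 / 8) * #(Y b)) ≤ 1 / 2 * #(Y b) := by
      have : (q : ℝ) * (lamY / (1 / 8)) ≤ 1 / 2 := by linarith
      calc (q : ℝ) * (lamY / (1 / 8) * #(Y b)) = q * (lamY / (1 / 8)) * #(Y b) := by ring
        _ ≤ _ := by gcongr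
    linarith
  refine ⟨φ.trans g, B', g b, D, fun i => (hB'Y i).trans (hYB _), hB',
    fun i h => (hφ i).2 (g.injective h), sdiff_subset.trans (hYB b), ?_, ?_⟩
  · have := hV ▸ hY.width b
    linarith
  · intro x hx i
    obtain ⟨hxY, hxh⟩ := mem_sdiff.1 hx
    refine ⟨?_, fun v hv => ?_⟩
    · by_contra! h
      refine hxh (mem_biUnion.2 ⟨i, mem_univ _, mem_filter.2 ⟨hxY, ?_⟩⟩)
      have : (#(B' i) : ℝ) < 8 * #(nbr G x (B' i)) := by exact_mod_cast h
      linarith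
    · obtain ⟨w, hwm, hwv, hwn⟩ := hw i v hv
      obtain ⟨r, p, d, hr0, hr, hp0, hpr, hpadj, hpd, hd, hpY⟩ := hYp x hxY w hwm
      -- Append `v` to the walk from `x` to its private neighbour `w`. The vertices lie in distinct
      -- sets of `B`, recorded by `f`, so shortening gives an induced path of length at most `2 * k
      -- + 3`.
      let p' : ℕ → V := fun a => if a ≤ r then p a else v
      let f : ℕ → ι := fun a => if a = 0 then g b else if a < r then e (d a) else
        if a = r then g m else g (φ i)
      have hmem : ∀ a ≤ r + 1, p' a ∈ B (f a) := by
        intro a ha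
        simp only [p', f]
        by_cases h0 : a = 0
        · subst h0; simpa [hp0] using hYB _ hxY
        rw [if_neg h0]
        rcases lt_trichotomy a r with h | h | h
        · rw [if_pos h.le, if_pos h]
          exact (hpd a (by omega) h).1
        · subst h
          simpa [hpr] using hYB _ hwm
        · rw [if_neg (by omega), if_neg (by omega), if_neg (by omega)]
          exact hYB _ (hB'Y _ hv)
      have hf : ∀ a a', a < a' → a' ≤ r + 1 → f a ≠ f a' := by
        intro a a' haa ha'
        have hgm : g b ≠ g m := fun h => hmb (g.injective h).symm
        have hgb : g b ≠ g (φ i) := fun h => (hφ i).2 (g.injective h).symm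
        have hgm' : g m ≠ g (φ i) := fun h => (hφ i).1 (g.injective h).symm
        simp only [f]
        rw [if_neg (show a' ≠ 0 by omega)]
        rcases Nat.eq_zero_or_pos a with h0 | h0
        · rw [if_pos h0]
          split_ifs with h1 h2
          · exact (hge _ _ (hpd a' (by omega) h1).2).symm
          · exact hgm
          · exact hgb
        · rw [if_neg h0.ne']
          by_cases h1 : a < r
          · rw [if_pos h1]
            have h2 := (hpd a h0 h1).2
            split_ifs with h3 h4
            · intro h
              have := hd a a' h0 h1 (by omega) h3 (he _ _ h2 (hpd a' (by omega) h3).2 h)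
              omega
            · exact hge _ _ h2
            · exact hge _ _ h2
          · rw [if_neg h1, if_pos (by omega), if_neg (by omega), if_neg (by omega)]
            exact hgm'
      obtain ⟨L, s, hL, hs0, hsL, hsm, hs⟩ := exists_indPath_of_seq G p' (r + 1)
        (fun a a' haa ha' => ne_of_mem_of_index_ne hB.disj (hf a a' haa ha') (hmem a (by omega))
          (hmem a' ha'))
        (fun a ha => by
          simp only [p']
          rw [if_pos (by omega)]
          split_ifs with h
          · exact hpadj a (by omega)
          · have : a = r := by omega
            subst this
            rw [hpr]; exact hwv)
      have hL0 : 0 < L := by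
        rcases Nat.eq_zero_or_pos L with h | h
        · subst h; omega
        · exact h
      have hsint : ∀ a, 0 < a → a < L → 0 < s a ∧ s a < r + 1 := fun a h0 ha =>
        ⟨hs0 ▸ hsm 0 a h0 ha.le, hsL ▸ hsm a L ha le_rfl⟩
      refine ⟨L, fun a => p' (s a), fun a => f (s a), hL0, by omega, hs, ?_, ?_, ?_, ?_⟩
      · simp [hs0, p', hp0]
      · simp [hsL, p']
      · intro a h0 ha
        obtain ⟨hs1, hs2⟩ := hsint a h0 ha
        refine ⟨hmem _ hs2.le, ?_, ?_, ?_⟩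
        · have := hf 0 (s a) hs1 hs2.le
          exact fun h => this (Eq.symm h)
        · intro j
          simp only [f, Function.Embedding.trans_apply]
          rw [if_neg hs1.ne']
          split_ifs with h1 h2
          · exact hge _ _ (hpd _ hs1 h1).2
          · exact fun h => (hφ j).1 (g.injective h).symm
          · omega
        · intro j hj u hu
          simp only [p']
          rw [if_pos (by omega)]
          rcases Nat.lt_or_ge (s a) r with h | h
          · exact hpY _ hs1 h (φ j) (hφ j).1 (hφ j).2 u (hB'Y j hu)
          · have : s a = r := by omega
            rw [this, hpr]
            exact hwn j hj u hu
      · intro a a' h0 ha h0' ha' h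
        by_contra hne
        rcases lt_or_gt_of_ne hne with hlt | hlt
        · exact hf _ _ (hsm a a' hlt ha'.le) (hsint a' h0' ha').2.le h
        · exact hf _ _ (hsm a' a hlt ha.le) (hsint a h0 ha).2.le h.symm

end Hubs

end PurePairs

namespace PurePairs

/-! ### Links of prescribed length -/

section Links

open Finset Classical Filter

universe u

/-- Every sufficiently good blockade contains a sub-blockade as good as desired that satisfies
`P`. -/
def Forces (c : ℝ) (P : ∀ {V : Type u} (_ : SimpleGraph V) {ι ι' : Type} (_ : ι → Finset V)
    (_ : ι' ↪ ι) (_ : ι' → Finset V), Prop) : Prop :=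
  ∀ (ι' : Type) [Fintype ι'] (σ' lam' : ℝ), 0 < σ' → 0 < lam' →
    ∃ (K : ℕ) (σ lam : ℝ), 0 < σ ∧ 0 < lam ∧ ∀ᶠ n : ℕ in atTop, ∀ (V : Type u) [Fintype V]
      (G : SimpleGraph V), Fintype.card V = n → Coh G ((n : ℝ) ^ (1 - c)) →
      ∀ (ι : Type) [Fintype ι] (B : ι → Finset V), K ≤ Fintype.card ι → Blockade G σ lam B →
      ∃ (φ : ι' ↪ ι) (B' : ι' → Finset V), (∀ i, B' i ⊆ B (φ i)) ∧ Blockade G σ' lam' B' ∧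
        P G B φ B'

/-- Any two vertices in distinct sets `B' i` and `B' j` are joined by a path of length `ℓ` that is
induced up to the adjacency of its ends, and whose interior lies in distinct sets of the family
`B` that are unused by `B'`, and has no neighbours in the other sets of `B'`. -/
def Linked (ℓ : ℕ) {V : Type u} (G : SimpleGraph V) {ι ι' : Type} (B : ι → Finset V)
    (φ : ι' ↪ ι) (B' : ι' → Finset V) : Prop :=
  ∀ i j, i ≠ j → ∀ v ∈ B' i, ∀ v' ∈ B' j, ∃ (p : ℕ → V) (d : ℕ → ι), p 0 = v ∧ p ℓ = v' ∧
    (∀ a b, a < b → b ≤ ℓ → ¬ (a = 0 ∧ b = ℓ) → (G.Adj (p a) (p b) ↔ b = a + 1)) ∧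
    (∀ a, 0 < a → a < ℓ → p a ∈ B (d a) ∧ (∀ l, d a ≠ φ l) ∧
      ∀ l, l ≠ i → l ≠ j → ∀ u ∈ B' l, ¬ G.Adj (p a) u) ∧
    ∀ a b, 0 < a → a < ℓ → 0 < b → b < ℓ → d a = d b → a = b

theorem Linked.restrict {ℓ : ℕ} {V : Type u} {G : SimpleGraph V} {ι ι₁ ι₂ : Type}
    {B : ι → Finset V} {φ₁ : ι₁ ↪ ι} {B₁ : ι₁ → Finset V} (h : Linked ℓ G B φ₁ B₁) (φ₂ : ι₂ ↪ ι₁)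
    {B₂ : ι₂ → Finset V} (hB₂ : ∀ i, B₂ i ⊆ B₁ (φ₂ i)) : Linked ℓ G B (φ₂.trans φ₁) B₂ := by
  intro i j hij v hv v' hv'
  obtain ⟨p, d, h0, hℓ, hp, hd, hinj⟩ :=
    h (φ₂ i) (φ₂ j) (fun h => hij (φ₂.injective h)) v (hB₂ i hv) v' (hB₂ j hv')
  refine ⟨p, d, h0, hℓ, hp, fun a ha0 ha => ?_, hinj⟩
  obtain ⟨h1, h2, h3⟩ := hd a ha0 ha
  exact ⟨h1, fun l => h2 _, fun l hli hlj u hu => h3 (φ₂ l) (fun h => hli (φ₂.injective h))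
    (fun h => hlj (φ₂.injective h)) u (hB₂ l hu)⟩

/-- Put `v` in front of a link from its private neighbour `w` to `v'`. The old interior misses `v`,
which lies in neither end set, and privacy makes `w` miss `v'`. That nonadjacency is needed since
`w` and `v'` may have been adjacent ends of the old link. -/
theorem Linked.extend {ℓ : ℕ} (hℓ : 2 ≤ ℓ) {V : Type u} {G : SimpleGraph V} {ι ι₁ ι₂ : Type}
    {B : ι → Finset V} {φ₁ : ι₁ ↪ ι} {B₁ : ι₁ → Finset V} (hB₁ : ∀ i, B₁ i ⊆ B (φ₁ i))
    (h : Linked ℓ G B φ₁ B₁) (φ₂ : ι₂ ↪ ι₁)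
    {B₂ : ι₂ → Finset V} (hB₂ : ∀ i, B₂ i ⊆ B₁ (φ₂ i)) {m : ι₁} (hm : ∀ i, φ₂ i ≠ m)
    (hpriv : ∀ i, ∀ v ∈ B₂ i, ∃ w ∈ B₁ m, G.Adj w v ∧ ∀ j, j ≠ i → ∀ u ∈ B₂ j, ¬ G.Adj w u) :
    Linked (ℓ + 1) G B (φ₂.trans φ₁) B₂ := by
  intro i j hij v hv v' hv'
  obtain ⟨w, hwm, hwv, hw⟩ := hpriv i v hv
  obtain ⟨p, d, h0, hpℓ, hp, hd, hinj⟩ := h m (φ₂ j) (hm j).symm w hwm v' (hB₂ j hv')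
  have hij' : φ₂ i ≠ φ₂ j := fun h => hij (φ₂.injective h)
  refine ⟨fun a => if a = 0 then v else p (a - 1), fun a => if a = 1 then φ₁ m else d (a - 1),
    by simp, by simpa using hpℓ, ?_, ?_, ?_⟩
  · intro a b hab hb hne
    dsimp only
    rw [if_neg (show b ≠ 0 by omega)]
    rcases Nat.eq_zero_or_pos a with ha | ha
    · subst ha
      rw [if_pos rfl]
      have hbℓ : b ≠ ℓ + 1 := fun h => hne ⟨rfl, h⟩
      rcases Nat.lt_or_ge 1 b with hb1 | hb1
      · have := (hd (b - 1) (by omega) (by omega)).2.2 (φ₂ i) (hm i) hij' v (hB₂ i hv)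
        rw [G.adj_comm]
        constructor
        · exact fun h => absurd h this
        · omega
      · have : b = 1 := by omega
        subst this
        simpa [h0] using hwv.symm
    · rw [if_neg (by omega)]
      by_cases hc : a = 1 ∧ b = ℓ + 1
      · obtain ⟨rfl, rfl⟩ := hc
        simp only [Nat.sub_self, Nat.add_sub_cancel, h0, hpℓ]
        constructor
        · exact fun h => absurd h (hw j hij.symm v' hv')
        · omega
      · rw [hp (a - 1) (b - 1) (by omega) (by omega) (by omega)]
        omega
  · intro a ha0 ha
    dsimp only
    rw [if_neg ha0.ne']
    by_cases h1 : a = 1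
    · subst h1
      simp only [Nat.sub_self, if_true, h0]
      refine ⟨hB₁ m hwm, fun l hl => hm l (φ₁.injective hl).symm, fun l hli _ u hu => hw l hli u hu⟩
    · rw [if_neg h1]
      obtain ⟨h2, h3, h4⟩ := hd (a - 1) (by omega) (by omega)
      exact ⟨h2, fun l => h3 _, fun l hli hlj u hu =>
        h4 (φ₂ l) (hm l) (fun h => hlj (φ₂.injective h)) u (hB₂ l hu)⟩
  · intro a b ha0 ha hb0 hb hab
    dsimp only at hab
    split_ifs at hab with h1 h2 h2
    · omega
    · exact absurd hab.symm ((hd (b - 1) (by omega) (by omega)).2.1 m)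
    · exact absurd hab ((hd (a - 1) (by omega) (by omega)).2.1 m)
    · have := hinj _ _ (by omega) (by omega) (by omega) (by omega) hab
      omega

/-- Paths of bounded length that are equal to one of given lengths can be chosen uniformly. -/
theorem exists_uniform {κ : Type*} [Fintype κ] {V : Type u} (Y : κ → Finset V) (P : κ → V → ℕ → Prop)
    {T s : ℕ} (hP : ∀ i, ∀ v ∈ Y i, ∃ r < T, P i v r) (hT : 0 < T) (hs : T * s ≤ Fintype.card κ) :
    ∃ (r : ℕ) (S : Finset κ) (Z : κ → Finset V), r < T ∧ s ≤ #S ∧ ∀ i ∈ S, Z i ⊆ Y i ∧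
      #(Y i) ≤ T * #(Z i) ∧ ∀ v ∈ Z i, P i v r := by
  have hZ : ∀ i, ∃ r < T, #(Y i) ≤ T * #((Y i).filter fun v => P i v r) := by
    intro i
    choose! f hf using hP i
    obtain ⟨r, hr, hc⟩ := exists_large_fiber (Y i) (range T) f
      (fun v hv => mem_range.2 (hf v hv).1) ⟨0, mem_range.2 hT⟩
    rw [card_range] at hc
    refine ⟨r, mem_range.1 hr, hc.trans ?_⟩
    gcongr with v
    rintro rfl
    exact (hf v ‹_›).2
  choose ρ hρ hρc using hZ
  obtain ⟨r, hrT, hr⟩ := exists_large_fiber (univ : Finset κ) (range T) ρ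
    (fun i _ => mem_range.2 (hρ i)) ⟨0, mem_range.2 hT⟩
  rw [card_univ, card_range] at hr
  refine ⟨r, univ.filter fun i => ρ i = r, fun i => (Y i).filter fun v => P i v r,
    mem_range.1 hrT, Nat.le_of_mul_le_mul_left ?_ hT, ?_⟩
  · refine (hs.trans hr).trans (le_of_eq ?_)
    congr
  · intro i hi
    have h1 : ρ i = r := (mem_filter.1 hi).2
    subst h1
    exact ⟨filter_subset _ _, hρc i, fun v hv => (mem_filter.1 hv).2⟩

/-- Two bunches of induced paths from a common vertex `x` give links. -/
theorem linked_of_paths {V : Type u} {G : SimpleGraph V} {ι ι₄ κ ι' : Type}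
    {B : ι → Finset V} {φ₄ : ι₄ ↪ ι} {B₄ : ι₄ → Finset V}
    (hB₄ : ∀ i, B₄ i ⊆ B (φ₄ i)) {b : ι} (hb : ∀ i, φ₄ i ≠ b) {x : V} (hx : x ∈ B b)
    {k r r₃ : ℕ} (hr : 0 < r) (hr₃ : 0 < r₃) {e : ℕ → ι₄} {g : κ ↪ ι₄}
    (he : ∀ a b, a < k → b < k → e a = e b → a = b) (hge : ∀ i a, a < k → e a ≠ g i)
    {Y : κ → Finset V} (hY : ∀ i, Y i ⊆ B₄ (g i)) {m : κ}
    (h₃ : ∀ w ∈ Y m, ∃ (p : ℕ → V) (c : ℕ → ℕ), IndPath G p r₃ ∧ p 0 = x ∧ p r₃ = w ∧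
        (∀ a, 0 < a → a < r₃ → p a ∈ B₄ (e (c a)) ∧ c a < k) ∧
        (∀ a b, 0 < a → a < b → b < r₃ → c a < c b) ∧
        (∀ a < r₃, ∀ i, i ≠ m → ∀ u ∈ Y i, ¬ G.Adj (p a) u))
    {φ : ι' ↪ κ} (hφ : ∀ i, φ i ≠ m) {B' : ι' → Finset V} (hB' : ∀ i, B' i ⊆ Y (φ i))
    (h₁ : ∀ i, ∀ v ∈ B' i, ∃ (p : ℕ → V) (d : ℕ → ι), IndPath G p r ∧ p 0 = x ∧ p r = v ∧
        (∀ a, 0 < a → a < r → p a ∈ B (d a) ∧ d a ≠ b ∧ (∀ j, d a ≠ φ₄ j) ∧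
          ∀ j, j ≠ g (φ i) → ∀ u ∈ B₄ j, ¬ G.Adj (p a) u) ∧
        ∀ a a', 0 < a → a < r → 0 < a' → a' < r → d a = d a' → a = a')
    (hpriv : ∀ i, ∀ v ∈ B' i, ∃ w ∈ Y m, G.Adj w v ∧ ∀ j, j ≠ i → ∀ u ∈ B' j, ¬ G.Adj w u) :
    Linked (r + r₃ + 1) G B ((φ.trans g).trans φ₄) B' := by
  intro i j hij v hv v' hv'
  obtain ⟨w, hwm, hwv, hw⟩ := hpriv j v' hv'
  obtain ⟨p₁, d₁, hp₁, hp₁x, hp₁v, hd₁, hd₁inj⟩ := h₁ i v hv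
  obtain ⟨p₃, c₃, hp₃, hp₃x, hp₃w, hc₃, hc₃m, hp₃Y⟩ := h₃ w hwm
  have hgφ : ∀ i j, i ≠ j → g (φ i) ≠ g (φ j) := fun i j hij h =>
    hij (φ.injective (g.injective h))
  have hgm : ∀ i, g (φ i) ≠ g m := fun i h => hφ i (g.injective h)
  -- Go from `v` back along `p₁` to `x`, along `p₃` to `w`, then to `v'`. The interior of `p₁`
  -- misses every set of `B₄` except that of `v`, hence misses `p₃` after `x`, and `v'`. The
  -- vertices of `p₃` before `w` miss `v` and `v'`, and `w` misses `v` by privacy.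
  refine ⟨fun a => if a < r then p₁ (r - a) else if a ≤ r + r₃ then p₃ (a - r) else v',
    fun a => if a < r then d₁ (r - a) else if a = r then b else
      if a < r + r₃ then φ₄ (e (c₃ (a - r))) else φ₄ (g m), ?_, ?_, ?_, ?_, ?_⟩
  · simp [hr, hp₁v]
  · dsimp only
    rw [if_neg (by omega), if_neg (by omega)]
  · intro a a' haa ha' hne
    dsimp only
    have hfalse : ∀ {Q : Prop}, ¬ Q → ¬ a' = a + 1 → (Q ↔ a' = a + 1) :=
      fun h h' => ⟨fun q => absurd q h, fun q => absurd q h'⟩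
    by_cases h1 : a' < r
    · rw [if_pos (by omega), if_pos h1, G.adj_comm,
        (hp₁ (r - a') (r - a) (by omega) (by omega)).2]
      omega
    rw [if_neg h1]
    by_cases h2 : a < r
    · rw [if_pos h2]
      by_cases h3 : a' = r
      · subst h3
        rw [if_pos (by omega), Nat.sub_self, hp₃x, ← hp₁x, G.adj_comm,
          (hp₁ 0 (a' - a) (by omega) (by omega)).2]
        omega
      refine hfalse ?_ (by omega)
      rcases Nat.eq_zero_or_pos a with h4 | h4
      · subst h4
        rw [Nat.sub_zero, hp₁v, if_pos (by omega), G.adj_comm]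
        rcases Nat.lt_or_ge (a' - r) r₃ with h5 | h5
        · exact hp₃Y _ h5 (φ i) (hφ i) v (hB' i hv)
        · have : a' - r = r₃ := by omega
          rw [this, hp₃w]
          exact hw i hij v hv
      · have h5 := (hd₁ (r - a) (by omega) (by omega)).2.2.2
        split_ifs with h6
        · rcases Nat.lt_or_ge (a' - r) r₃ with h7 | h7
          · have h8 := hc₃ (a' - r) (by omega) h7
            exact h5 _ (hge _ _ h8.2) _ h8.1
          · have : a' - r = r₃ := by omega
            rw [this, hp₃w]
            exact h5 _ (hgm i).symm _ (hY m hwm)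
        · exact h5 _ (hgφ j i hij.symm) _ (hY _ (hB' j hv'))
    · rw [if_neg h2, if_pos (by omega)]
      split_ifs with h3
      · rw [(hp₃ (a - r) (a' - r) (by omega) (by omega)).2]
        omega
      · rcases Nat.lt_or_ge (a - r) r₃ with h4 | h4
        · exact hfalse (hp₃Y _ h4 (φ j) (hφ j) v' (hB' j hv')) (by omega)
        · have : a - r = r₃ := by omega
          rw [this, hp₃w]
          exact ⟨fun _ => by omega, fun _ => hwv⟩
  · intro a ha0 ha
    dsimp only
    by_cases h1 : a < r
    · rw [if_pos h1, if_pos h1]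
      obtain ⟨h2, -, h4, h5⟩ := hd₁ (r - a) (by omega) (by omega)
      exact ⟨h2, fun l => h4 _, fun l hli _ u hu => h5 _ (hgφ l i hli) u (hY _ (hB' l hu))⟩
    rw [if_neg h1, if_neg h1, if_pos (show a ≤ r + r₃ by omega)]
    refine ⟨?_, ?_, ?_⟩
    · split_ifs with h2 h3
      · rw [h2, Nat.sub_self, hp₃x]; exact hx
      · exact hB₄ _ (hc₃ (a - r) (by omega) (by omega)).1
      · have : a - r = r₃ := by omega
        rw [this, hp₃w]
        exact hB₄ _ (hY m hwm)
    · intro l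
      simp only [Function.Embedding.trans_apply]
      split_ifs with h2 h3
      · exact (hb _).symm
      · exact fun h => hge _ _ (hc₃ (a - r) (by omega) (by omega)).2 (φ₄.injective h)
      · exact fun h => hgm l (φ₄.injective h).symm
    · intro l hli hlj u hu
      rcases Nat.lt_or_ge (a - r) r₃ with h4 | h4
      · exact hp₃Y _ h4 (φ l) (hφ l) u (hB' l hu)
      · have : a - r = r₃ := by omega
        rw [this, hp₃w]
        exact hw l hlj u hu
  · have key : ∀ a a', 0 < a → a < a' → a' < r + r₃ + 1 →
        (if a < r then d₁ (r - a) else if a = r then b else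
          if a < r + r₃ then φ₄ (e (c₃ (a - r))) else φ₄ (g m)) ≠
        (if a' < r then d₁ (r - a') else if a' = r then b else
          if a' < r + r₃ then φ₄ (e (c₃ (a' - r))) else φ₄ (g m)) := by
      intro a a' ha0 haa ha'
      by_cases h1 : a < r
      · rw [if_pos h1]
        obtain ⟨-, h2, h3, -⟩ := hd₁ (r - a) (by omega) (by omega)
        split_ifs with h4 h5 h6
        · intro h
          have := hd₁inj _ _ (by omega) (by omega) (by omega) (by omega) h
          omega
        · exact h2
        · exact h3 _
        · exact h3 _
      · rw [if_neg h1, if_neg (show ¬ a' < r by omega), if_neg (show ¬ a' = r by omega)]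
        by_cases h2 : a = r
        · rw [if_pos h2]
          split_ifs
          · exact (hb _).symm
          · exact (hb _).symm
        · rw [if_neg h2, if_pos (by omega)]
          have h3 := hc₃ (a - r) (by omega) (by omega)
          split_ifs with h4
          · intro h
            have h5 := hc₃ (a' - r) (by omega) (by omega)
            have h6 := hc₃m (a - r) (a' - r) (by omega) (by omega) (by omega)
            exact h6.ne (he _ _ h3.2 h5.2 (φ₄.injective h))
          · exact fun h => hge _ _ h3.2 (φ₄.injective h)
    intro a a' ha0 ha ha0' ha' h
    rcases lt_trichotomy a a' with hlt | hlt | hlt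
    · exact absurd h (key a a' ha0 hlt ha')
    · exact hlt
    · exact absurd h.symm (key a' a ha0' hlt ha)

/-- A vertex `x` from `exists_joined` is made a hub through `k` reserved sets of the joined
sub-blockade. The paths of length at most `2 * k + 3` to one end and at most `k + 1` to the hub set,
with one edge to a private neighbour, add up to at most `3 * k + 5`. -/
theorem forces_linked_le {c : ℝ} (hc1 : c < 1) {k : ℕ} (hk : 1 < (k + 1) * c) :
    Forces.{u} c fun G _ _ B φ B' => ∃ ℓ, 2 ≤ ℓ ∧ ℓ ≤ 3 * k + 5 ∧ Linked ℓ G B φ B' := by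
  intro ι' _ σ' lam' hσ' hlam'
  have hc : 0 < c := by
    by_contra! h
    have : ((k : ℝ) + 1) * c ≤ 0 := mul_nonpos_of_nonneg_of_nonpos (by positivity) h
    linarith
  obtain ⟨K₅, σ₅, lam₅, hσ₅, hlam₅, hpriv⟩ := exists_private_nbrs.{u} hc ι' hσ' hlam'
  obtain ⟨σ₀, hσ₀, hσ₀c, hchain⟩ := exists_chain_parameter hc1 hk
  -- Making the lengths of the joining paths equal is a pigeonhole over `2 * k + 4` values, after
  -- which at least `K₅ + 1` sets remain.
  set K₄ := (2 * k + 4) * (K₅ + 1) with hK₄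
  set R : ℝ := 4 * (k + 1) * (2 * k + 4) with hR
  have hR0 : 0 < R := by positivity
  obtain ⟨K, σ, lam, hσ, hlam, hjoin⟩ := exists_joined.{u} hc1 hk (Fin (k + 1 + K₄))
    (σ' := min σ₀ (σ₅ / 2)) (lam' := min (1 / 8) (lam₅ / R)) (by positivity) (by positivity)
  refine ⟨K, σ, lam, hσ, hlam, ?_⟩
  filter_upwards [eventually_gt_atTop 1, hchain, hpriv, hjoin,
    eventually_mul_rpow_le (a := 1 - c) (b := 1 - σ₀) (by linarith) 2,
    eventually_mul_rpow_le (a := 1 - σ₅) (b := 1 - min σ₀ (σ₅ / 2))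
      (by linarith [min_le_right σ₀ (σ₅ / 2)]) R]
    with n hn1 hn_chain hn_priv hn_join hn2 hnR
  intro V _ G hV hG ι _ B hK hB
  obtain ⟨t, ht1, ht2⟩ := hn_chain
  have hn1' : (1 : ℝ) ≤ n := by exact_mod_cast hn1.le
  have hγ0 : 0 < (n : ℝ) ^ (1 - c) := Real.rpow_pos_of_pos (by linarith) _
  obtain ⟨φ₄, B₄, b, D, hB₄, hB₄', hb, hD, hDc, hx⟩ := hn_join V G hV hG ι B hK hB
  have hwide' : (n : ℝ) ^ (1 - σ₀) ≤ (n : ℝ) ^ (1 - min σ₀ (σ₅ / 2)) :=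
    Real.rpow_le_rpow_of_exponent_le hn1' (by linarith [min_le_left σ₀ (σ₅ / 2)])
  have hwide : ∀ i, (n : ℝ) ^ (1 - σ₀) ≤ #(B₄ i) := fun i => hwide'.trans (hV ▸ hB₄'.width i)
  obtain ⟨e, g, he, hge⟩ := exists_embedding_pair (ι := Fin (k + 1 + K₄)) k K₄ (by simp)
  have hCC : ∀ i < k, ∀ j < k, i ≠ j → Disjoint (B₄ (e i)) (B₄ (e j)) := fun i hi j hj hij =>
    hB₄'.disj _ _ fun h => hij (he i j (by omega) (by omega) h)
  have hDd : ∀ i, Disjoint D (B₄ i) := fun i =>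
    (hB.disj b (φ₄ i) (hb i).symm).mono hD (hB₄ i)
  obtain ⟨x, hxD, hxlay⟩ := exists_card_lay_ge hγ0 hG (fun i => B₄ (e i)) k t D
    (fun i _ => by exact_mod_cast ht1.trans (hwide _)) (by linarith) ht2
    (fun i _ => hDd _) hCC
  have hxn : ∀ i, x ∉ B₄ i := fun i h => disjoint_left.1 (hDd i) hxD h
  have hK₄0 : 0 < K₄ := by positivity
  have : Nonempty (Fin K₄) := ⟨⟨0, hK₄0⟩⟩
  obtain ⟨m, r₃, Y, hr₃0, hr₃, hY, hYc, hYm, h₃⟩ := exists_hub hγ0 hG (C := fun i => B₄ (e i))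
    (fun i _ => hxn _) hCC hxlay (fun i => B₄ (g i)) (fun i => hn2.trans (hwide _))
    (fun i => hxn _) (fun i j hj => hB₄'.disj _ _ (hge i j hj.le)) (fun i => (hx x hxD (g i)).1)
    (fun j hj u hu i => by
      have h1 := hB₄'.link (e j) (g i) (hge i j hj.le) u hu
      have h2 : min (1 / 8) (lam₅ / R) * #(B₄ (g i)) ≤ 1 / 8 * #(B₄ (g i)) := by
        gcongr; exact min_le_left _ _
      have h3 : (8 : ℝ) * #(nbr G u (B₄ (g i))) ≤ #(B₄ (g i)) := by linarith
      exact_mod_cast h3)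
  have hYc' : ∀ i, #(B₄ (g i)) ≤ 4 * (k + 1) * #(Y i) := by
    intro i
    by_cases h : i = m
    · subst h; exact hYm
    · refine (hYc i h).trans ?_
      gcongr; omega
  obtain ⟨r, S, Z, hrT, hS, hZ⟩ := exists_uniform (T := 2 * k + 4) (s := K₅ + 1) Y
    (fun i v r => 0 < r ∧ ∃ (p : ℕ → V) (d : ℕ → ι), IndPath G p r ∧ p 0 = x ∧
        p r = v ∧ (∀ a, 0 < a → a < r → p a ∈ B (d a) ∧ d a ≠ b ∧ (∀ j, d a ≠ φ₄ j) ∧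
        ∀ j, j ≠ g i → ∀ u ∈ B₄ j, ¬ G.Adj (p a) u) ∧
        ∀ a a', 0 < a → a < r → 0 < a' → a' < r → d a = d a' → a = a')
    (fun i v hv => by
      obtain ⟨r, p, d, hr0, hr, h⟩ := (hx x hxD (g i)).2 v (hY i hv)
      exact ⟨r, by omega, hr0, p, d, h⟩) (by omega) (by rw [Fintype.card_fin])
  -- The hub set `m` is kept whole whether or not it has the chosen length: links enter it only
  -- through the hub paths and never use its joining paths.
  let Z' : Fin K₄ → Finset V := fun i => if i = m then Y i else Z i
  have hZ'Y : ∀ i, i = m ∨ i ∈ S → Z' i ⊆ Y i := by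
    intro i hi
    simp only [Z']
    split_ifs with h
    · exact Subset.rfl
    · exact (hZ i (hi.resolve_left h)).1
  have hZ'c : ∀ i, i = m ∨ i ∈ S → #(Y i) ≤ (2 * k + 4) * #(Z' i) := by
    intro i hi
    simp only [Z']
    split_ifs with h
    · exact Nat.le_mul_of_pos_left _ (by omega)
    · exact (hZ i (hi.resolve_left h)).2.1
  let Y' : Fin K₄ → Finset V := fun i => if i = m ∨ i ∈ S then Z' i else Y i
  let s : {i // i = m ∨ i ∈ S} ↪ Fin K₄ := Function.Embedding.subtype _
  have hZb : Blockade G σ₅ lam₅ fun i => Z' (s i) := by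
    have := hB₄'.shrink (σ' := σ₅) (R := R) (s.trans g) (B' := fun i => Z' (s i))
      (fun i => (hZ'Y i i.2).trans (hY i)) (by positivity) hR0
      (fun i => by
        have h1 : #(B₄ (g (s i))) ≤ 4 * (k + 1) * ((2 * k + 4) * #(Z' (s i))) :=
          (hYc' (s i)).trans (by gcongr; exact hZ'c i i.2)
        have h2 : (#(B₄ (g (s i))) : ℝ) ≤ 4 * (k + 1) * ((2 * k + 4) * #(Z' (s i))) := by
          exact_mod_cast h1
        rw [hR]
        exact h2.trans (le_of_eq (by ring))) (by rw [hV]; exact hnR)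
    have hV1 : 1 ≤ Fintype.card V := by omega
    refine this.mono ?_ le_rfl hV1
    calc R * min (1 / 8) (lam₅ / R) ≤ R * (lam₅ / R) := by gcongr; exact min_le_right _ _
      _ = lam₅ := by field_simp
  obtain ⟨φ, B', hB'Z, hB', hφ, hw⟩ := hn_priv V G hV hG {i // i = m ∨ i ∈ S} (fun i => Z' (s i))
    (by
      have h1 : #S ≤ Fintype.card {i // i = m ∨ i ∈ S} := by
        rw [Fintype.card_subtype]
        exact card_le_card fun i hi => by simp [hi]
      omega) hZb ⟨m, Or.inl rfl⟩ ⟨m, Or.inl rfl⟩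
  have hφm : ∀ i, s (φ i) ≠ m := fun i h => (hφ i).1 (Subtype.ext h)
  have hφS : ∀ i, s (φ i) ∈ S := fun i => (φ i).2.resolve_left (hφm i)
  have hB'Z' : ∀ i, B' i ⊆ Z (s (φ i)) := fun i => by
    have := hB'Z i
    simp only [Z', if_neg (hφm i)] at this
    exact this
  have hB'Y : ∀ i, B' i ⊆ Y (s (φ i)) := fun i => (hB'Z' i).trans (hZ _ (hφS i)).1
  refine ⟨((φ.trans s).trans g).trans φ₄, B',
    fun i => ((hB'Y i).trans (hY _)).trans (hB₄ _), hB', ?_⟩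
  -- That `r` is positive can be read only from an actual vertex; if there is none, every length
  -- works vacuously.
  rcases isEmpty_or_nonempty {i : ι' // (B' i).Nonempty} with hemp | ⟨⟨i₀, v₀, hv₀⟩⟩
  · refine ⟨2, le_rfl, by omega, fun i _ _ v hv => ?_⟩
    exact (hemp.false ⟨i, v, hv⟩).elim
  have hr0 := ((hZ _ (hφS i₀)).2.2 v₀ (hB'Z' i₀ hv₀)).1
  refine ⟨r + r₃ + 1, by omega, by omega, ?_⟩
  refine linked_of_paths (φ := φ.trans s) hB₄ hb (hD hxD) hr0 (by omega)
    (fun a b ha hb => he a b ha.le hb.le) (fun i a ha => hge i a ha.le) hY h₃ hφm hB'Y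
    (fun i v hv => ((hZ _ (hφS i)).2.2 v (hB'Z' i hv)).2) ?_
  intro i v hv
  obtain ⟨w, hw1, hw2⟩ := hw i v hv
  exact ⟨w, by simpa [Z', s] using hw1, hw2⟩

/-- Links of length `3 * k + 5` can be found in every sufficiently good blockade. -/
theorem forces_linked {c : ℝ} (hc1 : c < 1) {k : ℕ} (hk : 1 < (k + 1) * c) :
    Forces.{u} c (Linked (3 * k + 5)) := by
  have hc : 0 < c := by
    by_contra! h
    have : ((k : ℝ) + 1) * c ≤ 0 := mul_nonpos_of_nonneg_of_nonpos (by positivity) h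
    linarith
  -- Raise the lower bound on the length by one per round: links already of length `3 * k + 5` are
  -- restricted, shorter ones are extended by a private neighbour.
  have key : ∀ s, s + 2 ≤ 3 * k + 5 → Forces.{u} c fun G _ _ B φ B' =>
      ∃ ℓ, s + 2 ≤ ℓ ∧ ℓ ≤ 3 * k + 5 ∧ Linked ℓ G B φ B' := by
    intro s
    induction s with
    | zero => exact fun _ => forces_linked_le hc1 hk
    | succ s ih =>
      intro hs ι' _ σ' lam' hσ' hlam'
      obtain ⟨K₁, σ₁, lam₁, hσ₁, hlam₁, hpriv⟩ := exists_private_nbrs.{u} hc ι' hσ' hlam'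
      obtain ⟨K, σ, lam, hσ, hlam, hlink⟩ := ih (by omega) (Fin (K₁ + 1)) σ₁ lam₁ hσ₁ hlam₁
      refine ⟨K, σ, lam, hσ, hlam, ?_⟩
      filter_upwards [hpriv, hlink] with n hn₁ hn₂
      intro V _ G hV hG ι _ B hK hB
      obtain ⟨φ₁, B₁, hB₁, hB₁', ℓ, hℓs, hℓ, hL⟩ := hn₂ V G hV hG ι B hK hB
      obtain ⟨φ₂, B₂, hB₂, hB₂', hm, hw⟩ := hn₁ V G hV hG _ B₁ (by simp) hB₁' 0 0
      refine ⟨φ₂.trans φ₁, B₂, fun i => (hB₂ i).trans (hB₁ _), hB₂', ?_⟩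
      rcases hℓ.lt_or_eq with h | h
      · exact ⟨ℓ + 1, by omega, by omega,
          hL.extend (by omega) hB₁ φ₂ hB₂ (fun i => (hm i).1) hw⟩
      · exact ⟨ℓ, by omega, hℓ, hL.restrict φ₂ hB₂⟩
  intro ι' _ σ' lam' hσ' hlam'
  obtain ⟨K, σ, lam, hσ, hlam, h⟩ := key (3 * k + 3) le_rfl ι' σ' lam' hσ' hlam'
  refine ⟨K, σ, lam, hσ, hlam, ?_⟩
  filter_upwards [h] with n hn
  intro V _ G hV hG ι _ B hK hB
  obtain ⟨φ, B', h1, h2, ℓ, hℓ1, hℓ2, hL⟩ := hn V G hV hG ι B hK hB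
  have : ℓ = 3 * k + 5 := by omega
  exact ⟨φ, B', h1, h2, this ▸ hL⟩

end Links

end PurePairs

namespace PurePairs

/-! ### Long ears in sparse graphs -/

section Ears

open Finset Classical

variable {W : Type*}

/-- A graph of minimum degree at least two all of whose subgraphs are sparse has long ears. -/
theorem exists_ear (H : SimpleGraph W) {S : Finset W} (hS : S.Nonempty)
    (hdeg : ∀ v ∈ S, 2 ≤ #(nbr H v S)) {d : ℝ} {L : ℕ} (hL : 0 < L) (hd : 3 * L * d ≤ 1)
    (hsparse : ∀ T ⊆ S, T.Nonempty → (1 - d) * (∑ v ∈ T, (#(nbr H v T) : ℝ)) ≤ 2 * (#T - 1)) :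
    ∃ q : ℕ → W, (∀ a ≤ L, q a ∈ S) ∧ (∀ a b, a ≤ L → b ≤ L → q a = q b → a = b) ∧
      (∀ a < L, H.Adj (q a) (q (a + 1))) ∧
      ∀ a, 0 < a → a < L → ∀ u ∈ S, H.Adj (q a) u → u = q (a - 1) ∨ u = q (a + 1) := by
  by_contra hno
  have ho : ∀ a b, ∃ c, b ∈ S → c ∈ S ∧ H.Adj b c ∧ c ≠ a := by
    intro a b
    by_cases hb : b ∈ S
    · obtain ⟨c, hc, hca⟩ := exists_mem_ne (hdeg b hb) a
      exact ⟨c, fun _ => ⟨(mem_nbr.1 hc).1, (mem_nbr.1 hc).2, hca⟩⟩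
    · exact ⟨a, fun h => absurd h hb⟩
  choose o ho using ho
  have hL1 : (1 : ℝ) ≤ L := by exact_mod_cast hL
  have hd1 : d ≤ 1 / 3 := by
    by_contra! h
    nlinarith
  -- A fixed rule for continuing a walk without turning back. At a vertex of degree two the
  -- continuation is forced, so there the rule also retraces walks backwards.
  let nxt : (Σ _ : W, W) → Σ _ : W, W := fun x => ⟨x.2, o x.1 x.2⟩
  set darts : Finset (Σ _ : W, W) := S.sigma fun v => nbr H v S with hdarts
  have hmem : ∀ x, x ∈ darts ↔ x.1 ∈ S ∧ x.2 ∈ S ∧ H.Adj x.1 x.2 := by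
    intro x; rw [hdarts, mem_sigma, mem_nbr]
  have hnxt : ∀ x ∈ darts, nxt x ∈ darts := by
    intro x hx
    rw [hmem] at hx ⊢
    have := ho x.1 x.2 hx.2.1
    exact ⟨hx.2.1, this.1, this.2.1⟩
  have hwalk : ∀ x ∈ darts, ∃ p : ℕ → W, p 0 = x.1 ∧ p 1 = x.2 ∧ (∀ n, p n ∈ S) ∧
      (∀ n, H.Adj (p n) (p (n + 1))) ∧ ∀ n, p (n + 2) ≠ p n := by
    intro x hx
    have h1 : ∀ n, nxt^[n] x ∈ darts := by
      intro n
      induction n with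
      | zero => exact hx
      | succ n ih => rw [Function.iterate_succ_apply']; exact hnxt _ ih
    have h2 : ∀ n, (nxt^[n + 1] x).1 = (nxt^[n] x).2 := by
      intro n
      rw [Function.iterate_succ_apply']
    refine ⟨fun n => (nxt^[n] x).1, rfl, h2 0, fun n => ((hmem _).1 (h1 n)).1, fun n => ?_,
      fun n => ?_⟩
    · dsimp only
      rw [h2]; exact ((hmem _).1 (h1 n)).2.2
    · dsimp only
      rw [h2, Function.iterate_succ_apply']
      exact (ho _ _ ((hmem _).1 (h1 n)).2.1).2.2
  have hpair : ∀ (p : ℕ → W), (∀ n, p n ∈ S) → (∀ n, H.Adj (p n) (p (n + 1))) →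
      (∀ n, p (n + 2) ≠ p n) → ∀ n, #(nbr H (p (n + 1)) S) < 3 → ∀ u ∈ S, H.Adj (p (n + 1)) u →
      u = p n ∨ u = p (n + 2) := by
    intro p hpS hpa hpn n hn u hu hau
    by_contra! h
    have h1 : ({u, p n, p (n + 2)} : Finset W) ⊆ nbr H (p (n + 1)) S := by
      intro w hw
      simp only [mem_insert, mem_singleton] at hw
      rw [mem_nbr]
      rcases hw with rfl | rfl | rfl
      · exact ⟨hu, hau⟩
      · exact ⟨hpS _, (hpa n).symm⟩
      · exact ⟨hpS _, hpa (n + 1)⟩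
    have h2 := card_le_card h1
    rw [card_eq_three.2 ⟨u, p n, p (n + 2), h.1, h.2, (hpn n).symm, rfl⟩] at h2
    omega
  -- If `p 1, …, p (L - 1)` all had degree two, then `p 0, …, p L` would be an ear, or the walk
  -- would close into a cycle on a set `T` of at most `L` vertices. Sparsity on `T` then gives `1 ≤
  -- d * |T| ≤ d * L`, which is impossible.
  have hbranch : ∀ (p : ℕ → W), (∀ n, p n ∈ S) → (∀ n, H.Adj (p n) (p (n + 1))) →
      (∀ n, p (n + 2) ≠ p n) → ∃ i, i + 1 < L ∧ 3 ≤ #(nbr H (p (i + 1)) S) := by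
    intro p hpS hpa hpn
    by_contra! h2
    have htwo : ∀ i, i + 1 < L → ∀ u ∈ S, H.Adj (p (i + 1)) u → u = p i ∨ u = p (i + 2) :=
      fun i hi => hpair p hpS hpa hpn i (h2 i hi)
    have hrep : ∃ j, j ≤ L ∧ ∃ i < j, p i = p j := by
      by_contra! h
      refine hno ⟨p, fun a _ => hpS a, ?_, fun a _ => hpa a, ?_⟩
      · intro a b ha hb hab
        rcases lt_trichotomy a b with hlt | hlt | hlt
        · exact absurd hab (h b hb a hlt)
        · exact hlt
        · exact absurd hab.symm (h a ha b hlt)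
      · intro a ha0 ha u hu hau
        obtain ⟨a, rfl⟩ : ∃ a', a = a' + 1 := ⟨a - 1, by omega⟩
        exact htwo a ha u hu hau
    obtain ⟨hjL, i, hij, hpij⟩ := Nat.find_spec hrep
    have hmin : ∀ a b, a < b → b < Nat.find hrep → p a ≠ p b := fun a b hab hb h =>
      Nat.find_min hrep hb ⟨hb.le.trans hjL, a, hab, h⟩
    set j := Nat.find hrep with hj
    obtain ⟨j', hj'⟩ : ∃ j', j = j' + 1 := ⟨j - 1, by omega⟩
    rw [hj'] at hjL hij hpij hmin
    -- The first repetition is a return to the start: a later `p i` has degree two, so the vertex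
    -- before the return would be one of its two known neighbours, giving an earlier repetition, a
    -- loop or a step back.
    have hi0 : i = 0 := by
      by_contra hi
      obtain ⟨i', rfl⟩ : ∃ i', i = i' + 1 := ⟨i - 1, by omega⟩
      rcases htwo i' (by omega) (p j') (hpS _) (by rw [hpij]; exact (hpa j').symm) with h | h
      · exact hmin i' j' (by omega) (by omega) h.symm
      · rcases lt_trichotomy (i' + 2) j' with h' | h' | h'
        · exact hmin _ _ h' (by omega) h.symm
        · subst h'; exact hpn (i' + 1) hpij.symm
        · have : i' + 1 = j' := by omega
          subst this
          exact (hpa (i' + 1)).ne hpij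
    subst hi0
    have hj2 : 2 ≤ j' := by
      by_contra! h
      interval_cases j'
      · exact (hpa 0).ne hpij
      · exact hpn 0 hpij.symm
    set T := (range (j' + 1)).image p with hT
    have hTc : #T = j' + 1 := by
      rw [hT, card_image_of_injOn, card_range]
      intro a ha b hb hab
      simp only [coe_range, Set.mem_Iio] at ha hb
      rcases lt_trichotomy a b with hlt | hlt | hlt
      · exact absurd hab (hmin a b hlt hb)
      · exact hlt
      · exact absurd hab.symm (hmin b a hlt ha)
    have hTm : ∀ a ≤ j' + 1, p a ∈ T := by
      intro a ha
      rcases ha.lt_or_eq with h | h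
      · exact mem_image.2 ⟨a, mem_range.2 h, rfl⟩
      · rw [h, ← hpij]; exact mem_image.2 ⟨0, by simp, rfl⟩
    have hTd : ∀ v ∈ T, (2 : ℝ) ≤ #(nbr H v T) := by
      intro v hv
      obtain ⟨a, ha, rfl⟩ := mem_image.1 hv
      rw [mem_range] at ha
      have : ∃ x y, x ∈ T ∧ y ∈ T ∧ x ≠ y ∧ H.Adj (p a) x ∧ H.Adj (p a) y := by
        rcases Nat.eq_zero_or_pos a with rfl | h0
        · exact ⟨p 1, p j', hTm _ (by omega), hTm _ (by omega), hmin 1 j' (by omega) (by omega),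
            hpa 0, by rw [hpij]; exact (hpa j').symm⟩
        · obtain ⟨a, rfl⟩ : ∃ a', a = a' + 1 := ⟨a - 1, by omega⟩
          exact ⟨p a, p (a + 2), hTm _ (by omega), hTm _ (by omega), (hpn a).symm,
            (hpa a).symm, hpa (a + 1)⟩
      obtain ⟨x, y, hx, hy, hxy, hax, hay⟩ := this
      have h3 := card_le_card (show ({x, y} : Finset W) ⊆ nbr H (p a) T by
        intro w hw
        simp only [mem_insert, mem_singleton] at hw
        rcases hw with rfl | rfl
        · exact mem_nbr.2 ⟨hx, hax⟩
        · exact mem_nbr.2 ⟨hy, hay⟩)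
      rw [card_pair hxy] at h3
      exact_mod_cast h3
    have h3 := hsparse T (fun v hv => by
      obtain ⟨a, -, rfl⟩ := mem_image.1 hv
      exact hpS a) ⟨_, hTm 0 (by omega)⟩
    have h4 : (#T : ℝ) * 2 ≤ ∑ v ∈ T, (#(nbr H v T) : ℝ) := by
      rw [← nsmul_eq_mul]; exact card_nsmul_le_sum _ _ _ hTd
    have h5 : (#T : ℝ) ≤ L := by rw [hTc]; exact_mod_cast hjL
    have h6 : (0 : ℝ) < #T := by rw [hTc]; positivity
    have h7 : (1 - d) * (#T * 2) ≤ (1 - d) * ∑ v ∈ T, (#(nbr H v T) : ℝ) := by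
      gcongr; linarith
    have h8 : 1 ≤ d * #T := by linarith
    have h9 : 0 < d := by
      by_contra! h
      have := mul_nonpos_of_nonpos_of_nonneg h h6.le
      linarith
    have h10 : d * #T ≤ d * L := by gcongr
    linarith
  set big : Finset (Σ _ : W, W) := (S.filter fun v => 3 ≤ #(nbr H v S)).sigma fun v => nbr H v S
    with hbig
  -- Walk from a dart to the first vertex of degree at least three and reverse. Retracing is forced,
  -- so the dart is determined by a dart leaving that vertex and one of `L - 1` step counts.
  have hcover : darts ⊆ (big ×ˢ range (L - 1)).image
      fun x => ⟨(nxt^[x.2] x.1).2, (nxt^[x.2] x.1).1⟩ := by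
    intro x hx
    obtain ⟨p, hp0, hp1, hpS, hpa, hpn⟩ := hwalk x hx
    have hex := hbranch p hpS hpa hpn
    obtain ⟨hiL, hi⟩ := Nat.find_spec hex
    have hmin : ∀ a < Nat.find hex, #(nbr H (p (a + 1)) S) < 3 := by
      intro a ha
      have := Nat.find_min hex ha
      by_contra! h
      exact this ⟨by omega, h⟩
    set i := Nat.find hex with hidef
    have hback : ∀ l ≤ i, nxt^[l] ⟨p (i + 1), p i⟩ = ⟨p (i - l + 1), p (i - l)⟩ := by
      intro l
      induction l with
      | zero => intro _; rfl
      | succ l ih =>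
        intro hl
        rw [Function.iterate_succ_apply', ih (by omega)]
        obtain ⟨a, ha⟩ : ∃ a, i - l = a + 1 := ⟨i - l - 1, by omega⟩
        have h1 : i - (l + 1) = a := by omega
        rw [h1, ha]
        have h2 := ho (p (a + 1 + 1)) (p (a + 1)) (hpS _)
        have h3 := (hpair p hpS hpa hpn a (hmin a (by omega)) _ h2.1 h2.2.1).resolve_right h2.2.2
        simp only [nxt, h3]
    refine mem_image.2 ⟨(⟨p (i + 1), p i⟩, i), mem_product.2 ⟨?_, mem_range.2 (by omega)⟩, ?_⟩
    · rw [hbig, mem_sigma, mem_filter, mem_nbr]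
      exact ⟨⟨hpS _, hi⟩, hpS _, (hpa i).symm⟩
    · dsimp only
      rw [hback i le_rfl, Nat.sub_self, zero_add, hp0, hp1]
  have hcard : #darts ≤ #big * (L - 1) := by
    refine (card_le_card hcover).trans (card_image_le.trans ?_)
    rw [card_product, card_range]
  have hdc : #darts = ∑ v ∈ S, #(nbr H v S) := card_sigma _ _
  -- Vertex by vertex, with degree `D`: `6 ≤ 3 * D` if `D = 2`, and `D + 6 ≤ 3 * D` if `D ≥ 3`.
  have hbc : #big + 6 * #S ≤ 3 * #darts := by
    have h1 : #big = ∑ v ∈ S, if 3 ≤ #(nbr H v S) then #(nbr H v S) else 0 := by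
      rw [hbig, card_sigma, sum_filter]
    have h2 : 6 * #S = ∑ _v ∈ S, 6 := by rw [sum_const, smul_eq_mul, mul_comm]
    rw [h1, h2, hdc, mul_sum, ← sum_add_distrib]
    refine sum_le_sum fun v hv => ?_
    have := hdeg v hv
    split_ifs <;> omega
  have hE := hsparse S Subset.rfl hS
  have h1 : (#darts : ℝ) = ∑ v ∈ S, (#(nbr H v S) : ℝ) := by exact_mod_cast hdc
  have h2 : (#darts : ℝ) ≤ #big * (L - 1) := by
    have : (#darts : ℝ) ≤ (#big * (L - 1) : ℕ) := by exact_mod_cast hcard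
    rwa [Nat.cast_mul, Nat.cast_sub hL, Nat.cast_one] at this
  have h3 : (#big : ℝ) + 6 * #S ≤ 3 * #darts := by exact_mod_cast hbc
  have h4 : (2 : ℝ) * #S ≤ #darts := by
    rw [h1, mul_comm, ← nsmul_eq_mul]
    exact card_nsmul_le_sum _ _ _ fun v hv => by exact_mod_cast hdeg v hv
  have h5 : (0 : ℝ) < #S := by exact_mod_cast hS.card_pos
  rw [← h1] at hE
  set E : ℝ := (#darts : ℝ)
  have h6 : 0 < E := by linarith
  -- Sparsity bounds `3 * E - 6 * |S|` by `3 * d * E - 6`. Multiplied by `L - 1` this is less than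
  -- `E`, because `3 * L * d ≤ 1`.
  have h7 : E ≤ (3 * E - 6 * #S) * (L - 1) := h2.trans (by gcongr; linarith)
  have h8 : 3 * E - 6 * #S ≤ 3 * (d * E) - 6 := by linarith
  have h9 : (3 * E - 6 * #S) * (L - 1) ≤ (3 * (d * E) - 6) * (L - 1 : ℝ) := by
    gcongr
  have h10 : 3 * L * d * E ≤ 1 * E := by gcongr
  have h11 : 0 < d * E := by
    linarith
  nlinarith

end Ears

end PurePairs

namespace PurePairs

/-! ### Embedding by adding leaves and ears -/

section Embedding

open Finset Classical Filter

universe u w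

variable {W : Type w}

/-- Every sufficiently good blockade contains an induced copy of `H[S]`, with at most one vertex in
each of its sets. -/
def Embeds (c : ℝ) (H : SimpleGraph W) (S : Finset W) : Prop :=
  ∃ (K : ℕ) (σ lam : ℝ), 0 < σ ∧ 0 < lam ∧ ∀ᶠ n : ℕ in atTop, ∀ (V : Type u) [Fintype V]
    (G : SimpleGraph V), Fintype.card V = n → Coh G ((n : ℝ) ^ (1 - c)) →
    ∀ (ι : Type) [Fintype ι] (B : ι → Finset V), K ≤ Fintype.card ι → Blockade G σ lam B →
    ∃ (f : W → V) (φ : W → ι), (∀ x ∈ S, f x ∈ B (φ x)) ∧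
      (∀ x ∈ S, ∀ y ∈ S, φ x = φ y → x = y) ∧
      ∀ x ∈ S, ∀ y ∈ S, G.Adj (f x) (f y) ↔ H.Adj x y

theorem embeds_empty (c : ℝ) (H : SimpleGraph W) : Embeds.{u} c H ∅ := by
  refine ⟨1, 1, 1, one_pos, one_pos, ?_⟩
  filter_upwards [eventually_gt_atTop 0] with n hn
  intro V _ G hV _ ι _ B hK _
  have hVn : Nonempty V := Fintype.card_pos_iff.1 (by omega)
  have hιn : Nonempty ι := Fintype.card_pos_iff.1 hK
  exact ⟨fun _ => hVn.some, fun _ => hιn.some, by simp⟩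

/-- Reserve one set of the blockade and embed `S` into sets with private neighbours in it. The
private neighbour of the image of the unique neighbour of `x` can serve as the image of `x`. -/
theorem Embeds.insert_leaf {c : ℝ} (hc : 0 < c) {H : SimpleGraph W} {S : Finset W}
    (hS : Embeds.{u} c H S) {x : W}
    (hleaf : ∀ y ∈ S, ∀ y' ∈ S, H.Adj x y → H.Adj x y' → y = y') :
    Embeds.{u} c H (insert x S) := by
  by_cases hxS : x ∈ S
  · rwa [insert_eq_of_mem hxS]
  obtain ⟨K₁, σ₁, lam₁, hσ₁, hlam₁, h₁⟩ := hS
  obtain ⟨K, σ, lam, hσ, hlam, hpriv⟩ :=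
    exists_private_nbrs.{u} hc (Fin (K₁ + #S + 1)) hσ₁ hlam₁
  refine ⟨K + 1, σ, lam, hσ, hlam, ?_⟩
  filter_upwards [h₁, hpriv, eventually_gt_atTop 0] with n hn₁ hn_priv hn0
  intro V _ G hV hG ι _ B hK hB
  have hιn : Nonempty ι := Fintype.card_pos_iff.1 (by omega)
  obtain ⟨m⟩ := hιn
  obtain ⟨φ', B', hB', hB'b, hm, hw⟩ := hn_priv V G hV hG ι B (by omega) hB m m
  obtain ⟨f, φ, hf, hφ, hadj⟩ := hn₁ V G hV hG _ B' (by simp; omega) hB'b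
  obtain ⟨w, hwm, hwadj⟩ : ∃ w ∈ B m, ∀ y ∈ S, G.Adj w (f y) ↔ H.Adj x y := by
    by_cases hnb : ∃ y ∈ S, H.Adj x y
    · obtain ⟨y, hy, hxy⟩ := hnb
      obtain ⟨w, hwm, hwv, hwn⟩ := hw (φ y) (f y) (hf y hy)
      refine ⟨w, hwm, fun y' hy' => ?_⟩
      by_cases hyy : y' = y
      · subst hyy; exact ⟨fun _ => hxy, fun _ => hwv⟩
      · exact ⟨fun h => absurd h (hwn (φ y') (fun h' => hyy (hφ _ hy' _ hy h')) _ (hf _ hy')),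
          fun h => absurd (hleaf _ hy' _ hy h hxy) hyy⟩
    -- If `x` has no neighbour in `S`, take the private neighbour of a vertex in a set that the
    -- embedding does not use; the `#S` additional sets provide one.
    · obtain ⟨j, hj⟩ : ∃ j, j ∉ S.image φ := by
        by_contra! h
        have h1 : #(univ : Finset (Fin (K₁ + #S + 1))) ≤ #(S.image φ) :=
          card_le_card fun j _ => h j
        have h2 : #(S.image φ) ≤ #S := card_image_le
        rw [card_univ, Fintype.card_fin] at h1
        omega
      have hpos : (0 : ℝ) < #(B' j) := by
        refine lt_of_lt_of_le ?_ (hB'b.width j)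
        rw [hV]
        exact Real.rpow_pos_of_pos (by exact_mod_cast hn0) _
      obtain ⟨v, hv⟩ := card_pos.1 (by exact_mod_cast hpos : 0 < #(B' j))
      obtain ⟨w, hwm, -, hwn⟩ := hw j v hv
      refine ⟨w, hwm, fun y hy => ⟨fun h => absurd h ?_, fun h => absurd ⟨y, hy, h⟩ hnb⟩⟩
      exact hwn (φ y) (fun h => hj (mem_image.2 ⟨y, hy, h⟩)) _ (hf y hy)
  have hne : ∀ y ∈ S, y ≠ x := fun y hy h => hxS (h ▸ hy)
  refine ⟨Function.update f x w, Function.update (fun y => φ' (φ y)) x m, ?_, ?_, ?_⟩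
  · intro y hy
    rcases mem_insert.1 hy with rfl | hy
    · simpa using hwm
    · simpa [hne y hy] using hB' _ (hf y hy)
  · intro y hy y' hy' h
    rcases mem_insert.1 hy with rfl | hyS <;> rcases mem_insert.1 hy' with rfl | hyS'
    · rfl
    · simp only [Function.update_self, Function.update_of_ne (hne _ hyS')] at h
      exact absurd h.symm (hm _).1
    · simp only [Function.update_self, Function.update_of_ne (hne _ hyS)] at h
      exact absurd h (hm _).1
    · simp only [Function.update_of_ne (hne _ hyS), Function.update_of_ne (hne _ hyS')] at h
      exact hφ _ hyS _ hyS' (φ'.injective h)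
  · intro y hy y' hy'
    rcases mem_insert.1 hy with rfl | hyS <;> rcases mem_insert.1 hy' with rfl | hyS'
    · simp
    · rw [Function.update_self, Function.update_of_ne (hne _ hyS')]
      exact hwadj _ hyS'
    · rw [Function.update_self, Function.update_of_ne (hne _ hyS), G.adj_comm, H.adj_comm]
      exact hwadj _ hyS
    · rw [Function.update_of_ne (hne _ hyS), Function.update_of_ne (hne _ hyS')]
      exact hadj _ hyS _ hyS'

/-- Embed everything but the interior of the ear in a linked sub-blockade, then use a link between
the images of the ends as the interior. Whether the ends are adjacent is already settled by the
smaller embedding, so links need not control that pair. -/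
theorem Embeds.add_ear {c : ℝ} {H : SimpleGraph W} {S : Finset W} {L : ℕ} (hL : 0 < L)
    (hlink : Forces.{u} c (Linked L)) {q : ℕ → W} (hqS : ∀ a ≤ L, q a ∈ S)
    (hqinj : ∀ a b, a ≤ L → b ≤ L → q a = q b → a = b) (hqadj : ∀ a < L, H.Adj (q a) (q (a + 1)))
    (hq : ∀ a, 0 < a → a < L → ∀ x ∈ S, H.Adj (q a) x → x = q (a - 1) ∨ x = q (a + 1))
    (hS : Embeds.{u} c H (S.filter fun x => ∀ a, 0 < a → a < L → x ≠ q a)) :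
    Embeds.{u} c H S := by
  set S' := S.filter fun x => ∀ a, 0 < a → a < L → x ≠ q a with hS'
  have hS'S : S' ⊆ S := filter_subset _ _
  obtain ⟨K₁, σ₁, lam₁, hσ₁, hlam₁, h₁⟩ := hS
  obtain ⟨K, σ, lam, hσ, hlam, h₂⟩ := hlink (Fin K₁) σ₁ lam₁ hσ₁ hlam₁
  refine ⟨K, σ, lam, hσ, hlam, ?_⟩
  filter_upwards [h₁, h₂] with n hn₁ hn₂
  intro V _ G hV hG ι _ B hK hB
  obtain ⟨φ', B', hB', hB'b, hlinked⟩ := hn₂ V G hV hG ι B hK hB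
  obtain ⟨f, φ, hf, hφ, hadj⟩ := hn₁ V G hV hG _ B' (by simp) hB'b
  have hend : ∀ b ≤ L, (∀ a, 0 < a → a < L → b ≠ a) → q b ∈ S' := fun b hb h =>
    mem_filter.2 ⟨hqS b hb, fun a ha0 ha hba => h a ha0 ha (hqinj b a hb ha.le hba)⟩
  have hq0 : q 0 ∈ S' := hend 0 (by omega) (by omega)
  have hqL : q L ∈ S' := hend L le_rfl (by omega)
  have h0L : φ (q 0) ≠ φ (q L) := fun h => by
    have := hqinj 0 L (by omega) le_rfl (hφ _ hq0 _ hqL h)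
    omega
  obtain ⟨p, d, hp0, hpL, hp, hd, hdinj⟩ :=
    hlinked _ _ h0L _ (hf _ hq0) _ (hf _ hqL)
  -- The position along the ear, an inverse of `q` on `0, …, L`.
  obtain ⟨idx, hidx⟩ : ∃ idx : W → ℕ, ∀ a ≤ L, idx (q a) = a := by
    refine ⟨fun x => if h : ∃ a ≤ L, q a = x then h.choose else 0, fun a ha => ?_⟩
    have h : ∃ b ≤ L, q b = q a := ⟨a, ha, rfl⟩
    dsimp only
    rw [dif_pos h]
    exact hqinj _ _ h.choose_spec.1 ha h.choose_spec.2
  have hout : ∀ x ∈ S, x ∉ S' → ∃ a, 0 < a ∧ a < L ∧ x = q a := by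
    intro x hx hx'
    by_contra! h
    exact hx' (mem_filter.2 ⟨hx, h⟩)
  have hnot : ∀ a, 0 < a → a < L → q a ∉ S' := fun a ha0 ha h => (mem_filter.1 h).2 a ha0 ha rfl
  have hHq : ∀ a b, a < b → b ≤ L → ¬ (a = 0 ∧ b = L) → (H.Adj (q a) (q b) ↔ b = a + 1) := by
    intro a b hab hb hne
    constructor
    · intro h
      rcases Nat.eq_zero_or_pos a with ha | ha
      · rcases hq b (by omega) (by omega) _ (hqS a (by omega)) h.symm with h' | h'
        · have := hqinj _ _ (by omega) (by omega) h'; omega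
        · have := hqinj _ _ (by omega) (by omega) h'; omega
      · rcases hq a ha (by omega) _ (hqS b hb) h with h' | h'
        · have := hqinj _ _ (by omega) (by omega) h'; omega
        · have := hqinj _ _ (by omega) (by omega) h'; omega
    · rintro rfl
      exact hqadj a (by omega)
  have hmixed : ∀ x ∈ S', ∀ a, 0 < a → a < L → (G.Adj (f x) (p a) ↔ H.Adj x (q a)) := by
    intro x hx a ha0 ha
    by_cases hx0 : x = q 0
    · subst hx0
      rw [← hp0, hp 0 a ha0 ha.le (by omega), hHq 0 a ha0 ha.le (by omega)]
    by_cases hxL : x = q L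
    · subst hxL
      rw [← hpL, G.adj_comm, H.adj_comm, hp a L ha le_rfl (by omega), hHq a L ha le_rfl (by omega)]
    constructor
    · intro h
      exact absurd h.symm ((hd a ha0 ha).2.2 (φ x) (fun h => hx0 (hφ _ hx _ hq0 h))
        (fun h => hxL (hφ _ hx _ hqL h)) _ (hf x hx))
    · intro h
      have key : ∀ b ≤ L, x ≠ q b := by
        rintro b hb rfl
        by_cases hb' : 0 < b ∧ b < L
        · exact hnot b hb'.1 hb'.2 hx
        · rcases (by omega : b = 0 ∨ b = L) with rfl | rfl
          · exact hx0 rfl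
          · exact hxL rfl
      rcases hq a ha0 ha x (hS'S hx) h.symm with h' | h'
      · exact absurd h' (key _ (by omega))
      · exact absurd h' (key _ (by omega))
  have hint : ∀ a b, 0 < a → a < L → 0 < b → b < L →
      (G.Adj (p a) (p b) ↔ H.Adj (q a) (q b)) := by
    intro a b ha0 ha hb0 hb
    rcases lt_trichotomy a b with h | h | h
    · rw [hp a b h hb.le (by omega), hHq a b h hb.le (by omega)]
    · subst h; simp
    · rw [G.adj_comm, H.adj_comm, hp b a h ha.le (by omega), hHq b a h ha.le (by omega)]
  refine ⟨fun x => if x ∈ S' then f x else p (idx x),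
    fun x => if x ∈ S' then φ' (φ x) else d (idx x), ?_, ?_, ?_⟩
  · intro x hx
    dsimp only
    by_cases hx' : x ∈ S'
    · rw [if_pos hx', if_pos hx']; exact hB' _ (hf x hx')
    · obtain ⟨a, ha0, ha, rfl⟩ := hout x hx hx'
      rw [if_neg hx', if_neg hx', hidx a ha.le]
      exact (hd a ha0 ha).1
  · intro x hx y hy h
    dsimp only at h
    by_cases hx' : x ∈ S' <;> by_cases hy' : y ∈ S'
    · rw [if_pos hx', if_pos hy'] at h
      exact hφ _ hx' _ hy' (φ'.injective h)
    · obtain ⟨a, ha0, ha, rfl⟩ := hout y hy hy'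
      rw [if_pos hx', if_neg hy', hidx a ha.le] at h
      exact absurd h.symm ((hd a ha0 ha).2.1 _)
    · obtain ⟨a, ha0, ha, rfl⟩ := hout x hx hx'
      rw [if_neg hx', if_pos hy', hidx a ha.le] at h
      exact absurd h ((hd a ha0 ha).2.1 _)
    · obtain ⟨a, ha0, ha, rfl⟩ := hout x hx hx'
      obtain ⟨b, hb0, hb, rfl⟩ := hout y hy hy'
      rw [if_neg hx', if_neg hy', hidx a ha.le, hidx b hb.le] at h
      rw [hdinj a b ha0 ha hb0 hb h]
  · intro x hx y hy
    dsimp only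
    by_cases hx' : x ∈ S' <;> by_cases hy' : y ∈ S'
    · rw [if_pos hx', if_pos hy']
      exact hadj _ hx' _ hy'
    · obtain ⟨a, ha0, ha, rfl⟩ := hout y hy hy'
      rw [if_pos hx', if_neg hy', hidx a ha.le]
      exact hmixed x hx' a ha0 ha
    · obtain ⟨a, ha0, ha, rfl⟩ := hout x hx hx'
      rw [if_neg hx', if_pos hy', hidx a ha.le, G.adj_comm, H.adj_comm]
      exact hmixed y hy' a ha0 ha
    · obtain ⟨a, ha0, ha, rfl⟩ := hout x hx hx'
      obtain ⟨b, hb0, hb, rfl⟩ := hout y hy hy'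
      rw [if_neg hx', if_neg hy', hidx a ha.le, hidx b hb.le]
      exact hint a b ha0 ha hb0 hb

/-- The edge bound passes to subsets. So a vertex of degree at most one, or otherwise the interior
of an ear of length `3 * k + 5`, can be removed and the induction hypothesis applied. -/
theorem embeds_of_sparse {c : ℝ} (hc1 : c < 1) {k : ℕ} (hk : 1 < (k + 1) * c)
    (H : SimpleGraph W) {d : ℝ} (hd : 3 * ((3 * k + 5 : ℕ) : ℝ) * d ≤ 1) (S : Finset W)
    (hsparse : ∀ T ⊆ S, T.Nonempty → (1 - d) * (∑ v ∈ T, (#(nbr H v T) : ℝ)) ≤ 2 * (#T - 1)) :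
    Embeds.{u} c H S := by
  have hc : 0 < c := by
    by_contra! h
    have : ((k : ℝ) + 1) * c ≤ 0 := mul_nonpos_of_nonneg_of_nonpos (by positivity) h
    linarith
  induction S using Finset.strongInduction with
  | H S ih =>
    rcases S.eq_empty_or_nonempty with rfl | hne
    · exact embeds_empty c H
    by_cases hdeg : ∀ v ∈ S, 2 ≤ #(nbr H v S)
    · obtain ⟨q, hqS, hqinj, hqadj, hq⟩ := exists_ear H hne hdeg (by omega) hd hsparse
      refine Embeds.add_ear (by omega) (forces_linked hc1 hk) hqS hqinj hqadj hq (ih _ ?_ ?_)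
      · refine filter_ssubset.2 ⟨q 1, hqS 1 (by omega), fun h => ?_⟩
        exact h 1 one_pos (by omega) rfl
      · exact fun T hT => hsparse T (hT.trans (filter_subset _ _))
    · push Not at hdeg
      obtain ⟨x, hx, hx2⟩ := hdeg
      rw [← insert_erase hx]
      refine (ih _ (erase_ssubset hx) fun T hT => hsparse T (hT.trans (erase_subset _ _))).insert_leaf
        hc fun y hy y' hy' hxy hxy' => ?_
      exact card_le_one.1 (Nat.le_of_lt_succ hx2) y (mem_nbr.2 ⟨mem_of_mem_erase hy, hxy⟩) y'
        (mem_nbr.2 ⟨mem_of_mem_erase hy', hxy'⟩)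

/-! ### From congestion, sparsity and coherence to blockades -/

theorem sum_card_nbr_le_of_congestion_le [Fintype W] (H : SimpleGraph W) {d : ℝ}
    (hd : congestion H ≤ d) {T : Finset W} (hT : T.Nonempty) :
    (1 - d) * (∑ v ∈ T, (#(nbr H v T) : ℝ)) ≤ 2 * (#T - 1) := by
  -- For the subgraph induced on `T` the degree sum is twice the number of edges, and the bound on
  -- its congestion value rearranges to the claim.
  set J : H.Subgraph := (⊤ : H.Subgraph).induce T with hJ
  have hJadj : ∀ v w, J.Adj v w ↔ v ∈ T ∧ w ∈ T ∧ H.Adj v w := by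
    intro v w; simp [hJ]
  have hE : ∑ v ∈ T, #(nbr H v T) = 2 * J.edgeSet.ncard := by
    have h1 := J.spanningCoe.sum_degrees_eq_twice_card_edges
    have h2 : J.edgeSet.ncard = #J.spanningCoe.edgeFinset := by
      rw [← Set.ncard_coe_finset, SimpleGraph.coe_edgeFinset, SimpleGraph.Subgraph.edgeSet_spanningCoe]
    rw [h2, ← h1, ← sum_subset (subset_univ T)]
    · refine sum_congr rfl fun v hv => ?_
      rw [← SimpleGraph.card_neighborFinset_eq_degree]
      congr 1
      ext w
      simp [mem_nbr, hJadj, hv]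
    · intro v _ hv
      rw [← SimpleGraph.card_neighborFinset_eq_degree, card_eq_zero]
      ext w
      simp [hJadj, hv]
  have hE' : ∑ v ∈ T, (#(nbr H v T) : ℝ) = 2 * J.edgeSet.ncard := by exact_mod_cast hE
  have hT1 : (1 : ℝ) ≤ #T := by exact_mod_cast hT.card_pos
  rw [hE']
  rcases J.edgeSet.eq_empty_or_nonempty with h0 | h0
  · rw [h0, Set.ncard_empty, Nat.cast_zero]; linarith
  have hH : H.edgeSet.Nonempty := h0.mono J.edgeSet_subset
  have h3 := ((isGreatest_congestion H hH).2 ⟨J, h0, rfl⟩).trans hd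
  have hpos : (0 : ℝ) < J.edgeSet.ncard := by
    exact_mod_cast (Set.ncard_pos (Set.toFinite _)).2 h0
  have hv : J.verts.ncard = #T := by
    rw [hJ, SimpleGraph.Subgraph.induce_verts, Set.ncard_coe_finset]
  rw [hv] at h3
  have h4 : 1 - d ≤ ((#T : ℝ) - 1) / J.edgeSet.ncard := by linarith
  rw [le_div_iff₀ hpos] at h4
  linarith

/-- Arbitrary disjoint sets of equal size in a sparse graph form a blockade. -/
theorem exists_blockade {V : Type u} [Fintype V] {G : SimpleGraph V} {ε σ lam : ℝ} {K : ℕ}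
    (hK : 0 < K) (hG : IsSparse G ε) (hε : ε * (2 * K) ≤ lam) (hlam : 0 < lam)
    (hV : 2 * K ≤ Fintype.card V)
    (hσ : 2 * K * (Fintype.card V : ℝ) ^ (1 - σ) ≤ Fintype.card V) :
    ∃ B : Fin K → Finset V, Blockade G σ lam B := by
  set s := Fintype.card V / K with hs
  obtain ⟨e⟩ : Nonempty (Fin K × Fin s ↪ V) := Function.Embedding.nonempty_of_card_le (by
    simp only [Fintype.card_prod, Fintype.card_fin]
    exact Nat.mul_div_le _ _)
  -- Rounding down costs at most a factor 2, as each block is nonempty.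
  have hcard : (Fintype.card V : ℝ) ≤ 2 * K * s := by
    have h1 : Fintype.card V < K * (s + 1) := by
      rw [hs]; exact Nat.lt_mul_div_succ _ hK
    have h2 : 1 ≤ s := (Nat.le_div_iff_mul_le hK).2 (by omega)
    have h3 : Fintype.card V ≤ 2 * K * s := by nlinarith
    exact_mod_cast h3
  have hK' : (0 : ℝ) < K := by exact_mod_cast hK
  refine ⟨fun i => univ.map ⟨fun a => e (i, a), fun a b h => by simpa using h⟩, ?_, ?_, ?_⟩
  · intro i j hij
    rw [disjoint_left]
    intro v hv hv'
    obtain ⟨a, -, rfl⟩ := mem_map.1 hv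
    obtain ⟨b, -, hb⟩ := mem_map.1 hv'
    have := e.injective hb
    exact hij (congrArg Prod.fst this).symm
  · intro i
    rw [card_map, card_univ, Fintype.card_fin]
    have := hσ.trans hcard
    exact le_of_mul_le_mul_left this (by positivity)
  · intro i j _ v _
    rw [card_map, card_univ, Fintype.card_fin]
    have h1 : (#(nbr G v (univ.map ⟨fun a => e (j, a), fun a b h => by simpa using h⟩)) : ℝ) ≤
        (G.neighborSet v).ncard := by
      rw [← Set.ncard_coe_finset]
      exact_mod_cast Set.ncard_le_ncard (fun w hw => (mem_nbr.1 hw).2) (Set.toFinite _)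
    refine h1.trans ((hG v).le.trans ?_)
    have h2 : 0 ≤ ε := by
      have : (0 : ℝ) ≤ (G.neighborSet v).ncard := by positivity
      have h4 := this.trans_lt (hG v)
      exact (pos_of_mul_pos_left h4 (by positivity)).le
    calc ε * Fintype.card V ≤ ε * (2 * K * s) := by gcongr
      _ = ε * (2 * K) * s := by ring
      _ ≤ lam * s := by gcongr

theorem coh_of_isCoherent {V : Type u} {G : SimpleGraph V} {γ γ' : ℝ} (h : IsCoherent G γ γ)
    (hγ : γ ≤ γ') : Coh G γ' := by
  intro A B hAB hA hB
  by_contra! hno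
  exact h ⟨A, B, ⟨hAB, hno⟩, hγ.trans hA, hγ.trans hB⟩

/-- A sparse graph with at least two vertices is not coherent down to single vertices. -/
theorem one_lt_of_isCoherent {V : Type u} [Fintype V] {G : SimpleGraph V} {ε γ : ℝ}
    (hV : 1 < Fintype.card V) (hG : IsSparse G ε) (h : IsCoherent G γ γ)
    (hε : ε ≤ 1 / 2) : 1 < γ := by
  by_contra! hγ
  have hadj : ∀ v w, v ≠ w → G.Adj v w := by
    intro v w hvw
    obtain ⟨a, ha, b, hb, hab⟩ := coh_of_isCoherent h hγ {v} {w} (by simpa using hvw) (by simp)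
      (by simp)
    rw [mem_singleton] at ha hb
    rwa [ha, hb] at hab
  obtain ⟨v⟩ : Nonempty V := Fintype.card_pos_iff.1 (by omega)
  have h1 : G.neighborSet v = ((univ.erase v : Finset V) : Set V) := by
    ext w
    simp only [SimpleGraph.mem_neighborSet, coe_erase, coe_univ, Set.mem_sdiff, Set.mem_univ,
      true_and, Set.mem_singleton_iff]
    exact ⟨fun h => h.ne', fun h => hadj v w (Ne.symm h)⟩
  have h2 := hG v
  rw [h1, Set.ncard_coe_finset, card_erase_of_mem (mem_univ v), card_univ,
    Nat.cast_sub hV.le] at h2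
  have h3 : (2 : ℝ) ≤ Fintype.card V := by exact_mod_cast hV
  push_cast at h2
  nlinarith

end Embedding

end PurePairs

theorem theorem2p3 {W : Type*} [Fintype W] (H : SimpleGraph W) (c : ℝ) (hc : 0 < c)
    (hH : PurePairs.congestion H ≤ c / (9 + 15 * c)) :
    ∃ ε : ℝ, 0 < ε ∧ ∀ {V : Type*} [Fintype V] (G : SimpleGraph V),
      1 < Fintype.card V →
      PurePairs.IsSparse G ε →
      PurePairs.IsCoherent G (ε * (Fintype.card V : ℝ) ^ (1 - c))
        (ε * (Fintype.card V : ℝ) ^ (1 - c)) →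
      H.IsIndContained G := by
  rcases le_or_gt 1 c with hc1 | hc1
  -- For `c ≥ 1` the coherence threshold is at most `1 / 2`, so no graph satisfies the hypotheses.
  · refine ⟨1 / 2, by norm_num, fun {V} _ G hV hG hcoh => ?_⟩
    have h1 := PurePairs.one_lt_of_isCoherent hV hG hcoh le_rfl
    have h2 : (Fintype.card V : ℝ) ^ (1 - c) ≤ 1 :=
      Real.rpow_le_one_of_one_le_of_nonpos (by exact_mod_cast hV.le) (by linarith)
    linarith
  set k := ⌊1 / c⌋₊ with hk
  have hk1 : 1 < ((k : ℝ) + 1) * c := by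
    rw [← div_lt_iff₀ hc]; exact Nat.lt_floor_add_one _
  have hkc : k * c ≤ 1 := by
    rw [← le_div_iff₀ hc]; exact Nat.floor_le (by positivity)
  -- This is where the congestion bound comes from: `3 * (3 * k + 5) * c = 9 * k * c + 15 * c ≤ 9 +
  -- 15 * c`, since `k * c ≤ 1`.
  have hd : 3 * ((3 * k + 5 : ℕ) : ℝ) * (c / (9 + 15 * c)) ≤ 1 := by
    rw [mul_div_assoc', div_le_one (by positivity)]
    push_cast
    linarith
  obtain ⟨K, σ, lam, hσ, hlam, hemb⟩ := PurePairs.embeds_of_sparse hc1 hk1 H hd Finset.univ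
    fun T _ hT => PurePairs.sum_card_nbr_le_of_congestion_le H hH hT
  have hlarge := (hemb.and (PurePairs.eventually_mul_rpow_le (a := 1 - σ) (b := 1) (by linarith)
    (2 * (K + 1 : ℕ)))).and (Filter.eventually_ge_atTop (2 * (K + 1)))
  obtain ⟨n₀, hn₀⟩ := Filter.eventually_atTop.1 hlarge
  -- `1 / 2` keeps the coherence threshold above 1, `1 / (n₀ + 1)` then excludes graphs with fewer
  -- than `n₀` vertices, and the last term makes equal blocks sufficiently sparse to each other.
  refine ⟨min (1 / 2) (min (1 / (n₀ + 1)) (lam / (2 * (K + 1 : ℕ)))), by positivity,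
    fun {V} _ G hV hG hcoh => ?_⟩
  set ε := min (1 / 2 : ℝ) (min (1 / (n₀ + 1)) (lam / (2 * (K + 1 : ℕ)))) with hε
  have hε0 : 0 < ε := by positivity
  have hε1 : ε ≤ 1 / 2 := min_le_left _ _
  have hε2 : ε ≤ 1 / (n₀ + 1) := (min_le_right _ _).trans (min_le_left _ _)
  have hε3 : ε ≤ lam / (2 * (K + 1 : ℕ)) := (min_le_right _ _).trans (min_le_right _ _)
  have hV1 : (1 : ℝ) ≤ Fintype.card V := by exact_mod_cast hV.le
  have hn : n₀ ≤ Fintype.card V := by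
    by_contra! hn
    have h1 := PurePairs.one_lt_of_isCoherent hV hG hcoh hε1
    have h2 : (Fintype.card V : ℝ) ^ (1 - c) ≤ Fintype.card V := by
      conv_rhs => rw [← Real.rpow_one (Fintype.card V : ℝ)]
      exact Real.rpow_le_rpow_of_exponent_le hV1 (by linarith)
    have h3 : (Fintype.card V : ℝ) ≤ n₀ + 1 := by
      have : (Fintype.card V : ℝ) < n₀ := by exact_mod_cast hn
      linarith
    have h4 : ε * (Fintype.card V : ℝ) ^ (1 - c) ≤ 1 / (n₀ + 1) * (n₀ + 1) := by
      gcongr; exact h2.trans h3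
    rw [one_div_mul_cancel (by positivity)] at h4
    linarith
  obtain ⟨⟨h1, h2⟩, h3⟩ := hn₀ _ hn
  rw [Real.rpow_one] at h2
  obtain ⟨B, hB⟩ := PurePairs.exists_blockade (σ := σ) (lam := lam) (Nat.succ_pos K) hG
    (by rwa [le_div_iff₀ (by positivity)] at hε3) hlam h3 h2
  obtain ⟨f, φ, hf, hφ, hadj⟩ := h1 V G rfl (PurePairs.coh_of_isCoherent hcoh
    (mul_le_of_le_one_left (by positivity) (by linarith))) (Fin (K + 1)) B (by simp) hB
  refine ⟨⟨⟨f, fun x y hxy => ?_⟩, fun {x y} => hadj x (Finset.mem_univ _) y (Finset.mem_univ _)⟩⟩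
  by_contra hne
  exact PurePairs.ne_of_mem_of_index_ne hB.disj
    (fun h => hne (hφ x (Finset.mem_univ _) y (Finset.mem_univ _) h))
    (hf x (Finset.mem_univ _)) (hf y (Finset.mem_univ _)) hxy
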